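/- **Setting.** A parameter is a triple $p=(b_1,c_0,c_1)\in\mathbb R^3$ with $$0<b_1<1,\qquad b_1-1<c_0<\tfrac1{b_1}-1,\qquad -b_1<c_1<\tfrac{b_1}{1-b_1}.\tag{C}$$ Put $\Phi(A;z)=\frac{az+b}{cz+d}$ for $A=\begin{pmatrix}a&b\\c&d\end{pmatrix}$, and $$A_0=\begin{pmatrix}b_1(c_0+1)&0\\c_0&1\end{pmatrix},\qquad A_1=\begin{pmatrix}1-b_1+c_1&b_1\\c_1&1\end{pmatrix}.$$ There is exactly one continuous distribution function $f$ on $[0,1]$ (so $f(0)=0$, $f(1)=1$, $f$ nondecreasing) with $f(x)=\Phi(A_0;f(2x))$ for $0\le x\le\frac12$ and $f(x)=\Phi(A_1;f(2x-1))$ for $\frac12\le x\le1$; let $\mu_p$ be the probability measure on $[0,1]$ with distribution function $f$. Put $$\alpha=\min\Big\{0,\tfrac{c_0}{1-b_1(c_0+1)},\tfrac{c_1}{b_1}\Big\},\quad \beta=\max\Big\{0,\tfrac{c_0}{1-b_1(c_0+1)},\tfrac{c_1}{b_1}\Big\},\quad G_i(p;y)=\Phi({}^tA_i;y)\ \ (y\in[\alpha,\beta],\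 i=0,1).$$ The dual of $p$ is $\widetilde p=\big(1-b_1,\,-\frac{c_1}{1+c_1},\,-\frac{c_0}{1+c_0}\big)$, which again satisfies (C); quantities formed from $\widetilde p$ carry a tilde. Call $p$ *contracting* if the Lipschitz constant of $G_1(p;\cdot)$ on $[\alpha,\beta]$ is strictly less than $1$. Let $E$ be the set of $p$ satisfying (C) such that $p$ or $\widetilde p$ is contracting. Let $I$ be an open interval containing $0$ and let $t\mapsto p(t)=(b_1(t),c_0(t),c_1(t))\in E$, $t\in I$, be $C^\infty$. Write $\mu_t=\mu_{p(t)}$, $F(t,x)=\mu_t([0,x])$, $G_i(t,y)=G_i(p(t);y)$, and $f_k(x)=\partial_t^kF(0,x)$ for $k\ge1$ and $x\in[0,1]$. (ND) means that one of the following holds (where $b_1,\alpha,\beta$ without argument are taken at $t=0$): * $p(0)$ is contracting and $b_1'(0)(\alpha+1)+b_1(1-b_1)\min\{0,\delta_0,\delta_1\}>0$, where $\delta_i=\min_{y\in[\alpha,\beta]}\frac{\partial_tG_i(0,y)}{1-\partial_yG_i(0,y)}$; * $\widetilde p(0)$ is contracting and $\widetilde b_1{}'(0)(\widetilde\alpha+1)+\widetilde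 b_1(1-\widetilde b_1)\max\{0,\widetilde\delta_0,\widetilde\delta_1\}<0$, where $\widetilde\delta_i=\max_{y\in[\widetilde\alpha,\widetilde\beta]}\frac{\partial_t\widetilde G_i(0,y)}{1-\partial_y\widetilde G_i(0,y)}$. (L) means that for some $a\in(0,1)$, $p(t)=(t+a,0,0)$ for all $t\in I$. **Theorem.** Assume (ND). There is $c\in[0,1]$, with $c<1$ if $\mu_0$ is singular and $c=1$ if $\mu_0$ is absolutely continuous with respect to Lebesgue measure, such that the following hold for $k=1$ and, if (L) holds, for every $k\ge1$ (with the same $c$): * $F(\cdot,x)$ is $k$ times continuously differentiable near $t=0$ for every $x\in[0,1]$, so that $f_k$ is well defined; * (i) $\displaystyle\limsup_{h\to0}\frac{|f_k(x+h)-f_k(x)|}{|h|^c}=+\infty$ for $\mu_0$-a.e. $x$; * (ii) for every nonempty open interval $J\subset[0,1]$, $$\sup_{x,y\in J,\ x>y}\frac{f_k(x)-f_k(y)}{(x-y)^c}=+\infty\quad\text{and}\quad\inf_{x,y\in J,\ x>y}\frac{f_k(x)-f_k(y)}{(x-y)^c}=-\infty;$$ * consequently $f_k$ is of monotonic type on no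 open interval: for every nonempty open interval $J\subset[0,1]$, $$-\infty=\inf_{x,y\in J,\ x\ne y}\frac{f_k(x)-f_k(y)}{x-y}<\sup_{x,y\in J,\ x\ne y}\frac{f_k(x)-f_k(y)}{x-y}=+\infty.$$ -/

import Mathlib

open Set Filter Topology MeasureTheory
open scoped ContDiff NNReal BoundedContinuousFunction

/-- A parameter `(b₁, c₀, c₁)`; it determines the pair of matrices `(A₀, A₁)`. -/
structure DRParam where
  b : ℝ
  c₀ : ℝ
  c₁ : ℝ

/-- The action `z ↦ (a z + b) / (c z + d)` of a real `2 × 2` matrix. -/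
noncomputable def mobius (A : Matrix (Fin 2) (Fin 2) ℝ) (z : ℝ) : ℝ :=
  (A 0 0 * z + A 0 1) / (A 1 0 * z + A 1 1)

namespace DRParam

/-- `b₁ ∈ (0,1)`, `c₀ ∈ (b₁ - 1, 1/b₁ - 1)`, `c₁ ∈ (-b₁, b₁/(1 - b₁))`. -/
def Cond (p : DRParam) : Prop :=
  p.b ∈ Ioo (0 : ℝ) 1 ∧ p.c₀ ∈ Ioo (p.b - 1) (1 / p.b - 1) ∧ p.c₁ ∈ Ioo (-p.b) (p.b / (1 - p.b))

def A₀ (p : DRParam) : Matrix (Fin 2) (Fin 2) ℝ := !![p.b * (p.c₀ + 1), 0; p.c₀, 1]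

def A₁ (p : DRParam) : Matrix (Fin 2) (Fin 2) ℝ := !![1 - p.b + p.c₁, p.b; p.c₁, 1]

/-- The dual parameter, which corresponds to the reflection `x ↦ 1 - x`. -/
noncomputable def dual (p : DRParam) : DRParam where
  b := 1 - p.b
  c₀ := -(p.c₁ / (1 + p.c₁))
  c₁ := -(p.c₀ / (1 + p.c₀))

noncomputable def α (p : DRParam) : ℝ :=
  min 0 (min (p.c₀ / (1 - p.b * (p.c₀ + 1))) (p.c₁ / p.b))

noncomputable def β (p : DRParam) : ℝ :=
  max 0 (max (p.c₀ / (1 - p.b * (p.c₀ + 1))) (p.c₁ / p.b))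

/-- `G₀(y) = Φ(ᵗA₀; y)`, considered on `[α, β]`. -/
noncomputable def G₀ (p : DRParam) (y : ℝ) : ℝ := mobius p.A₀.transpose y

/-- `G₁(y) = Φ(ᵗA₁; y)`, considered on `[α, β]`. -/
noncomputable def G₁ (p : DRParam) (y : ℝ) : ℝ := mobius p.A₁.transpose y

/-- The Lipschitz constant of `Φ(ᵗA₁; ·)` on `[α, β]` is strictly less than `1`. -/
def Contracting (p : DRParam) : Prop :=
  ∃ K : ℝ≥0, K < 1 ∧ LipschitzOnWith K p.G₁ (Icc p.α p.β)

/-- Membership in the set `E` of admissible parameters. -/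
def InE (p : DRParam) : Prop := p.Cond ∧ (p.Contracting ∨ p.dual.Contracting)

/-- `f` is the continuous solution of de Rham's functional equation for `(A₀, A₁)` on `[0,1]`
which is a distribution function (extended by `0` to the left and by `1` to the right). -/
structure IsDeRham (p : DRParam) (f : StieltjesFunction ℝ) : Prop where
  cont : Continuous f
  left : ∀ x ≤ 0, f x = 0
  right : ∀ x, 1 ≤ x → f x = 1
  eq₀ : ∀ x ∈ Icc (0 : ℝ) (1 / 2), f x = mobius p.A₀ (f (2 * x))
  eq₁ : ∀ x ∈ Icc (1 / 2 : ℝ) 1, f x = mobius p.A₁ (f (2 * x - 1))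

lemma mobius_A₀ (p : DRParam) (z : ℝ) :
    mobius p.A₀ z = p.b * (p.c₀ + 1) * z / (p.c₀ * z + 1) := by
  simp [mobius, A₀]

lemma mobius_A₁ (p : DRParam) (z : ℝ) :
    mobius p.A₁ z = ((1 - p.b + p.c₁) * z + p.b) / (p.c₁ * z + 1) := by
  simp [mobius, A₁]

lemma den_ge {c z : ℝ} (hz : z ∈ Icc (0 : ℝ) 1) : min 1 (1 + c) ≤ c * z + 1 := by
  rcases le_total 0 c with h | h
  · exact (min_le_left _ _).trans (by nlinarith [mul_nonneg h hz.1])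
  · exact (min_le_right _ _).trans (by nlinarith [hz.2, hz.1])

/-- A difference quotient estimate for the maps `z ↦ (a z + e) / (c z + 1)` on `[0,1]`. -/
lemma exists_ratio {a e c : ℝ} (hc : -1 < c) (hd : 0 < a - e * c) (h1 : a - e * c < 1)
    (h2 : a - e * c < (1 + c) ^ 2) : ∃ K : ℝ≥0, K < 1 ∧ ∀ u ∈ Icc (0 : ℝ) 1, ∀ v ∈ Icc (0 : ℝ) 1,
      u ≤ v → 0 ≤ (a * v + e) / (c * v + 1) - (a * u + e) / (c * u + 1) ∧
      (a * v + e) / (c * v + 1) - (a * u + e) / (c * u + 1) ≤ K * (v - u) := by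
  have hm : 0 < min 1 (1 + c) := lt_min one_pos (by linarith)
  have hlt : a - e * c < (min 1 (1 + c)) ^ 2 := by
    rcases min_choice 1 (1 + c) with h | h <;> rw [h] <;> linarith
  have hK : 0 ≤ (a - e * c) / (min 1 (1 + c)) ^ 2 := by positivity
  refine ⟨((a - e * c) / (min 1 (1 + c)) ^ 2).toNNReal, ?_, fun u hu v hv huv => ?_⟩
  · rw [Real.toNNReal_lt_one]
    exact (div_lt_one (by positivity)).2 hlt
  · have hu' := den_ge (c := c) hu
    have hv' := den_ge (c := c) hv
    have pu : 0 < c * u + 1 := hm.trans_le hu'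
    have pv : 0 < c * v + 1 := hm.trans_le hv'
    have key : (a * v + e) / (c * v + 1) - (a * u + e) / (c * u + 1)
        = (a - e * c) / ((c * v + 1) * (c * u + 1)) * (v - u) := by
      rw [div_sub_div _ _ pv.ne' pu.ne', div_mul_eq_mul_div]
      congr 1
      ring
    rw [key, Real.coe_toNNReal _ hK]
    have hvu : 0 ≤ v - u := by linarith
    refine ⟨by positivity, mul_le_mul_of_nonneg_right ?_ hvu⟩
    rw [pow_two]
    gcongr

lemma Cond.ratio₀ {p : DRParam} (h : p.Cond) : ∃ K : ℝ≥0, K < 1 ∧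
    ∀ u ∈ Icc (0 : ℝ) 1, ∀ v ∈ Icc (0 : ℝ) 1, u ≤ v →
      0 ≤ mobius p.A₀ v - mobius p.A₀ u ∧ mobius p.A₀ v - mobius p.A₀ u ≤ K * (v - u) := by
  obtain ⟨⟨hb, hb'⟩, ⟨h0, h0'⟩, -⟩ := h
  have h3 : p.b * (p.c₀ + 1) < 1 := by
    have : p.c₀ + 1 < 1 / p.b := by linarith
    rwa [lt_div_iff₀ hb, mul_comm] at this
  have := exists_ratio (a := p.b * (p.c₀ + 1)) (e := 0) (c := p.c₀) (by linarith)
    (by nlinarith) (by linarith) (by nlinarith)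
  simpa [mobius_A₀] using this

lemma Cond.ratio₁ {p : DRParam} (h : p.Cond) : ∃ K : ℝ≥0, K < 1 ∧
    ∀ u ∈ Icc (0 : ℝ) 1, ∀ v ∈ Icc (0 : ℝ) 1, u ≤ v →
      0 ≤ mobius p.A₁ v - mobius p.A₁ u ∧ mobius p.A₁ v - mobius p.A₁ u ≤ K * (v - u) := by
  obtain ⟨⟨hb, hb'⟩, -, h1, h1'⟩ := h
  have h3 : p.c₁ * (1 - p.b) < p.b := by
    rwa [lt_div_iff₀ (by linarith)] at h1'
  have := exists_ratio (a := 1 - p.b + p.c₁) (e := p.b) (c := p.c₁) (by linarith)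
    (by nlinarith) (by nlinarith) (by nlinarith)
  simpa [mobius_A₁] using this

/-- Continuous distribution functions of probability measures on `[0,1]`. -/
def distSet : Set (ℝ →ᵇ ℝ) := {f | Monotone f ∧ (∀ x ≤ 0, f x = 0) ∧ ∀ x, 1 ≤ x → f x = 1}

lemma isClosed_distSet : IsClosed distSet := by
  have hc : ∀ x : ℝ, Continuous fun f : ℝ →ᵇ ℝ => f x := fun x =>
    continuous_eval_const x
  have : distSet = (⋂ (x : ℝ) (y : ℝ) (_ : x ≤ y), {f : ℝ →ᵇ ℝ | f x ≤ f y}) ∩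
      ((⋂ (x : ℝ) (_ : x ≤ 0), {f : ℝ →ᵇ ℝ | f x = 0}) ∩
        ⋂ (x : ℝ) (_ : 1 ≤ x), {f : ℝ →ᵇ ℝ | f x = 1}) := by
    ext f
    simp [distSet, Monotone]
  rw [this]
  refine IsClosed.inter ?_ (IsClosed.inter ?_ ?_)
  · exact isClosed_iInter fun x => isClosed_iInter fun y => isClosed_iInter fun _ =>
      isClosed_le (hc x) (hc y)
  · exact isClosed_iInter fun x => isClosed_iInter fun _ => isClosed_eq (hc x) continuous_const
  · exact isClosed_iInter fun x => isClosed_iInter fun _ => isClosed_eq (hc x) continuous_const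

lemma mem_Icc_of_dist {f : ℝ → ℝ} (h : Monotone f) (h0 : ∀ x ≤ 0, f x = 0)
    (h1 : ∀ x, 1 ≤ x → f x = 1) (x : ℝ) : f x ∈ Icc (0 : ℝ) 1 := by
  constructor
  · rw [← h0 (min 0 x) (min_le_left _ _)]
    exact h (min_le_right _ _)
  · rw [← h1 (max 1 x) (le_max_left _ _)]
    exact h (le_max_right _ _)

/-- A continuous monotone function that is `0` left of `0` and `1` right of `1`. -/
noncomputable def toDistSet (f : ℝ → ℝ) (hc : Continuous f) (h : Monotone f)
    (h0 : ∀ x ≤ 0, f x = 0) (h1 : ∀ x, 1 ≤ x → f x = 1) : distSet :=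
  ⟨BoundedContinuousFunction.ofNormedAddCommGroup f hc 1 fun x => by
    have := mem_Icc_of_dist h h0 h1 x
    rw [Real.norm_eq_abs, abs_le]
    exact ⟨by linarith [this.1], this.2⟩, h, h0, h1⟩

/-- The right-hand side of de Rham's functional equation. -/
noncomputable def step (p : DRParam) (f : ℝ → ℝ) (x : ℝ) : ℝ :=
  if x ≤ 1 / 2 then mobius p.A₀ (f (2 * x)) else mobius p.A₁ (f (2 * x - 1))

lemma mobius_ends {p : DRParam} (h : p.Cond) : mobius p.A₀ 0 = 0 ∧ mobius p.A₀ 1 = p.b ∧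
    mobius p.A₁ 0 = p.b ∧ mobius p.A₁ 1 = 1 := by
  obtain ⟨⟨hb, hb'⟩, ⟨h0, h0'⟩, h1, h1'⟩ := h
  have e0 : p.c₀ + 1 ≠ 0 := by linarith
  have e1 : p.c₁ + 1 ≠ 0 := by linarith
  refine ⟨by simp [mobius_A₀], ?_, by simp [mobius_A₁], ?_⟩
  · rw [mobius_A₀]
    field_simp
  · rw [mobius_A₁]
    field_simp
    ring

lemma continuousOn_of_ratio {g : ℝ → ℝ} {K : ℝ≥0} (hg : ∀ u ∈ Icc (0 : ℝ) 1, ∀ v ∈ Icc (0 : ℝ) 1,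
    u ≤ v → 0 ≤ g v - g u ∧ g v - g u ≤ K * (v - u)) : LipschitzOnWith K g (Icc 0 1) := by
  refine LipschitzOnWith.of_dist_le_mul fun u hu v hv => ?_
  rw [Real.dist_eq, Real.dist_eq]
  rcases le_total u v with h | h
  · obtain ⟨a, b⟩ := hg u hu v hv h
    rw [abs_sub_comm, abs_of_nonneg a, abs_sub_comm, abs_of_nonneg (by linarith)]
    exact b
  · obtain ⟨a, b⟩ := hg v hv u hu h
    rw [abs_of_nonneg a, abs_of_nonneg (by linarith)]
    exact b

lemma step_props {p : DRParam} (h : p.Cond) {f : ℝ → ℝ} (hc : Continuous f) (hm : Monotone f)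
    (h0 : ∀ x ≤ 0, f x = 0) (h1 : ∀ x, 1 ≤ x → f x = 1) :
    Continuous (p.step f) ∧ Monotone (p.step f) ∧ (∀ x ≤ 0, p.step f x = 0) ∧
      ∀ x, 1 ≤ x → p.step f x = 1 := by
  obtain ⟨K₀, -, r₀⟩ := h.ratio₀
  obtain ⟨K₁, -, r₁⟩ := h.ratio₁
  obtain ⟨e1, e2, e3, e4⟩ := mobius_ends h
  have hI := mem_Icc_of_dist hm h0 h1
  refine ⟨?_, ?_, fun x hx => ?_, fun x hx => ?_⟩
  · refine Continuous.if_le ?_ ?_ continuous_id continuous_const ?_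
    · exact (continuousOn_of_ratio r₀).continuousOn.comp_continuous
        (hc.comp (by fun_prop)) fun x => hI _
    · exact (continuousOn_of_ratio r₁).continuousOn.comp_continuous
        (hc.comp (by fun_prop)) fun x => hI _
    · rintro x rfl
      rw [h1 _ (by norm_num), h0 _ (by norm_num), e2, e3]
  · intro x y hxy
    have m₀ : ∀ u ∈ Icc (0 : ℝ) 1, ∀ v ∈ Icc (0 : ℝ) 1, u ≤ v → mobius p.A₀ u ≤ mobius p.A₀ v :=
      fun u hu v hv huv => by linarith [(r₀ u hu v hv huv).1]
    have m₁ : ∀ u ∈ Icc (0 : ℝ) 1, ∀ v ∈ Icc (0 : ℝ) 1, u ≤ v → mobius p.A₁ u ≤ mobius p.A₁ v :=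
      fun u hu v hv huv => by linarith [(r₁ u hu v hv huv).1]
    have z0 : (0 : ℝ) ∈ Icc (0 : ℝ) 1 := by simp
    have z1 : (1 : ℝ) ∈ Icc (0 : ℝ) 1 := by simp
    unfold step
    split_ifs with hx hy hy
    · exact m₀ _ (hI _) _ (hI _) (hm (by linarith))
    · have a := m₀ _ (hI (2 * x)) _ z1 (hI _).2
      have b := m₁ _ z0 _ (hI (2 * y - 1)) (hI _).1
      linarith
    · linarith
    · exact m₁ _ (hI _) _ (hI _) (hm (by linarith))
  · rw [step, if_pos (by linarith), h0 _ (by linarith), e1]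
  · rw [step, if_neg (by linarith), h1 _ (by linarith), e4]

lemma exists_contracting {p : DRParam} (h : p.Cond) : ∃ (K : ℝ≥0) (T : distSet → distSet),
    ContractingWith K T ∧ ∀ f x, (T f).1 x = p.step f.1 x := by
  obtain ⟨K₀, k₀, r₀⟩ := h.ratio₀
  obtain ⟨K₁, k₁, r₁⟩ := h.ratio₁
  refine ⟨max K₀ K₁, fun f => toDistSet (p.step f.1)
    (step_props h f.1.continuous f.2.1 f.2.2.1 f.2.2.2).1
    (step_props h f.1.continuous f.2.1 f.2.2.1 f.2.2.2).2.1
    (step_props h f.1.continuous f.2.1 f.2.2.1 f.2.2.2).2.2.1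
    (step_props h f.1.continuous f.2.1 f.2.2.1 f.2.2.2).2.2.2, ⟨max_lt k₀ k₁, ?_⟩,
    fun f x => rfl⟩
  refine LipschitzWith.of_dist_le_mul fun f g => ?_
  rw [Subtype.dist_eq, Subtype.dist_eq]
  refine (BoundedContinuousFunction.dist_le (by positivity)).2 fun x => ?_
  change dist (p.step f.1 x) (p.step g.1 x) ≤ _
  have hf := mem_Icc_of_dist f.2.1 f.2.2.1 f.2.2.2
  have hg := mem_Icc_of_dist g.2.1 g.2.2.1 g.2.2.2
  unfold step
  split_ifs
  · refine ((continuousOn_of_ratio r₀).dist_le_mul _ (hf _) _ (hg _)).trans ?_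
    gcongr
    · exact le_max_left _ _
    · exact BoundedContinuousFunction.dist_coe_le_dist _
  · refine ((continuousOn_of_ratio r₁).dist_le_mul _ (hf _) _ (hg _)).trans ?_
    gcongr
    · exact le_max_right _ _
    · exact BoundedContinuousFunction.dist_coe_le_dist _

/-- De Rham's functional equation has exactly one solution that is a continuous distribution
function on `[0,1]`. -/
theorem existsUnique_isDeRham {p : DRParam} (h : p.Cond) :
    ∃! f : StieltjesFunction ℝ, p.IsDeRham f := by
  obtain ⟨K, T, hT, hTs⟩ := exists_contracting h
  have : CompleteSpace distSet := isClosed_distSet.completeSpace_coe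
  have : Nonempty distSet := ⟨toDistSet (fun x => max 0 (min x 1)) (by fun_prop)
    (fun x y hxy => by dsimp only; gcongr) (fun x hx => by simp [hx]) (fun x hx => by simp [hx])⟩
  let f := ContractingWith.fixedPoint T hT
  have hf : ∀ x, f.1 x = p.step f.1 x := fun x => by
    rw [← hTs, (hT.fixedPoint_isFixedPt).eq]
  obtain ⟨e1, e2, e3, e4⟩ := mobius_ends h
  refine ⟨⟨f.1, f.2.1, fun x => f.1.continuous.continuousWithinAt⟩,
    ⟨f.1.continuous, f.2.2.1, f.2.2.2, fun x hx => ?_, fun x hx => ?_⟩, fun g hg => ?_⟩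
  · exact (hf x).trans (if_pos hx.2)
  · refine (hf x).trans ?_
    rcases hx.1.eq_or_lt with rfl | h'
    · rw [step, if_pos le_rfl, f.2.2.2 _ (by norm_num), e2]
      change p.b = mobius p.A₁ (f.1 _)
      rw [f.2.2.1 _ (by norm_num), e3]
    · exact if_neg (not_le.2 h')
  · let g' := toDistSet g hg.cont g.mono hg.left hg.right
    have hfix : Function.IsFixedPt T g' := by
      refine Subtype.ext (DFunLike.ext _ _ fun x => ?_)
      rw [hTs]
      change p.step g x = g x
      unfold step
      split_ifs with hx
      · rcases le_total 0 x with h0 | h0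
        · exact (hg.eq₀ x ⟨h0, hx⟩).symm
        · rw [hg.left x h0, hg.left _ (by linarith), e1]
      · rcases le_total x 1 with h1 | h1
        · exact (hg.eq₁ x ⟨by linarith, h1⟩).symm
        · rw [hg.right x h1, hg.right _ (by linarith), e4]
    have hgf : g' = f := hT.fixedPoint_unique hfix
    ext x
    exact congrArg (fun u : distSet => u.1 x) hgf

open Classical in
/-- The probability measure `μ_{A₀, A₁}` whose distribution function solves de Rham's functional
equation (and `0` if the parameter violates `Cond`). -/
noncomputable def measure (p : DRParam) : Measure ℝ :=
  if h : p.Cond then (existsUnique_isDeRham h).choose.measure else 0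

end DRParam

/-- `F(t, x) = μ_t([0, x])` for a curve of parameters. -/
noncomputable def distF (γ : ℝ → DRParam) (t x : ℝ) : ℝ := (γ t).measure.real (Icc 0 x)

/-- `f_k(x) = ∂_t^k F(0, x)`. -/
noncomputable def fk (γ : ℝ → DRParam) (k : ℕ) (x : ℝ) : ℝ :=
  iteratedDeriv k (fun t => distF γ t x) 0

/-- `∂_t G(0, y) / (1 - ∂_y G(0, y))`, where `G(t, y) = g (γ t) y` and `g` is `G₀` or `G₁`. -/
noncomputable def ndRatio (g : DRParam → ℝ → ℝ) (γ : ℝ → DRParam) (y : ℝ) : ℝ :=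
  deriv (fun t => g (γ t) y) 0 / (1 - deriv (g (γ 0)) y)

/-- The minimum over `[α, β]` of `ndRatio`. -/
noncomputable def deltaMin (g : DRParam → ℝ → ℝ) (γ : ℝ → DRParam) : ℝ :=
  sInf (ndRatio g γ '' Icc (γ 0).α (γ 0).β)

/-- The maximum over `[α, β]` of `ndRatio`. -/
noncomputable def deltaMax (g : DRParam → ℝ → ℝ) (γ : ℝ → DRParam) : ℝ :=
  sSup (ndRatio g γ '' Icc (γ 0).α (γ 0).β)

/-- First alternative of the non-degeneracy condition. The contraction property says that
`∂_y G₁ < 1` on `[α, β]`, so that the quotient defining the minimum for `G₁` makes sense (for `G₀`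
this is automatic). -/
def ND₁ (γ : ℝ → DRParam) : Prop :=
  (γ 0).Contracting ∧
    0 < deriv (fun t => (γ t).b) 0 * ((γ 0).α + 1) + (γ 0).b * (1 - (γ 0).b) *
      min 0 (min (deltaMin DRParam.G₀ γ) (deltaMin DRParam.G₁ γ))

/-- Second alternative, to be applied to the dual curve. -/
def ND₂ (γ : ℝ → DRParam) : Prop :=
  (γ 0).Contracting ∧
    deriv (fun t => (γ t).b) 0 * ((γ 0).α + 1) + (γ 0).b * (1 - (γ 0).b) *
      max 0 (max (deltaMax DRParam.G₀ γ) (deltaMax DRParam.G₁ γ)) < 0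

/-- The non-degeneracy condition (ND). -/
def ND (γ : ℝ → DRParam) : Prop := ND₁ γ ∨ ND₂ fun t => (γ t).dual

/-- The linear case (L) on the parameter interval `I`. -/
def LinearCase (γ : ℝ → DRParam) (I : Set ℝ) : Prop :=
  ∃ a ∈ Ioo (0 : ℝ) 1, ∀ t ∈ I, γ t = ⟨t + a, 0, 0⟩

/-- A smooth curve of admissible parameters on an open interval `I` containing `0`. -/
structure IsAdmissibleCurve (γ : ℝ → DRParam) (I : Set ℝ) : Prop where
  isOpen : IsOpen I
  ordConnected : I.OrdConnected
  zero_mem : (0 : ℝ) ∈ I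
  inE : ∀ t ∈ I, (γ t).InE
  smooth_b : ContDiffOn ℝ ∞ (fun t => (γ t).b) I
  smooth_c₀ : ContDiffOn ℝ ∞ (fun t => (γ t).c₀) I
  smooth_c₁ : ContDiffOn ℝ ∞ (fun t => (γ t).c₁) I

/-- The supremum of `(f x - f y) / (x - y) ^ c` over `x > y` in `J`. -/
noncomputable def supQuot (f : ℝ → ℝ) (c : ℝ) (J : Set ℝ) : EReal :=
  ⨆ (x ∈ J) (y ∈ J) (_ : y < x), (((f x - f y) / (x - y) ^ c : ℝ) : EReal)

/-- The infimum of `(f x - f y) / (x - y) ^ c` over `x > y` in `J`. -/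
noncomputable def infQuot (f : ℝ → ℝ) (c : ℝ) (J : Set ℝ) : EReal :=
  ⨅ (x ∈ J) (y ∈ J) (_ : y < x), (((f x - f y) / (x - y) ^ c : ℝ) : EReal)

/-- `f : [0,1] → ℝ` is of monotonic type on no open interval. -/
def IsMTNI (f : ℝ → ℝ) : Prop :=
  ∀ u v : ℝ, 0 ≤ u → u < v → v ≤ 1 →
    (⨅ (x ∈ Ioo u v) (y ∈ Ioo u v) (_ : x ≠ y), (((f x - f y) / (x - y) : ℝ) : EReal)) = ⊥ ∧
    (⨆ (x ∈ Ioo u v) (y ∈ Ioo u v) (_ : x ≠ y), (((f x - f y) / (x - y) : ℝ) : EReal)) = ⊤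

/-! For a dyadic interval let m be its mass under μ₀ and D the increment of f₁ over it. By the
functional equation, F restricted to the interval is a rescaled linear fractional image of F itself,
and its shape depends only on the ratio y (`rowRatio`) of the lower row of the matrix product of the
interval. The left half receives the share P = b₁(1+y)/(1+b₁y) of the mass (`dyadicInc_even`).
Differentiation in t gives D(left) = P D + Q m, where Q is the t-derivative of the share
(`exists_split`). Halving moves y by G₀ or G₁ and the derivative of y by affine maps y' ↦ A + B y';
the numbers δᵢ provide an interval invariant under these maps (`ndRatio_step`), and (ND) then keeps
Q positive and away from 0 (`HasSplitting`). The second alternative of (ND) is the same argument,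
with signs reversed, for the reflected measure.

So D/m is a μ₀-martingale along dyadic intervals whose jumps, Q/P or -Q/(1-P), are bounded and
bounded away from 0. Stopped when it leaves a bounded range it is bounded above, hence converges;
jumps bounded below exclude this on paths that stay in the range. Thus D/m is unbounded almost
everywhere (`hasUnboundedDensity`). In the linear case the jumps of the ratio for f_{k+1} are those
of size at least |D/m| for f_k, so unboundedness propagates in k (`hasUnboundedDensity_succ`).

The exponent c comes from a bound m ≥ κ 2^(-nc), with κ depending on the point (`exists_exponent`).
For c = 1 it holds because 2^(-n)/m is a nonnegative martingale. If μ₀ is not absolutely continuous,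
the sums of √m over a level decay exponentially faster than the trivial bound, and Borel–Cantelli
gives some c < 1; the gain fails only if F is linear fractional, and then μ₀ is absolutely
continuous.

Multiplying the two facts, D 2^(nc) is unbounded at almost every point, which is (i). For (ii), an
upper bound on D 2^(nc) inside one dyadic interval would bound D/m from above wherever the mass
bound holds, so D/m would converge almost everywhere there, a contradiction (`exists_large`); the
lower bound is the same statement for -f_k.

Smoothness in t follows from the implicit function theorem for the bounded sequence of values of F
along the orbit of x under the doubling map (`contDiffAt_of_linearFractional_recursion`). -/

/-! ### Dyadic intervals and martingale convergence. -/

/-- The index `j` of the dyadic interval `[j / 2 ^ n, (j + 1) / 2 ^ n)` that contains `x ≥ 0`. -/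
noncomputable def dyadicIndex (n : ℕ) (x : ℝ) : ℕ := ⌊x * (2 ^ n : ℕ)⌋₊

lemma dyadicIndex_succ_div (n : ℕ) (x : ℝ) : dyadicIndex (n + 1) x / 2 = dyadicIndex n x := by
  have h := Nat.mul_cast_floor_div_cancel (n := 2) two_ne_zero (x * (2 ^ n : ℕ))
  rw [dyadicIndex, dyadicIndex, ← h, pow_succ]
  push_cast
  rw [mul_assoc]

lemma dyadicIndex_add_div (n l : ℕ) (x : ℝ) :
    dyadicIndex (n + l) x / 2 ^ l = dyadicIndex n x := by
  induction l with
  | zero => simp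
  | succ l ih =>
    rw [pow_succ', ← Nat.div_div_eq_div_mul, ← add_assoc, dyadicIndex_succ_div, ih]

lemma measurable_dyadicIndex (n : ℕ) : Measurable (dyadicIndex n) :=
  Nat.measurable_floor.comp (measurable_id.mul_const _)

/-- The filtration generated by the dyadic intervals. -/
noncomputable def dyadicFiltration : Filtration ℕ (inferInstance : MeasurableSpace ℝ) where
  seq n := MeasurableSpace.comap (dyadicIndex n) ⊤
  mono' := monotone_nat_of_le_succ fun n => by
    rintro _ ⟨T, -, rfl⟩
    refine ⟨(· / 2) ⁻¹' T, trivial, ?_⟩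
    ext x
    simp [dyadicIndex_succ_div]
  le' n := (measurable_dyadicIndex n).comap_le

/-- `μ` is a probability measure on `[0, 1)` which gives the `j`-th dyadic interval of level `n`
the positive mass `m n j`. -/
structure HasDyadicMass (μ : Measure ℝ) (m : ℕ → ℕ → ℝ) : Prop where
  prob : IsProbabilityMeasure μ
  pos : ∀ n, ∀ j < 2 ^ n, 0 < m n j
  mass : ∀ n, ∀ j < 2 ^ n, μ (dyadicIndex n ⁻¹' {j}) = ENNReal.ofReal (m n j)
  lt : ∀ n, ∀ᵐ x ∂μ, dyadicIndex n x < 2 ^ n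
  unit : ∀ᵐ x ∂μ, x ∈ Ico (0 : ℝ) 1

/-- A function on dyadic intervals whose value at an interval is the sum over its two halves. -/
def DyadicAdditive (D : ℕ → ℕ → ℝ) : Prop :=
  ∀ n, ∀ j < 2 ^ n, D (n + 1) (2 * j) + D (n + 1) (2 * j + 1) = D n j

lemma sum_range_two_pow_succ (n : ℕ) (g : ℕ → ℝ) :
    ∑ i ∈ Finset.range (2 ^ (n + 1)), g i = ∑ j ∈ Finset.range (2 ^ n), (g (2 * j) + g (2 * j + 1)) := by
  rw [pow_succ]
  generalize 2 ^ n = N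
  induction N with
  | zero => simp
  | succ N ih =>
    rw [Finset.sum_range_succ _ N, ← ih, add_mul, one_mul, Finset.sum_range_succ,
      Finset.sum_range_succ, mul_comm N 2]
    ring

namespace HasDyadicMass

variable {μ : Measure ℝ} {m : ℕ → ℕ → ℝ}

/-- Indices outside `range (2 ^ n)` occur only on a null set, so functions of the index are simple
functions almost everywhere. -/
lemma ae_eq_sum (h : HasDyadicMass μ m) (n : ℕ) (g : ℕ → ℝ) :
    (fun x => g (dyadicIndex n x)) =ᵐ[μ] fun x => ∑ j ∈ Finset.range (2 ^ n),
      (dyadicIndex n ⁻¹' {j}).indicator (fun _ => g j) x := by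
  filter_upwards [h.lt n] with x hx
  rw [Finset.sum_eq_single_of_mem _ (Finset.mem_range.2 hx)]
  · simp
  · intro j _ hj
    simp [hj.symm]

lemma integrable_indicator (h : HasDyadicMass μ m) (n j : ℕ) (c : ℝ) :
    Integrable ((dyadicIndex n ⁻¹' {j}).indicator fun _ => c) μ :=
  have := h.prob
  (integrable_const c).indicator (measurable_dyadicIndex n (measurableSet_singleton j))

lemma integrable (h : HasDyadicMass μ m) (n : ℕ) (g : ℕ → ℝ) :
    Integrable (fun x => g (dyadicIndex n x)) μ :=
  (integrable_finsetSum _ fun _ _ => h.integrable_indicator _ _ _).congr (h.ae_eq_sum n g).symm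

lemma integral (h : HasDyadicMass μ m) (n : ℕ) (g : ℕ → ℝ) :
    ∫ x, g (dyadicIndex n x) ∂μ = ∑ j ∈ Finset.range (2 ^ n), m n j * g j := by
  have := h.prob
  rw [integral_congr_ae (h.ae_eq_sum n g),
    integral_finsetSum _ fun _ _ => h.integrable_indicator _ _ _]
  refine Finset.sum_congr rfl fun j hj => ?_
  rw [Finset.mem_range] at hj
  rw [integral_indicator (measurable_dyadicIndex n (measurableSet_singleton j)),
    setIntegral_const, Measure.real, h.mass n j hj, ENNReal.toReal_ofReal (h.pos n j hj).le,
    smul_eq_mul]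

/-- Integrating `Y n` over an interval gives `m n j * Y n j`, so additivity of this product over the
two halves is exactly the martingale property. -/
lemma martingale (h : HasDyadicMass μ m) {Y : ℕ → ℕ → ℝ}
    (hY : DyadicAdditive fun n j => m n j * Y n j) :
    Martingale (fun n x => Y n (dyadicIndex n x)) dyadicFiltration μ := by
  have := h.prob
  have hmeas : ∀ n, StronglyMeasurable[dyadicFiltration n] fun x => Y n (dyadicIndex n x) :=
    fun n => by
      refine Measurable.stronglyMeasurable ?_
      exact (measurable_from_top (f := Y n)).comp (comap_measurable (dyadicIndex n))
  refine martingale_nat hmeas (fun n => h.integrable n (Y n)) fun n => ?_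
  refine ae_eq_condExp_of_forall_setIntegral_eq (dyadicFiltration.le n)
    (h.integrable (n + 1) (Y (n + 1))) (fun _ _ _ => (h.integrable n (Y n)).integrableOn) ?_
    (hmeas n).aestronglyMeasurable
  rintro s hs -
  have hs' := dyadicFiltration.le n s hs
  obtain ⟨T, -, rfl⟩ := hs
  classical
  rw [← integral_indicator hs', ← integral_indicator hs']
  have e1 : (dyadicIndex n ⁻¹' T).indicator (fun x => Y n (dyadicIndex n x)) =
      fun x => (fun j => if j ∈ T then Y n j else 0) (dyadicIndex n x) := by
    ext x
    simp [indicator_apply]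
  have e2 : (dyadicIndex n ⁻¹' T).indicator (fun x => Y (n + 1) (dyadicIndex (n + 1) x)) =
      fun x => (fun j => if j / 2 ∈ T then Y (n + 1) j else 0) (dyadicIndex (n + 1) x) := by
    ext x
    simp [indicator_apply, dyadicIndex_succ_div]
  rw [e1, e2, h.integral, h.integral, sum_range_two_pow_succ]
  refine Finset.sum_congr rfl fun j hj => ?_
  have hj' := hY n j (Finset.mem_range.1 hj)
  have q1 : 2 * j / 2 = j := by omega
  have q2 : (2 * j + 1) / 2 = j := by omega
  simp only [q1, q2]
  split_ifs
  · exact hj'.symm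
  · simp

/-- A dyadic martingale that is bounded above converges almost everywhere. -/
lemma ae_tendsto_of_le (h : HasDyadicMass μ m) {Y : ℕ → ℕ → ℝ}
    (hY : DyadicAdditive fun n j => m n j * Y n j) {C : ℝ} (hC : ∀ n, ∀ j < 2 ^ n, Y n j ≤ C) :
    ∀ᵐ x ∂μ, ∃ l, Tendsto (fun n => Y n (dyadicIndex n x)) atTop (𝓝 l) := by
  have := h.prob
  have hM := h.martingale hY
  have hint : ∀ n, ∫ x, Y n (dyadicIndex n x) ∂μ = ∫ x, Y 0 (dyadicIndex 0 x) ∂μ := fun n => by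
    have := hM.setIntegral_eq (Nat.zero_le n) (s := univ) MeasurableSet.univ
    simpa using this.symm
  refine hM.submartingale.exists_ae_tendsto_of_bdd
    (R := (|C| + (C - ∫ x, Y 0 (dyadicIndex 0 x) ∂μ)).toNNReal) fun n => ?_
  have hi := h.integrable n (Y n)
  rw [eLpNorm_one_eq_lintegral_enorm, ← ofReal_integral_norm_eq_lintegral_enorm hi]
  refine ENNReal.ofReal_le_ofReal ?_
  -- The mean of a martingale is constant, so an upper bound alone already bounds it in L¹.
  calc ∫ x, ‖Y n (dyadicIndex n x)‖ ∂μ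
      ≤ ∫ x, (|C| + (C - Y n (dyadicIndex n x))) ∂μ := by
        refine integral_mono_ae hi.norm ((integrable_const _).add ((integrable_const _).sub hi)) ?_
        filter_upwards [h.lt n] with x hx
        have h1 := hC n _ hx
        rw [Real.norm_eq_abs, abs_le]
        constructor <;> linarith [le_abs_self C, neg_abs_le C]
    _ = _ := by
        have hi' : Integrable (fun x => C - Y n (dyadicIndex n x)) μ := (integrable_const _).sub hi
        rw [integral_add (integrable_const _) hi', integral_sub (integrable_const _) hi, hint]
        simp

end HasDyadicMass

/-- The dyadic interval `j` of level `n` and all its ancestors belong to `S`. -/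
def GoodAncestors (S : ℕ → ℕ → Prop) : ℕ → ℕ → Prop
  | 0, j => S 0 j
  | n + 1, j => GoodAncestors S n (j / 2) ∧ S (n + 1) j

lemma goodAncestors_of_forall {S : ℕ → ℕ → Prop} {x : ℝ} (hx : ∀ n, S n (dyadicIndex n x)) (n : ℕ) :
    GoodAncestors S n (dyadicIndex n x) := by
  induction n with
  | zero => exact hx 0
  | succ n ih => exact ⟨by rwa [dyadicIndex_succ_div], hx _⟩

lemma GoodAncestors.self {S : ℕ → ℕ → Prop} {n j : ℕ} (h : GoodAncestors S n j) : S n j := by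
  cases n with
  | zero => exact h
  | succ n => exact h.2

open Classical in
/-- The process `Y` stopped when it leaves `S`. -/
noncomputable def stopAtExit (S : ℕ → ℕ → Prop) (Y : ℕ → ℕ → ℝ) : ℕ → ℕ → ℝ
  | 0, j => Y 0 j
  | n + 1, j => if GoodAncestors S n (j / 2) then Y (n + 1) j else stopAtExit S Y n (j / 2)

lemma GoodAncestors.stopAtExit {S : ℕ → ℕ → Prop} (Y : ℕ → ℕ → ℝ) {n j : ℕ}
    (h : GoodAncestors S n j) : stopAtExit S Y n j = Y n j := by
  cases n with
  | zero => rfl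
  | succ n => exact if_pos h.1

/-- A dyadic martingale which is bounded above up to and including the first exit from `S` converges
almost everywhere on the set of points that never leave `S`. -/
lemma HasDyadicMass.ae_tendsto_of_good {μ : Measure ℝ} {m : ℕ → ℕ → ℝ} (h : HasDyadicMass μ m)
    (hm : DyadicAdditive m) {Y : ℕ → ℕ → ℝ} (hY : DyadicAdditive fun n j => m n j * Y n j)
    (S : ℕ → ℕ → Prop) {C : ℝ} (hC0 : ∀ j < 2 ^ 0, Y 0 j ≤ C)
    (hC : ∀ n, ∀ j < 2 ^ (n + 1), S n (j / 2) → Y (n + 1) j ≤ C) :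
    ∀ᵐ x ∂μ, (∀ n, S n (dyadicIndex n x)) →
      ∃ l, Tendsto (fun n => Y n (dyadicIndex n x)) atTop (𝓝 l) := by
  -- After the exit the value is copied to both halves, and additivity reduces to that of `m`.
  have hadd : DyadicAdditive fun n j => m n j * stopAtExit S Y n j := by
    intro n j hj
    have q1 : 2 * j / 2 = j := by omega
    have q2 : (2 * j + 1) / 2 = j := by omega
    simp only [stopAtExit]
    rw [q1, q2]
    split_ifs with hg
    · rw [hg.stopAtExit]
      exact hY n j hj
    · rw [← add_mul]
      exact congrArg (· * _) (hm n j hj)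
  have hbd : ∀ n, ∀ j < 2 ^ n, stopAtExit S Y n j ≤ C := by
    intro n
    induction n with
    | zero => exact hC0
    | succ n ih =>
      intro j hj
      simp only [stopAtExit]
      split_ifs with hg
      · exact hC n j hj hg.self
      · exact ih _ (by rw [pow_succ] at hj; omega)
  filter_upwards [h.ae_tendsto_of_le hadd hbd] with x ⟨l, hl⟩ hx
  exact ⟨l, hl.congr fun n => (goodAncestors_of_forall hx n).stopAtExit Y⟩

/-! ### Increments over dyadic intervals and pointwise Hölder quotients. -/

/-- The increment of `f` over the `j`-th dyadic interval of level `n`. -/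
noncomputable def dyadicInc (f : ℝ → ℝ) (n j : ℕ) : ℝ := f ((j + 1) / 2 ^ n) - f (j / 2 ^ n)

lemma dyadicInc_children (f : ℝ → ℝ) (n j : ℕ) :
    dyadicInc f (n + 1) (2 * j) + dyadicInc f (n + 1) (2 * j + 1) = dyadicInc f n j := by
  have e1 : ((2 * j : ℕ) : ℝ) / 2 ^ (n + 1) = j / 2 ^ n := by
    rw [pow_succ]; push_cast; field_simp
  have e2 : (((2 * j + 1 : ℕ) : ℝ) + 1) / 2 ^ (n + 1) = (j + 1) / 2 ^ n := by
    rw [pow_succ]; push_cast; field_simp; ring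
  unfold dyadicInc
  rw [e1, e2]
  push_cast
  ring

lemma dyadicAdditive_dyadicInc (f : ℝ → ℝ) : DyadicAdditive (dyadicInc f) :=
  fun n j _ => dyadicInc_children f n j

lemma dyadicIndex_bounds {x : ℝ} (hx : 0 ≤ x) (n : ℕ) :
    (dyadicIndex n x : ℝ) / 2 ^ n ≤ x ∧ x < (dyadicIndex n x + 1) / 2 ^ n := by
  have h1 := Nat.floor_le (a := x * (2 ^ n : ℕ)) (by positivity)
  have h2 := Nat.lt_floor_add_one (x * (2 ^ n : ℕ))
  push_cast at h1 h2
  rw [div_le_iff₀ (by positivity), lt_div_iff₀ (by positivity)]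
  unfold dyadicIndex
  push_cast
  exact ⟨h1, h2⟩

lemma dyadicIndex_lt {x : ℝ} (hx : x ∈ Ico (0 : ℝ) 1) (n : ℕ) : dyadicIndex n x < 2 ^ n := by
  have h := (dyadicIndex_bounds hx.1 n).1
  rw [div_le_iff₀ (by positivity)] at h
  have : (dyadicIndex n x : ℝ) < 2 ^ n := h.trans_lt (by nlinarith [hx.2, pow_pos (two_pos (α := ℝ)) n])
  exact_mod_cast this

lemma rpow_sub_le_of_dyadic {c : ℝ} (hc : 0 ≤ c) {n : ℕ} {h : ℝ} (h2 : |h| ≤ ((2 : ℝ) ^ n)⁻¹) :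
    |h| ^ c * ((2 : ℝ) ^ n) ^ c ≤ 1 := by
  rw [← Real.mul_rpow (abs_nonneg _) (by positivity)]
  refine Real.rpow_le_one (by positivity) ?_ hc
  calc |h| * 2 ^ n ≤ ((2 : ℝ) ^ n)⁻¹ * 2 ^ n := by gcongr
    _ = 1 := inv_mul_cancel₀ (by positivity)

/-- If the normalized increments of `f` over the dyadic intervals that contain `x` are unbounded,
then `f` has infinite upper `c`-Hölder derivative at `x`. -/
lemma limsup_eq_top_of_not_bddAbove {f : ℝ → ℝ} {c x : ℝ} (hc : 0 ≤ c) (hx : 0 ≤ x)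
    (hf : ¬ BddAbove (range fun n => |dyadicInc f n (dyadicIndex n x)| * ((2 : ℝ) ^ n) ^ c)) :
    limsup (fun h : ℝ => ((|f (x + h) - f x| / |h| ^ c : ℝ) : EReal)) (𝓝[≠] 0) = ⊤ := by
  by_contra hne
  obtain ⟨M, hM, -⟩ := EReal.lt_iff_exists_real_btwn.1 (lt_top_iff_ne_top.2 hne)
  have hev := eventually_lt_of_limsup_lt hM
  refine hf (IsBoundedUnder.bddAbove_range (isBoundedUnder_of_eventually_le (a := 2 * |M|) ?_))
  rw [eventually_nhdsWithin_iff, Metric.eventually_nhds_iff] at hev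
  obtain ⟨δ, hδ, hev⟩ := hev
  -- The case h = 0 is included because `x` may itself be the left endpoint of its dyadic interval.
  have key : ∀ h : ℝ, |h| < δ → |f (x + h) - f x| ≤ |M| * |h| ^ c := by
    intro h hh
    rcases eq_or_ne h 0 with rfl | h0
    · simp
      positivity
    · have := hev (y := h) (by simpa using hh) h0
      rw [EReal.coe_lt_coe_iff, div_lt_iff₀ (by positivity)] at this
      exact this.le.trans (by gcongr; exact le_abs_self M)
  have hlim : Tendsto (fun n : ℕ => ((2 : ℝ) ^ n)⁻¹) atTop (𝓝 0) :=
    tendsto_inv_atTop_zero.comp (tendsto_pow_atTop_atTop_of_one_lt one_lt_two)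
  filter_upwards [hlim.eventually_lt_const hδ] with n hn
  obtain ⟨b1, b2⟩ := dyadicIndex_bounds hx n
  set j := dyadicIndex n x
  have e : ((j : ℝ) + 1) / 2 ^ n = j / 2 ^ n + (2 ^ n)⁻¹ := by ring
  -- The endpoints straddle `x` at distance at most 2^(-n), so the increment splits into two
  -- differences based at `x`.
  have l1 : |((j : ℝ) + 1) / 2 ^ n - x| ≤ ((2 : ℝ) ^ n)⁻¹ := by
    rw [abs_of_pos (by linarith)]; linarith
  have l2 : |(j : ℝ) / 2 ^ n - x| ≤ ((2 : ℝ) ^ n)⁻¹ := by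
    rw [abs_of_nonpos (by linarith)]; linarith
  have k1 := key _ (l1.trans_lt hn)
  have k2 := key _ (l2.trans_lt hn)
  rw [add_sub_cancel] at k1 k2
  have r1 := mul_le_mul_of_nonneg_left (rpow_sub_le_of_dyadic hc l1) (abs_nonneg M)
  have r2 := mul_le_mul_of_nonneg_left (rpow_sub_le_of_dyadic hc l2) (abs_nonneg M)
  have p : 0 ≤ ((2 : ℝ) ^ n) ^ c := by positivity
  calc |dyadicInc f n j| * ((2 : ℝ) ^ n) ^ c
      ≤ (|M| * |((j : ℝ) + 1) / 2 ^ n - x| ^ c + |M| * |(j : ℝ) / 2 ^ n - x| ^ c) *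
          ((2 : ℝ) ^ n) ^ c := by
        gcongr
        have := abs_sub_le (f ((j + 1) / 2 ^ n)) (f x) (f (j / 2 ^ n))
        rw [abs_sub_comm (f x)] at this
        unfold dyadicInc
        linarith
    _ ≤ 2 * |M| := by linarith

/-! ### Unbounded martingales against lower bounds for the mass. -/

/-- A positive lower bound for the mass of dyadic intervals relative to their length to the power
`c`, at almost every point. -/
def HasMassLowerBound (μ : Measure ℝ) (m : ℕ → ℕ → ℝ) (c : ℝ) : Prop :=
  ∀ᵐ x ∂μ, ∃ κ > 0, ∀ n, κ ≤ m n (dyadicIndex n x) * ((2 : ℝ) ^ n) ^ c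

/-- The density of `D` with respect to `m` is unbounded along dyadic intervals at almost every
point. -/
def HasUnboundedDensity (μ : Measure ℝ) (m D : ℕ → ℕ → ℝ) : Prop :=
  ∀ᵐ x ∂μ, ¬ BddAbove (range fun n => |D n (dyadicIndex n x) / m n (dyadicIndex n x)|)

section
variable {μ : Measure ℝ} {m D : ℕ → ℕ → ℝ}

/-- The quotient of Lebesgue measure by μ on dyadic intervals, 2^(-n)/m, is a nonnegative
martingale. Its negative is bounded above by 0, hence converges almost everywhere, so the quotient
is bounded along almost every path. -/
lemma HasDyadicMass.hasMassLowerBound_one (h : HasDyadicMass μ m) : HasMassLowerBound μ m 1 := by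
  have hadd : DyadicAdditive fun n j => m n j * (-((2 : ℝ) ^ n)⁻¹ / m n j) := by
    intro n j hj
    have h1 := (h.pos n j hj).ne'
    have h2 := (h.pos (n + 1) (2 * j) (by rw [pow_succ]; omega)).ne'
    have h3 := (h.pos (n + 1) (2 * j + 1) (by rw [pow_succ]; omega)).ne'
    simp only [mul_div_cancel₀ _ h1, mul_div_cancel₀ _ h2, mul_div_cancel₀ _ h3]
    rw [pow_succ]
    field_simp
    norm_num
  have hle : ∀ n, ∀ j < 2 ^ n, -((2 : ℝ) ^ n)⁻¹ / m n j ≤ 0 := fun n j hj =>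
    div_nonpos_of_nonpos_of_nonneg (neg_nonpos.2 (by positivity)) (h.pos n j hj).le
  filter_upwards [h.ae_tendsto_of_le hadd hle, h.unit] with x ⟨l, hl⟩ hx
  obtain ⟨B, hB⟩ := hl.bddBelow_range
  have hp := fun n => h.pos n _ (dyadicIndex_lt hx n)
  have hB' : ∀ n, B ≤ -((2 : ℝ) ^ n)⁻¹ / m n (dyadicIndex n x) := fun n => hB ⟨n, rfl⟩
  have hneg : B < 0 := (hB' 0).trans_lt (div_neg_of_neg_of_pos (by norm_num) (hp 0))
  refine ⟨(-B)⁻¹, by simpa using hneg, fun n => ?_⟩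
  have := hB' n
  rw [le_div_iff₀ (hp n)] at this
  rw [Real.rpow_one, inv_le_iff_one_le_mul₀ (by linarith)]
  have h2 : ((2 : ℝ) ^ n)⁻¹ * 2 ^ n = 1 := inv_mul_cancel₀ (by positivity)
  nlinarith [pow_pos (two_pos (α := ℝ)) n]

/-- Here |D| 2^(nc) is the product of |D/m|, which is unbounded, and m 2^(nc), which stays above κ.
-/
lemma HasDyadicMass.not_bddAbove_inc (h : HasDyadicMass μ m) {c : ℝ}
    (hlow : HasMassLowerBound μ m c) (hD : HasUnboundedDensity μ m D) :
    ∀ᵐ x ∂μ, ¬ BddAbove (range fun n => |D n (dyadicIndex n x)| * ((2 : ℝ) ^ n) ^ c) := by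
  filter_upwards [hlow, hD, h.unit] with x ⟨κ, hκ, hl⟩ hu hx ⟨B, hB⟩
  refine hu ⟨B / κ, ?_⟩
  rintro _ ⟨n, rfl⟩
  have h1 : |D n (dyadicIndex n x)| * ((2 : ℝ) ^ n) ^ c ≤ B := hB ⟨n, rfl⟩
  have hp := h.pos n _ (dyadicIndex_lt hx n)
  have h2 := hl n
  dsimp only
  rw [abs_div, abs_of_pos hp, le_div_iff₀ hκ, div_mul_eq_mul_div, div_le_iff₀ hp]
  have h3 : |D n (dyadicIndex n x)| * κ ≤
      |D n (dyadicIndex n x)| * (m n (dyadicIndex n x) * ((2 : ℝ) ^ n) ^ c) := by gcongr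
  have h4 := mul_le_mul_of_nonneg_right h1 hp.le
  linarith

/-- Inside every dyadic interval there are dyadic intervals where `D`, normalized by the length to
the power `c`, is arbitrarily large. -/
lemma HasDyadicMass.exists_large (h : HasDyadicMass μ m) (hm : DyadicAdditive m)
    (hDa : DyadicAdditive D) {η : ℝ} (hη : 0 < η)
    (hchild : ∀ n, ∀ j < 2 ^ (n + 1), η * m n (j / 2) ≤ m (n + 1) j) {c : ℝ} (hc : 0 ≤ c)
    (hlow : HasMassLowerBound μ m c) (hD : HasUnboundedDensity μ m D) (n₀ : ℕ) {j₀ : ℕ}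
    (hj₀ : j₀ < 2 ^ n₀) (M : ℝ) :
    ∃ l j, j / 2 ^ l = j₀ ∧ M < D (n₀ + l) j * ((2 : ℝ) ^ (n₀ + l)) ^ c := by
  by_contra! hcon
  have hcon' : ∀ l j, j / 2 ^ l = j₀ → D (n₀ + l) j * ((2 : ℝ) ^ (n₀ + l)) ^ c ≤ |M| :=
    fun l j hj => (hcon l j hj).trans (le_abs_self M)
  have hYa : DyadicAdditive fun n j => m n j * (D n j / m n j) := by
    intro n j hj
    have h1 := (h.pos n j hj).ne'
    have h2 := (h.pos (n + 1) (2 * j) (by rw [pow_succ]; omega)).ne'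
    have h3 := (h.pos (n + 1) (2 * j + 1) (by rw [pow_succ]; omega)).ne'
    simp only [mul_div_cancel₀ _ h1, mul_div_cancel₀ _ h2, mul_div_cancel₀ _ h3]
    exact hDa n j hj
  -- A path stays in `S N` if it passes through `j₀` and its normalized mass never drops below
  -- 1/(N+1). The sets for all N cover almost all of the interval `j₀`.
  let S : ℕ → ℕ → ℕ → Prop := fun N n j =>
    (1 : ℝ) / (N + 1) ≤ m n j * ((2 : ℝ) ^ n) ^ c ∧ ∀ l, n = n₀ + l → j / 2 ^ l = j₀
  let C₀ : ℝ := ∑ n ∈ Finset.range (n₀ + 1), ∑ j ∈ Finset.range (2 ^ n), |D n j / m n j|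
  have hC₀ : ∀ n ≤ n₀, ∀ j < 2 ^ n, D n j / m n j ≤ C₀ := by
    intro n hn j hj
    refine (le_abs_self _).trans ?_
    refine le_trans ?_ (Finset.single_le_sum
      (f := fun n => ∑ j ∈ Finset.range (2 ^ n), |D n j / m n j|)
      (fun _ _ => Finset.sum_nonneg fun _ _ => abs_nonneg _) (Finset.mem_range.2 (Nat.lt_succ_of_le hn)))
    exact Finset.single_le_sum (f := fun j => |D n j / m n j|) (fun _ _ => abs_nonneg _)
      (Finset.mem_range.2 hj)
  have hconv : ∀ N : ℕ, ∀ᵐ x ∂μ, (∀ n, S N n (dyadicIndex n x)) →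
      ∃ l, Tendsto (fun n => D n (dyadicIndex n x) / m n (dyadicIndex n x)) atTop (𝓝 l) := by
    intro N
    refine h.ae_tendsto_of_good hm hYa (S N) (C := max C₀ (|M| * (N + 1) / η))
      (fun j hj => (hC₀ 0 (Nat.zero_le _) j hj).trans (le_max_left _ _)) fun n j hj hS => ?_
    rcases le_or_gt (n + 1) n₀ with hn | hn
    · exact (hC₀ _ hn j hj).trans (le_max_left _ _)
    · refine le_trans ?_ (le_max_right _ _)
      obtain ⟨l, rfl⟩ := Nat.exists_eq_add_of_le (Nat.lt_succ_iff.1 hn)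
      have hd := hcon' (l + 1) j (by rw [pow_succ', ← Nat.div_div_eq_div_mul]; exact hS.2 l rfl)
      rw [← add_assoc] at hd
      have hp := h.pos _ j hj
      have hpow : ((2 : ℝ) ^ (n₀ + l)) ^ c ≤ ((2 : ℝ) ^ (n₀ + l + 1)) ^ c :=
        Real.rpow_le_rpow (by positivity) (pow_le_pow_right₀ one_le_two (Nat.le_succ _)) hc
      -- The stopped process includes the first interval outside `S N`. There the mass bound is
      -- lost, but only by the factor η, since a half carries at least the share η of its parent.
      have hmass : η / (N + 1) ≤ m (n₀ + l + 1) j * ((2 : ℝ) ^ (n₀ + l + 1)) ^ c :=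
        calc η / (N + 1) = η * (1 / (N + 1)) := by ring
          _ ≤ η * (m (n₀ + l) (j / 2) * ((2 : ℝ) ^ (n₀ + l)) ^ c) :=
            mul_le_mul_of_nonneg_left hS.1 hη.le
          _ = η * m (n₀ + l) (j / 2) * ((2 : ℝ) ^ (n₀ + l)) ^ c := by ring
          _ ≤ m (n₀ + l + 1) j * ((2 : ℝ) ^ (n₀ + l + 1)) ^ c :=
            mul_le_mul (hchild _ j hj) hpow (by positivity) hp.le
      have hN : (0 : ℝ) < N + 1 := by positivity
      have hq : (0 : ℝ) < ((2 : ℝ) ^ (n₀ + l + 1)) ^ c := by positivity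
      rw [div_le_iff₀ hp, ← mul_le_mul_iff_left₀ hq]
      calc _ ≤ |M| := hd
        _ = |M| * (N + 1) / η * (η / (N + 1)) := by field_simp
        _ ≤ |M| * (N + 1) / η * (m (n₀ + l + 1) j * ((2 : ℝ) ^ (n₀ + l + 1)) ^ c) := by gcongr
        _ = _ := by ring
  -- Convergence makes D/m bounded along the path, against `hD`; so the interval `j₀` would be a
  -- null set, although its mass is positive.
  have hae : ∀ᵐ x ∂μ, x ∉ dyadicIndex n₀ ⁻¹' {j₀} := by
    filter_upwards [ae_all_iff.2 hconv, hlow, hD] with x h1 ⟨κ, hκ, h2⟩ h3 hx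
    obtain ⟨N, hN⟩ := exists_nat_one_div_lt hκ
    obtain ⟨l, hl⟩ := h1 N fun n => ⟨hN.le.trans (h2 n), fun l hl => by
      rw [hl, dyadicIndex_add_div]; exact hx⟩
    exact h3 (hl.abs.bddAbove_range)
  have h0 : μ (dyadicIndex n₀ ⁻¹' {j₀}) = 0 := by
    rw [ae_iff] at hae
    simpa only [not_not, ofPred_mem_eq] using hae
  rw [h.mass n₀ j₀ hj₀, ENNReal.ofReal_eq_zero] at h0
  linarith [h.pos n₀ j₀ hj₀]

/-- The density is unbounded if `m` is split in proportion `P : 1 - P` and the derivative of this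
proportion is bounded and bounded away from `0`. -/
lemma HasDyadicMass.hasUnboundedDensity (h : HasDyadicMass μ m) (hm : DyadicAdditive m)
    (hDa : DyadicAdditive D) {η ε C : ℝ} (hη : 0 < η) (hε : 0 < ε)
    (hsplit : ∀ n, ∀ j < 2 ^ n, ∃ P ∈ Icc η (1 - η), ∃ Q ∈ Icc ε C,
      m (n + 1) (2 * j) = P * m n j ∧ D (n + 1) (2 * j) = P * D n j + Q * m n j) :
    HasUnboundedDensity μ m D := by
  have hYa : DyadicAdditive fun n j => m n j * (D n j / m n j) := by
    intro n j hj
    have h1 := (h.pos n j hj).ne'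
    have h2 := (h.pos (n + 1) (2 * j) (by rw [pow_succ]; omega)).ne'
    have h3 := (h.pos (n + 1) (2 * j + 1) (by rw [pow_succ]; omega)).ne'
    simp only [mul_div_cancel₀ _ h1, mul_div_cancel₀ _ h2, mul_div_cancel₀ _ h3]
    exact hDa n j hj
  -- The jump of D/m is Q/P into the left half and -Q/(1-P) into the right half.
  have hinc : ∀ n, ∀ j < 2 ^ (n + 1), D (n + 1) j / m (n + 1) j - D n (j / 2) / m n (j / 2) ≤ C / η ∧
      ε ≤ |D (n + 1) j / m (n + 1) j - D n (j / 2) / m n (j / 2)| := by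
    intro n j hj
    have hj2 : j / 2 < 2 ^ n := by rw [pow_succ] at hj; omega
    obtain ⟨P, ⟨hP, hP'⟩, Q, ⟨hQ, hQ'⟩, e1, e2⟩ := hsplit n (j / 2) hj2
    have hp := h.pos n _ hj2
    have a1 := hm n _ hj2
    have a2 := hDa n _ hj2
    have hPpos : 0 < P := hη.trans_le hP
    have hPpos' : 0 < 1 - P := by linarith
    rcases Nat.even_or_odd' j with ⟨i, rfl | rfl⟩
    · rw [show 2 * i / 2 = i by omega] at *
      have : D (n + 1) (2 * i) / m (n + 1) (2 * i) - D n i / m n i = Q / P := by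
        rw [e1, e2]
        field_simp
        ring
      rw [this]
      constructor
      · have : 0 ≤ C := by linarith
        gcongr
      · refine (le_trans ?_ (le_abs_self _))
        rw [le_div_iff₀ hPpos]
        nlinarith
    · rw [show (2 * i + 1) / 2 = i by omega] at *
      have e3 : m (n + 1) (2 * i + 1) = (1 - P) * m n i := by linarith
      have e4 : D (n + 1) (2 * i + 1) = (1 - P) * D n i - Q * m n i := by linarith
      have : D (n + 1) (2 * i + 1) / m (n + 1) (2 * i + 1) - D n i / m n i = -(Q / (1 - P)) := by
        rw [e3, e4]
        field_simp
        ring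
      rw [this]
      have hQP : ε ≤ Q / (1 - P) := by
        rw [le_div_iff₀ hPpos']
        nlinarith
      constructor
      · have : 0 ≤ C / η := by
          have : 0 ≤ C := by linarith
          positivity
        linarith
      · rw [abs_neg]
        exact hQP.trans (le_abs_self _)
  have hconv : ∀ N : ℕ, ∀ᵐ x ∂μ, (∀ n, |D n (dyadicIndex n x) / m n (dyadicIndex n x)| ≤ N) →
      ∃ l, Tendsto (fun n => D n (dyadicIndex n x) / m n (dyadicIndex n x)) atTop (𝓝 l) := by
    intro N
    refine h.ae_tendsto_of_good hm hYa (fun n j => |D n j / m n j| ≤ N)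
      -- The first value outside [-N, N] exceeds N by at most one jump, that is by at most C/η.
      (C := max (D 0 0 / m 0 0) (N + C / η)) (fun j hj => ?_) fun n j hj hS => ?_
    · obtain rfl : j = 0 := by simpa using hj
      exact le_max_left _ _
    · refine le_trans ?_ (le_max_right _ _)
      have h1 := (hinc n j hj).1
      have h2 := (le_abs_self _).trans hS
      linarith
  filter_upwards [ae_all_iff.2 hconv, h.unit] with x h1 hx ⟨B, hB⟩
  obtain ⟨N, hN⟩ := exists_nat_ge B
  obtain ⟨l, hl⟩ := h1 N fun n => (hB ⟨n, rfl⟩ : _ ≤ B).trans hN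
  have hdiff := ((hl.comp (tendsto_add_atTop_nat 1)).sub hl).abs
  rw [sub_self, abs_zero] at hdiff
  obtain ⟨n, hn⟩ := (hdiff.eventually_lt_const hε).exists
  have := (hinc n _ (dyadicIndex_lt hx (n + 1))).2
  rw [dyadicIndex_succ_div] at this
  simp only [Function.comp] at hn
  linarith

/-- Unboundedness of the density passes from `D` to `D'` if the increments of the density of `D'`
are comparable with the density of `D`. -/
lemma HasDyadicMass.hasUnboundedDensity_succ (h : HasDyadicMass μ m) (hm : DyadicAdditive m)
    {D' : ℕ → ℕ → ℝ} (hDa' : DyadicAdditive D') {a k : ℝ} (ha : a ∈ Ioo (0 : ℝ) 1) (hk : 1 ≤ k)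
    (hma : ∀ n, ∀ j < 2 ^ n, m (n + 1) (2 * j) = a * m n j)
    (hD' : ∀ n, ∀ j < 2 ^ n, D' (n + 1) (2 * j) = a * D' n j + k * D n j)
    (hD : HasUnboundedDensity μ m D) : HasUnboundedDensity μ m D' := by
  obtain ⟨ha0, ha1⟩ := ha
  -- The jumps of D'/m are (k/a)(D/m) and -(k/(1-a))(D/m), with both factors of modulus at least 1.
  -- A bound B for |D'/m| therefore gives the bound 2B for |D/m|.
  have hinc : ∀ n, ∀ j < 2 ^ (n + 1), |D n (j / 2) / m n (j / 2)| ≤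
      |D' (n + 1) j / m (n + 1) j - D' n (j / 2) / m n (j / 2)| := by
    intro n j hj
    have hj2 : j / 2 < 2 ^ n := by rw [pow_succ] at hj; omega
    have e1 := hma n _ hj2
    have e2 := hD' n _ hj2
    have hp := h.pos n _ hj2
    have a1 := hm n _ hj2
    have a2 := hDa' n _ hj2
    have ha1' : 0 < 1 - a := by linarith
    rcases Nat.even_or_odd' j with ⟨i, rfl | rfl⟩
    · rw [show 2 * i / 2 = i by omega] at *
      have : D' (n + 1) (2 * i) / m (n + 1) (2 * i) - D' n i / m n i = k / a * (D n i / m n i) := by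
        rw [e1, e2]
        field_simp
        ring
      rw [this, abs_mul]
      refine le_mul_of_one_le_left (abs_nonneg _) ((le_trans ?_ (le_abs_self _)))
      rw [le_div_iff₀ ha0]
      linarith
    · rw [show (2 * i + 1) / 2 = i by omega] at *
      have e3 : m (n + 1) (2 * i + 1) = (1 - a) * m n i := by linarith
      have e4 : D' (n + 1) (2 * i + 1) = (1 - a) * D' n i - k * D n i := by linarith
      have : D' (n + 1) (2 * i + 1) / m (n + 1) (2 * i + 1) - D' n i / m n i =
          -(k / (1 - a) * (D n i / m n i)) := by
        rw [e3, e4]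
        field_simp
        ring
      rw [this, abs_neg, abs_mul]
      refine le_mul_of_one_le_left (abs_nonneg _) ((le_trans ?_ (le_abs_self _)))
      rw [le_div_iff₀ ha1']
      linarith
  filter_upwards [hD, h.unit] with x h1 hx ⟨B, hB⟩
  refine h1 ⟨2 * B, ?_⟩
  rintro _ ⟨n, rfl⟩
  have h2 := hinc n _ (dyadicIndex_lt hx (n + 1))
  rw [dyadicIndex_succ_div] at h2
  have b1 : |D' n (dyadicIndex n x) / m n (dyadicIndex n x)| ≤ B := hB ⟨n, rfl⟩
  have b2 : |D' (n + 1) (dyadicIndex (n + 1) x) / m (n + 1) (dyadicIndex (n + 1) x)| ≤ B :=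
    hB ⟨n + 1, rfl⟩
  refine h2.trans ((abs_sub _ _).trans ?_)
  linarith

end

/-! ### From dyadic increments to quotients on open intervals. -/

lemma exists_dyadic_subset {u v : ℝ} (hu : 0 ≤ u) (huv : u < v) (hv : v ≤ 1) :
    ∃ n j : ℕ, j < 2 ^ n ∧ u < j / 2 ^ n ∧ ((j : ℝ) + 1) / 2 ^ n < v := by
  have hlim : Tendsto (fun n : ℕ => ((2 : ℝ) ^ n)⁻¹) atTop (𝓝 0) :=
    tendsto_inv_atTop_zero.comp (tendsto_pow_atTop_atTop_of_one_lt one_lt_two)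
  -- With mesh below (v - u)/2, the interval next to the one containing `u` still lies to the left
  -- of `v`.
  obtain ⟨n, hn⟩ := (hlim.eventually_lt_const (u := (v - u) / 2) (by linarith)).exists
  obtain ⟨b1, b2⟩ := dyadicIndex_bounds hu n
  have h2 : (((dyadicIndex n u + 1 : ℕ) : ℝ) + 1) / 2 ^ n < v := by
    have : (((dyadicIndex n u + 1 : ℕ) : ℝ) + 1) / 2 ^ n =
        (dyadicIndex n u : ℝ) / 2 ^ n + 2 * ((2 : ℝ) ^ n)⁻¹ := by push_cast; ring
    rw [this]
    linarith
  refine ⟨n, dyadicIndex n u + 1, ?_, by push_cast; exact b2, h2⟩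
  have h3 := h2.trans_le hv
  rw [div_lt_one (by positivity)] at h3
  have h4 : ((dyadicIndex n u + 1 : ℕ) : ℝ) < ((2 ^ n : ℕ) : ℝ) := by push_cast at h3 ⊢; linarith
  exact_mod_cast h4

lemma dyadic_descendant_bounds {n l j j₀ : ℕ} (h : j / 2 ^ l = j₀) :
    (j₀ : ℝ) / 2 ^ n ≤ j / 2 ^ (n + l) ∧ ((j : ℝ) + 1) / 2 ^ (n + l) ≤ (j₀ + 1) / 2 ^ n := by
  have hp : 0 < 2 ^ l := by positivity
  have h1 : j₀ * 2 ^ l ≤ j := (Nat.le_div_iff_mul_le hp).1 h.ge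
  have h2 : j + 1 ≤ (j₀ + 1) * 2 ^ l := (Nat.div_lt_iff_lt_mul hp).1 (by omega)
  have h1' : (j₀ : ℝ) * 2 ^ l ≤ j := by exact_mod_cast h1
  have h2' : (j : ℝ) + 1 ≤ (j₀ + 1) * 2 ^ l := by exact_mod_cast h2
  rw [pow_add]
  constructor
  · rw [div_le_div_iff₀ (by positivity) (by positivity)]
    calc (j₀ : ℝ) * (2 ^ n * 2 ^ l) = (j₀ * 2 ^ l) * 2 ^ n := by ring
      _ ≤ j * 2 ^ n := by gcongr
  · rw [div_le_div_iff₀ (by positivity) (by positivity)]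
    calc ((j : ℝ) + 1) * 2 ^ n ≤ ((j₀ + 1) * 2 ^ l) * 2 ^ n := by gcongr
      _ = _ := by ring

/-- The normalized increments of `f` are unbounded above on every open subinterval of `[0, 1]`. -/
def UnboundedQuot (f : ℝ → ℝ) (c : ℝ) : Prop :=
  ∀ u v : ℝ, 0 ≤ u → u < v → v ≤ 1 → ∀ M : ℝ, ∃ x ∈ Ioo u v, ∃ y ∈ Ioo u v, y < x ∧
    M < (f x - f y) / (x - y) ^ c

lemma unboundedQuot_of_exists_large {f : ℝ → ℝ} {c : ℝ}
    (hf : ∀ n₀ : ℕ, ∀ j₀ < 2 ^ n₀, ∀ M : ℝ, ∃ l j, j / 2 ^ l = j₀ ∧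
      M < dyadicInc f (n₀ + l) j * ((2 : ℝ) ^ (n₀ + l)) ^ c) : UnboundedQuot f c := by
  intro u v hu huv hv M
  obtain ⟨n₀, j₀, hj₀, h1, h2⟩ := exists_dyadic_subset hu huv hv
  obtain ⟨l, j, hj, hM⟩ := hf n₀ j₀ hj₀ M
  obtain ⟨b1, b2⟩ := dyadic_descendant_bounds (n := n₀) hj
  have e : ((j : ℝ) + 1) / 2 ^ (n₀ + l) - j / 2 ^ (n₀ + l) = (2 ^ (n₀ + l))⁻¹ := by ring
  have hpos : (0 : ℝ) < (2 ^ (n₀ + l))⁻¹ := by positivity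
  refine ⟨(j + 1) / 2 ^ (n₀ + l), ⟨by linarith, by linarith⟩, j / 2 ^ (n₀ + l),
    ⟨by linarith, by linarith⟩, by linarith, ?_⟩
  rw [e, Real.inv_rpow (by positivity), div_inv_eq_mul]
  exact hM

lemma supQuot_eq_top {f : ℝ → ℝ} {c : ℝ} (hf : UnboundedQuot f c) {u v : ℝ} (hu : 0 ≤ u)
    (huv : u < v) (hv : v ≤ 1) : supQuot f c (Ioo u v) = ⊤ := by
  rw [EReal.eq_top_iff_forall_lt]
  intro M
  obtain ⟨x, hx, y, hy, hxy, hM⟩ := hf u v hu huv hv M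
  refine (EReal.coe_lt_coe_iff.2 hM).trans_le ?_
  exact le_iSup₂_of_le x hx (le_iSup₂_of_le y hy (le_iSup_of_le hxy le_rfl))

lemma infQuot_eq_bot {f : ℝ → ℝ} {c : ℝ} (hf : UnboundedQuot (-f) c) {u v : ℝ} (hu : 0 ≤ u)
    (huv : u < v) (hv : v ≤ 1) : infQuot f c (Ioo u v) = ⊥ := by
  rw [EReal.eq_bot_iff_forall_lt]
  intro M
  obtain ⟨x, hx, y, hy, hxy, hM⟩ := hf u v hu huv hv (-M)
  have hM' : (f x - f y) / (x - y) ^ c < M := by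
    have : ((-f) x - (-f) y) / (x - y) ^ c = -((f x - f y) / (x - y) ^ c) := by
      simp only [Pi.neg_apply]; ring
    linarith
  refine lt_of_le_of_lt ?_ (EReal.coe_lt_coe_iff.2 hM')
  exact iInf₂_le_of_le x hx (iInf₂_le_of_le y hy (iInf_le_of_le hxy le_rfl))

/-- For 0 < x - y < 1 and c ≤ 1 one has x - y ≤ (x - y)^c, so a positive quotient can only grow.
Positivity is secured by exceeding |M| instead of M. -/
lemma UnboundedQuot.one {f : ℝ → ℝ} {c : ℝ} (hf : UnboundedQuot f c) (hc : c ≤ 1) :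
    UnboundedQuot f 1 := by
  intro u v hu huv hv M
  obtain ⟨x, hx, y, hy, hxy, hM⟩ := hf u v hu huv hv |M|
  refine ⟨x, hx, y, hy, hxy, (le_abs_self M).trans_lt (hM.trans_le ?_)⟩
  have hd : 0 < x - y := by linarith
  have hnum : 0 < f x - f y := by
    have := (abs_nonneg M).trans_lt hM
    have hp : 0 < (x - y) ^ c := by positivity
    rwa [div_pos_iff_of_pos_right hp] at this
  exact div_le_div_of_nonneg_left hnum.le (by positivity)
    (Real.rpow_le_rpow_of_exponent_ge hd (by linarith [hx.2, hy.1]) hc)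

lemma isMTNI_of_unboundedQuot {f : ℝ → ℝ} (hf : UnboundedQuot f 1) (hf' : UnboundedQuot (-f) 1) :
    IsMTNI f := by
  intro u v hu huv hv
  constructor
  · rw [EReal.eq_bot_iff_forall_lt]
    intro M
    obtain ⟨x, hx, y, hy, hxy, hM⟩ := hf' u v hu huv hv (-M)
    rw [Real.rpow_one] at hM
    have hM' : (f x - f y) / (x - y) < M := by
      have : ((-f) x - (-f) y) / (x - y) = -((f x - f y) / (x - y)) := by
        simp only [Pi.neg_apply]; ring
      linarith
    refine lt_of_le_of_lt ?_ (EReal.coe_lt_coe_iff.2 hM')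
    exact iInf₂_le_of_le x hx (iInf₂_le_of_le y hy (iInf_le_of_le hxy.ne' le_rfl))
  · rw [EReal.eq_top_iff_forall_lt]
    intro M
    obtain ⟨x, hx, y, hy, hxy, hM⟩ := hf u v hu huv hv M
    rw [Real.rpow_one] at hM
    refine (EReal.coe_lt_coe_iff.2 hM).trans_le ?_
    exact le_iSup₂_of_le x hx (le_iSup₂_of_le y hy (le_iSup_of_le hxy.ne' le_rfl))

lemma HasUnboundedDensity.neg {μ : Measure ℝ} {m : ℕ → ℕ → ℝ} {f : ℝ → ℝ}
    (h : HasUnboundedDensity μ m (dyadicInc f)) : HasUnboundedDensity μ m (dyadicInc (-f)) := by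
  have : dyadicInc (-f) = fun n j => -dyadicInc f n j := by
    ext n j
    simp only [dyadicInc, Pi.neg_apply]
    ring
  rw [this]
  unfold HasUnboundedDensity at h ⊢
  simpa only [neg_div, abs_neg] using h

/-! ### The de Rham measure on dyadic intervals. -/

namespace DRParam

variable {p : DRParam} {f : StieltjesFunction ℝ}

lemma G₀_apply (p : DRParam) (y : ℝ) : p.G₀ y = p.b * (p.c₀ + 1) * y + p.c₀ := by
  simp [G₀, mobius, A₀]

lemma G₁_apply (p : DRParam) (y : ℝ) :
    p.G₁ y = ((1 - p.b + p.c₁) * y + p.c₁) / (p.b * y + 1) := by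
  simp [G₁, mobius, A₁]

/-- If `(r, s)` is the lower row of the matrix product that belongs to the `j`-th dyadic interval of
level `n`, then this is `r / s`. -/
noncomputable def rowRatio (p : DRParam) : ℕ → ℕ → ℝ
  | 0, _ => 0
  | n + 1, j => if j % 2 = 0 then p.G₀ (rowRatio p n (j / 2)) else p.G₁ (rowRatio p n (j / 2))

lemma rowRatio_even (p : DRParam) (n j : ℕ) :
    p.rowRatio (n + 1) (2 * j) = p.G₀ (p.rowRatio n j) := by
  rw [rowRatio, if_pos (by omega), show 2 * j / 2 = j by omega]

lemma rowRatio_odd (p : DRParam) (n j : ℕ) :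
    p.rowRatio (n + 1) (2 * j + 1) = p.G₁ (p.rowRatio n j) := by
  rw [rowRatio, if_neg (by omega), show (2 * j + 1) / 2 = j by omega]

/-- An invariant set of `G₀` and `G₁` that contains `0` contains all row ratios. -/
lemma rowRatio_mem {s : Set ℝ} (h0 : (0 : ℝ) ∈ s) (hG₀ : MapsTo p.G₀ s s) (hG₁ : MapsTo p.G₁ s s)
    (n j : ℕ) : p.rowRatio n j ∈ s := by
  induction n generalizing j with
  | zero => exact h0
  | succ n ih =>
    rw [rowRatio]
    split_ifs
    exacts [hG₀ (ih _), hG₁ (ih _)]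

/-- The proportion of the mass of a dyadic interval with row ratio `y` in its left half. -/
noncomputable def leftShare (p : DRParam) (y : ℝ) : ℝ := p.b * (1 + y) / (1 + p.b * y)

lemma Cond.c₀_add_one_pos (h : p.Cond) : 0 < p.c₀ + 1 := by
  linarith [h.1.1, h.2.1.1]

lemma Cond.c₁_add_one_pos (h : p.Cond) : 0 < p.c₁ + 1 := by
  linarith [h.1.2, h.2.2.1]

lemma Cond.slope_lt_one (h : p.Cond) : p.b * (p.c₀ + 1) < 1 := by
  have : p.c₀ + 1 < 1 / p.b := by linarith [h.2.1.2]
  rwa [lt_div_iff₀ h.1.1, mul_comm] at this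

lemma Cond.c₁_mul_lt (h : p.Cond) : p.c₁ * (1 - p.b) < p.b := by
  have := h.2.2.2
  rwa [lt_div_iff₀ (by linarith [h.1.2])] at this

lemma Cond.den_pos (h : p.Cond) {y : ℝ} (hy : -1 < y) : 0 < p.b * y + 1 := by
  nlinarith [h.1.1, h.1.2]

lemma Cond.leftShare_pos (h : p.Cond) {y : ℝ} (hy : -1 < y) : 0 < p.leftShare y := by
  have := h.den_pos hy
  exact div_pos (mul_pos h.1.1 (by linarith)) (by linarith)

lemma Cond.one_sub_leftShare (h : p.Cond) {y : ℝ} (hy : -1 < y) :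
    1 - p.leftShare y = (1 - p.b) / (1 + p.b * y) := by
  have := h.den_pos hy
  rw [leftShare]
  have h' : 1 + p.b * y ≠ 0 := by linarith
  field_simp
  ring

lemma Cond.leftShare_lt_one (h : p.Cond) {y : ℝ} (hy : -1 < y) : p.leftShare y < 1 := by
  have h1 := h.one_sub_leftShare hy
  have h2 : 0 < (1 - p.b) / (1 + p.b * y) :=
    div_pos (by linarith [h.1.2]) (by linarith [h.den_pos hy])
  linarith

/-- In the coordinate y + 1 the positivity of both maps becomes visible, so (-1, ∞), where all
denominators are positive, is invariant. -/
lemma G₀_add_one (p : DRParam) (y : ℝ) : p.G₀ y + 1 = (p.c₀ + 1) * (p.b * y + 1) := by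
  rw [G₀_apply]
  ring

lemma Cond.G₁_add_one (h : p.Cond) {y : ℝ} (hy : -1 < y) :
    p.G₁ y + 1 = (p.c₁ + 1) * (y + 1) / (p.b * y + 1) := by
  have := (h.den_pos hy).ne'
  rw [G₁_apply]
  field_simp
  ring

lemma Cond.mapsTo_G₀_Ioi (h : p.Cond) : MapsTo p.G₀ (Ioi (-1)) (Ioi (-1)) := fun y hy => by
  have h1 := p.G₀_add_one y
  have h2 := mul_pos h.c₀_add_one_pos (h.den_pos hy)
  simp only [mem_Ioi]
  linarith

lemma Cond.mapsTo_G₁_Ioi (h : p.Cond) : MapsTo p.G₁ (Ioi (-1)) (Ioi (-1)) := fun y hy => by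
  have h1 := h.G₁_add_one hy
  have h2 : 0 < (p.c₁ + 1) * (y + 1) / (p.b * y + 1) :=
    div_pos (mul_pos h.c₁_add_one_pos (by linarith [mem_Ioi.1 hy])) (h.den_pos hy)
  simp only [mem_Ioi]
  linarith

lemma Cond.rowRatio_gt (h : p.Cond) (n j : ℕ) : -1 < p.rowRatio n j :=
  rowRatio_mem (s := Ioi (-1)) (by simp) h.mapsTo_G₀_Ioi h.mapsTo_G₁_Ioi n j

lemma Cond.neg_one_lt_α (h : p.Cond) : -1 < p.α := by
  have h1 := h.slope_lt_one
  refine lt_min (by norm_num) (lt_min ?_ ?_)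
  · rw [lt_div_iff₀ (by linarith)]
    nlinarith [mul_pos h.c₀_add_one_pos (sub_pos.2 h.1.2)]
  · rw [lt_div_iff₀ h.1.1]
    linarith [h.2.2.1]

lemma zero_mem_Icc_α_β (p : DRParam) : (0 : ℝ) ∈ Icc p.α p.β :=
  ⟨min_le_left _ _, le_max_left _ _⟩

/-- `G₀` is affine with slope in (0, 1), and its fixed point c₀/(1 - b₁(c₀+1)) lies in [α, β], so
both ends are moved inwards. -/
lemma Cond.mapsTo_G₀_Icc (h : p.Cond) : MapsTo p.G₀ (Icc p.α p.β) (Icc p.α p.β) := by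
  have h1 := h.slope_lt_one
  have h0 := mul_pos h.1.1 h.c₀_add_one_pos
  have a1 : p.α ≤ p.c₀ / (1 - p.b * (p.c₀ + 1)) := (min_le_right _ _).trans (min_le_left _ _)
  have b1 : p.c₀ / (1 - p.b * (p.c₀ + 1)) ≤ p.β := (le_max_left _ _).trans (le_max_right _ _)
  rw [le_div_iff₀ (by linarith)] at a1
  rw [div_le_iff₀ (by linarith)] at b1
  intro y hy
  rw [G₀_apply]
  constructor
  · nlinarith [hy.1]
  · nlinarith [hy.2]

/-- The fixed points of `G₁` are -1 and c₁/b₁, for G₁(y) - y = (c₁ - b₁y)(y + 1)/(b₁y + 1). As `G₁`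
increases on (-1, ∞) and α ≤ c₁/b₁ ≤ β, neither end is moved outwards. -/
lemma Cond.mapsTo_G₁_Icc (h : p.Cond) : MapsTo p.G₁ (Icc p.α p.β) (Icc p.α p.β) := by
  have hb := h.1.1
  have hb' := h.1.2
  have hc := h.c₁_add_one_pos
  have hα := h.neg_one_lt_α
  have a1 : p.α ≤ p.c₁ / p.b := (min_le_right _ _).trans (min_le_right _ _)
  have b1 : p.c₁ / p.b ≤ p.β := (le_max_right _ _).trans (le_max_right _ _)
  rw [le_div_iff₀ hb] at a1
  rw [div_le_iff₀ hb] at b1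
  have hβ : 0 ≤ p.β := p.zero_mem_Icc_α_β.2
  intro y hy
  have hd := h.den_pos (hα.trans_le hy.1)
  have hs : 0 < (1 - p.b) * (1 + p.c₁) := mul_pos (by linarith) (by linarith)
  have da := h.den_pos hα
  have db := h.den_pos (y := p.β) (by linarith)
  have mono : ∀ u v : ℝ, -1 < u → u ≤ v → p.G₁ u ≤ p.G₁ v := fun u v hu huv => by
    have du := h.den_pos hu
    have dv := h.den_pos (hu.trans_le huv)
    rw [G₁_apply, G₁_apply, div_le_div_iff₀ du dv]
    nlinarith [mul_nonneg hs.le (sub_nonneg.2 huv)]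
  constructor
  · refine le_trans ?_ (mono _ _ hα hy.1)
    rw [G₁_apply, le_div_iff₀ da]
    nlinarith
  · refine (mono _ _ (hα.trans_le hy.1) hy.2).trans ?_
    rw [G₁_apply, div_le_iff₀ db]
    nlinarith

lemma Cond.rowRatio_mem_Icc (h : p.Cond) (n j : ℕ) : p.rowRatio n j ∈ Icc p.α p.β :=
  rowRatio_mem p.zero_mem_Icc_α_β h.mapsTo_G₀_Icc h.mapsTo_G₁_Icc n j

namespace IsDeRham

lemma mem_Icc (hf : p.IsDeRham f) (x : ℝ) : f x ∈ Icc (0 : ℝ) 1 :=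
  mem_Icc_of_dist f.mono hf.left hf.right x

lemma apply_half (hf : p.IsDeRham f) (h : p.Cond) : f (1 / 2) = p.b := by
  rw [hf.eq₀ _ (by norm_num), mul_one_div_cancel two_ne_zero, hf.right 1 le_rfl,
    (mobius_ends h).2.1]

/-- The distribution function inside a dyadic interval. -/
lemma sub_eq (hf : p.IsDeRham f) (h : p.Cond) (n : ℕ) : ∀ j : ℕ, j < 2 ^ n → ∀ z ∈ Icc (0 : ℝ) 1,
    f ((j + z) / 2 ^ n) - f (j / 2 ^ n) =
      dyadicInc f n j * ((1 + p.rowRatio n j) * f z / (1 + p.rowRatio n j * f z)) := by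
  have hden : ∀ {y z : ℝ}, -1 < y → 0 < 1 + y * f z := fun {y z} hy => by
    obtain ⟨h0, h1⟩ := hf.mem_Icc z
    rcases h0.eq_or_lt with h0 | h0
    · simp [← h0]
    · nlinarith [mul_pos h0 (neg_lt_iff_pos_add.1 hy)]
  have hb : 0 < p.b := h.1.1
  have hb1 : p.b < 1 := h.1.2
  induction n with
  | zero =>
    intro j hj z hz
    obtain rfl : j = 0 := by simpa using hj
    simp [dyadicInc, rowRatio, hf.left 0 le_rfl, hf.right 1 le_rfl]
  | succ n ih =>
    intro j hj z hz
    have hj2 : j / 2 < 2 ^ n := by rw [pow_succ] at hj; omega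
    have hz0 := (hf.mem_Icc z).1
    have hz1 := (hf.mem_Icc z).2
    have e0 : ∀ i : ℕ, ((2 * i : ℕ) : ℝ) / 2 ^ (n + 1) = (i + 0) / 2 ^ n := fun i => by
      rw [pow_succ]; push_cast; field_simp; ring
    have e1 : ∀ (i : ℕ) (w : ℝ), (((2 * i : ℕ) : ℝ) + w) / 2 ^ (n + 1) = (i + w / 2) / 2 ^ n :=
      fun i w => by rw [pow_succ]; push_cast; field_simp
    have e2 : ∀ (i : ℕ) (w : ℝ),
        (((2 * i + 1 : ℕ) : ℝ) + w) / 2 ^ (n + 1) = (i + (1 + w) / 2) / 2 ^ n :=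
      fun i w => by rw [pow_succ]; push_cast; field_simp; ring
    have hc0 := h.c₀_add_one_pos
    have hc1 := h.c₁_add_one_pos
    have hy := h.rowRatio_gt n (j / 2)
    have hyb := h.den_pos hy
    have hy1 : 0 < 1 + p.rowRatio n (j / 2) := by linarith
    have hIH := ih _ hj2
    have hhalf := hIH (1 / 2) (by norm_num)
    rw [hf.apply_half h] at hhalf
    rcases Nat.even_or_odd' j with ⟨i, rfl | rfl⟩
    · rw [show 2 * i / 2 = i by omega] at *
      -- The point z of the left half is the point z/2 of the parent, where the functional equation
      -- expresses f(z/2) by f(z). The matrix of the new digit acts on the lower row from the right,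
      -- that is, its transpose acts on y.
      have hchild := hIH (z / 2) ⟨by linarith [hz.1], by linarith [hz.2]⟩
      rw [hf.eq₀ (z / 2) ⟨by linarith [hz.1], by linarith [hz.2]⟩, mul_div_cancel₀ _ two_ne_zero,
        mobius_A₀] at hchild
      rw [rowRatio_even, G₀_apply]
      unfold dyadicInc at hchild hhalf ⊢
      rw [e1, e1, e0, add_zero, hchild, hhalf]
      set y := p.rowRatio n i
      have d1 : 0 < p.c₀ * f z + 1 := by linarith [hden (y := p.c₀) (z := z) (by linarith)]
      have d2 : 0 < 1 + (p.b * (p.c₀ + 1) * y + p.c₀) * f z :=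
        hden (by nlinarith [mul_pos hc0 hyb])
      have d3 : 0 < 1 + y * (p.b * (p.c₀ + 1) * f z / (p.c₀ * f z + 1)) := by
        rw [mul_div_assoc', ← sub_neg_eq_add, sub_eq_add_neg, neg_neg, add_div' _ _ _ d1.ne']
        exact div_pos (by linarith) d1
      have d4 : 1 + y * p.b ≠ 0 := by linarith
      have k1 : (1 + y) * (p.b * (p.c₀ + 1) * f z / (p.c₀ * f z + 1)) /
          (1 + y * (p.b * (p.c₀ + 1) * f z / (p.c₀ * f z + 1))) =
          (1 + y) * (p.b * (p.c₀ + 1)) * f z / (1 + (p.b * (p.c₀ + 1) * y + p.c₀) * f z) := by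
        rw [div_eq_div_iff d3.ne' d2.ne']
        field_simp
        ring
      rw [k1]
      generalize f ((i + 1) / 2 ^ n) - f (i / 2 ^ n) = m
      rw [mul_assoc m]
      congr 1
      rw [div_mul_div_comm, div_eq_div_iff d2.ne' (mul_pos (by linarith) d2).ne']
      ring
    · rw [show (2 * i + 1) / 2 = i by omega] at *
      have hchild := hIH ((1 + z) / 2) ⟨by linarith [hz.1], by linarith [hz.2]⟩
      have e3 : 2 * ((1 + z) / 2) - 1 = z := by ring
      rw [hf.eq₁ ((1 + z) / 2) ⟨by linarith [hz.1], by linarith [hz.2]⟩, e3, mobius_A₁] at hchild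
      have e4 := e2 i 0
      rw [add_zero, add_zero] at e4
      have e5 := e2 i 1
      rw [one_add_one_eq_two, div_self two_ne_zero] at e5
      rw [rowRatio_odd, G₁_apply]
      unfold dyadicInc at hchild hhalf ⊢
      rw [e2, e5, e4]
      set y := p.rowRatio n i
      have d1 : 0 < p.c₁ * f z + 1 := by linarith [hden (y := p.c₁) (z := z) (by linarith)]
      have hG := h.mapsTo_G₁_Ioi hy
      rw [G₁_apply, mem_Ioi] at hG
      have d2 := hden (z := z) hG
      have d2' : 0 < p.b * y + 1 + ((1 - p.b + p.c₁) * y + p.c₁) * f z := by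
        have := mul_pos d2 hyb
        rwa [add_mul, one_mul, mul_right_comm, div_mul_cancel₀ _ hyb.ne'] at this
      have d4 : 1 + y * p.b ≠ 0 := by linarith
      have k1 : (1 + y) * (((1 - p.b + p.c₁) * f z + p.b) / (p.c₁ * f z + 1)) /
          (1 + y * (((1 - p.b + p.c₁) * f z + p.b) / (p.c₁ * f z + 1))) =
          (1 + y) * ((1 - p.b + p.c₁) * f z + p.b) /
            (p.b * y + 1 + ((1 - p.b + p.c₁) * y + p.c₁) * f z) := by
        have d3 : 1 + y * (((1 - p.b + p.c₁) * f z + p.b) / (p.c₁ * f z + 1)) =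
            (p.b * y + 1 + ((1 - p.b + p.c₁) * y + p.c₁) * f z) / (p.c₁ * f z + 1) := by
          field_simp
          ring
        rw [d3, mul_div_assoc', div_div_div_cancel_right₀ d1.ne']
      have k2 : 1 + ((1 - p.b + p.c₁) * y + p.c₁) / (p.b * y + 1) =
          (1 + p.c₁) * (1 + y) / (p.b * y + 1) := by
        field_simp
        ring
      have k3 : (1 + ((1 - p.b + p.c₁) * y + p.c₁) / (p.b * y + 1)) * f z /
          (1 + ((1 - p.b + p.c₁) * y + p.c₁) / (p.b * y + 1) * f z) =
          (1 + p.c₁) * (1 + y) * f z / (p.b * y + 1 + ((1 - p.b + p.c₁) * y + p.c₁) * f z) := by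
        have d3 : 1 + ((1 - p.b + p.c₁) * y + p.c₁) / (p.b * y + 1) * f z =
            (p.b * y + 1 + ((1 - p.b + p.c₁) * y + p.c₁) * f z) / (p.b * y + 1) := by
          field_simp
        rw [d3, k2, div_mul_eq_mul_div, div_div_div_cancel_right₀ hyb.ne']
      rw [k3]
      rw [k1] at hchild
      generalize f ((i + 1) / 2 ^ n) = F1 at *
      generalize f (i / 2 ^ n) = F0 at *
      generalize f ((i + (1 + z) / 2) / 2 ^ n) = Fz at *
      generalize f ((i + 1 / 2) / 2 ^ n) = Fh at *
      have r1 : Fz = F0 + (F1 - F0) * ((1 + y) * ((1 - p.b + p.c₁) * f z + p.b) /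
            (p.b * y + 1 + ((1 - p.b + p.c₁) * y + p.c₁) * f z)) := by linarith
      have r2 : Fh = F0 + (F1 - F0) * ((1 + y) * p.b / (1 + y * p.b)) := by linarith
      -- Increments in the right half start at the midpoint, so its share is subtracted and the
      -- remainder rescaled by the mass share of the right half.
      have k4 : (1 + y) * ((1 - p.b + p.c₁) * f z + p.b) /
            (p.b * y + 1 + ((1 - p.b + p.c₁) * y + p.c₁) * f z) - (1 + y) * p.b / (1 + y * p.b) =
          (1 - (1 + y) * p.b / (1 + y * p.b)) * ((1 + p.c₁) * (1 + y) * f z /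
            (p.b * y + 1 + ((1 - p.b + p.c₁) * y + p.c₁) * f z)) := by
        rw [div_sub_div _ _ d2'.ne' d4, one_sub_div d4, div_mul_div_comm,
          div_eq_div_iff (mul_ne_zero d2'.ne' d4) (mul_ne_zero d4 d2'.ne')]
        ring
      rw [r1, r2]
      linear_combination (F1 - F0) * k4

lemma dyadicInc_even (hf : p.IsDeRham f) (h : p.Cond) {n j : ℕ} (hj : j < 2 ^ n) :
    dyadicInc f (n + 1) (2 * j) = p.leftShare (p.rowRatio n j) * dyadicInc f n j := by
  have e1 : ((2 * j : ℕ) : ℝ) / 2 ^ (n + 1) = j / 2 ^ n := by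
    rw [pow_succ]; push_cast; field_simp
  have e2 : (((2 * j : ℕ) : ℝ) + 1) / 2 ^ (n + 1) = (j + 1 / 2) / 2 ^ n := by
    rw [pow_succ]; push_cast; field_simp
  rw [dyadicInc, e1, e2, hf.sub_eq h n j hj _ (by norm_num), hf.apply_half h, leftShare]
  ring

lemma dyadicInc_odd (hf : p.IsDeRham f) (h : p.Cond) {n j : ℕ} (hj : j < 2 ^ n) :
    dyadicInc f (n + 1) (2 * j + 1) = (1 - p.leftShare (p.rowRatio n j)) * dyadicInc f n j := by
  have h1 := dyadicInc_children f n j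
  have h2 := hf.dyadicInc_even h hj
  linarith

lemma dyadicInc_pos (hf : p.IsDeRham f) (h : p.Cond) (n : ℕ) : ∀ j < 2 ^ n, 0 < dyadicInc f n j := by
  induction n with
  | zero =>
    intro j hj
    obtain rfl : j = 0 := by simpa using hj
    simp [dyadicInc, hf.left 0 le_rfl, hf.right 1 le_rfl]
  | succ n ih =>
    intro j hj
    have hj2 : j / 2 < 2 ^ n := by rw [pow_succ] at hj; omega
    have h1 := ih _ hj2
    have hy := h.rowRatio_gt n (j / 2)
    rcases Nat.even_or_odd' j with ⟨i, rfl | rfl⟩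
    · rw [show 2 * i / 2 = i by omega] at *
      rw [hf.dyadicInc_even h hj2]
      exact mul_pos (h.leftShare_pos hy) h1
    · rw [show (2 * i + 1) / 2 = i by omega] at *
      rw [hf.dyadicInc_odd h hj2]
      exact mul_pos (by linarith [h.leftShare_lt_one hy]) h1

lemma leftLim_eq (hf : p.IsDeRham f) (x : ℝ) : Function.leftLim f x = f x :=
  hf.cont.continuousAt.continuousWithinAt.leftLim_eq

lemma measure_Ico (hf : p.IsDeRham f) (a b : ℝ) :
    f.measure (Ico a b) = ENNReal.ofReal (f b - f a) := by
  rw [StieltjesFunction.measure_Ico, hf.leftLim_eq, hf.leftLim_eq]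

lemma measure_Iio_zero (hf : p.IsDeRham f) : f.measure (Iio 0) = 0 := by
  have ht : Tendsto f atBot (𝓝 0) :=
    tendsto_const_nhds.congr' ((eventually_le_atBot 0).mono fun x hx => (hf.left x hx).symm)
  rw [StieltjesFunction.measure_Iio _ ht, hf.leftLim_eq, hf.left 0 le_rfl]
  simp

lemma measure_Ici_one (hf : p.IsDeRham f) : f.measure (Ici 1) = 0 := by
  have ht : Tendsto f atTop (𝓝 1) :=
    tendsto_const_nhds.congr' ((eventually_ge_atTop 1).mono fun x hx => (hf.right x hx).symm)
  rw [StieltjesFunction.measure_Ici _ ht, hf.leftLim_eq, hf.right 1 le_rfl]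
  simp

lemma ae_mem_Ico (hf : p.IsDeRham f) : ∀ᵐ x ∂f.measure, x ∈ Ico (0 : ℝ) 1 := by
  have h1 := measure_eq_zero_iff_ae_notMem.1 hf.measure_Iio_zero
  have h2 := measure_eq_zero_iff_ae_notMem.1 hf.measure_Ici_one
  filter_upwards [h1, h2] with x a b
  exact ⟨not_lt.1 a, not_le.1 b⟩

lemma hasDyadicMass (hf : p.IsDeRham f) (h : p.Cond) : HasDyadicMass f.measure (dyadicInc f) where
  prob := by
    refine StieltjesFunction.isProbabilityMeasure f ?_ ?_
    · exact tendsto_const_nhds.congr' ((eventually_le_atBot 0).mono fun x hx => (hf.left x hx).symm)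
    · exact tendsto_const_nhds.congr' ((eventually_ge_atTop 1).mono fun x hx => (hf.right x hx).symm)
  pos := hf.dyadicInc_pos h
  mass n j hj := by
    rw [dyadicInc, ← hf.measure_Ico]
    -- The equality holds only almost everywhere: the natural floor sends every negative number to
    -- the index 0.
    refine measure_congr ?_
    filter_upwards [hf.ae_mem_Ico] with x hx
    refine propext ?_
    change dyadicIndex n x = j ↔ x ∈ Ico _ _
    obtain ⟨b1, b2⟩ := dyadicIndex_bounds hx.1 n
    have hp : (0 : ℝ) < 2 ^ n := by positivity
    constructor
    · rintro rfl
      exact ⟨b1, b2⟩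
    · rintro ⟨a1, a2⟩
      have l1 := b1.trans_lt a2
      have l2 := a1.trans_lt b2
      rw [div_lt_div_iff_of_pos_right hp] at l1 l2
      have l1' : dyadicIndex n x < j + 1 := by exact_mod_cast l1
      have l2' : j < dyadicIndex n x + 1 := by exact_mod_cast l2
      omega
  lt n := hf.ae_mem_Ico.mono fun x hx => dyadicIndex_lt hx n
  unit := hf.ae_mem_Ico

lemma measure_eq (hf : p.IsDeRham f) (h : p.Cond) : p.measure = f.measure := by
  rw [measure, dif_pos h]
  congr 1
  exact (existsUnique_isDeRham h).unique (existsUnique_isDeRham h).choose_spec.1 hf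

lemma measure_real_Icc (hf : p.IsDeRham f) (h : p.Cond) (x : ℝ) :
    p.measure.real (Icc 0 x) = f x := by
  rw [hf.measure_eq h, Measure.real, StieltjesFunction.measure_Icc,
    hf.leftLim_eq, hf.left 0 le_rfl, sub_zero,
    ENNReal.toReal_ofReal (hf.mem_Icc x).1]

end IsDeRham

end DRParam

/-! ### Smooth dependence on the parameter by the implicit function theorem. -/

/-- The left shift on bounded sequences. -/
noncomputable def shiftCLM : (ℕ →ᵇ ℝ) →L[ℝ] (ℕ →ᵇ ℝ) :=
  LinearMap.mkContinuous
    { toFun := fun u => u.compContinuous ⟨fun n => n + 1, continuous_of_discreteTopology⟩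
      map_add' := fun _ _ => rfl
      map_smul' := fun _ _ => rfl } 1 fun u => by
    rw [one_mul]
    exact (BoundedContinuousFunction.norm_le (norm_nonneg _)).2 fun n => u.norm_coe_le_norm (n + 1)

@[simp] lemma shiftCLM_apply (u : ℕ →ᵇ ℝ) (n : ℕ) : shiftCLM u n = u (n + 1) := rfl

/-- A bounded real sequence. -/
noncomputable def boundedSeq (g : ℕ → ℝ) (C : ℝ) (h : ∀ n, ‖g n‖ ≤ C) : ℕ →ᵇ ℝ :=
  BoundedContinuousFunction.ofNormedAddCommGroup g continuous_of_discreteTopology C h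

@[simp] lemma boundedSeq_apply (g : ℕ → ℝ) (C : ℝ) (h : ∀ n, ‖g n‖ ≤ C) (n : ℕ) :
    boundedSeq g C h n = g n := rfl

lemma isUnit_of_le_seq {w : ℕ →ᵇ ℝ} {d : ℝ} (hd : 0 < d) (h : ∀ n, d ≤ w n) : IsUnit w := by
  have hb : ∀ n, ‖(w n)⁻¹‖ ≤ d⁻¹ := fun n => by
    rw [norm_inv, Real.norm_of_nonneg (hd.le.trans (h n))]
    exact inv_anti₀ hd (h n)
  refine IsUnit.of_mul_eq_one (boundedSeq (fun n => (w n)⁻¹) d⁻¹ hb) ?_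
  ext n
  simp [mul_inv_cancel₀ (hd.trans_le (h n)).ne']

lemma ringInverse_seq_apply {w : ℕ →ᵇ ℝ} (h : IsUnit w) (n : ℕ) : Ring.inverse w n = (w n)⁻¹ := by
  have := congrArg (fun u : ℕ →ᵇ ℝ => u n) (Ring.inverse_mul_cancel w h)
  exact eq_inv_of_mul_eq_one_left (by simpa using this)

/-- Smooth dependence on a parameter for bounded solutions of `u n = Φ n (u (n + 1))`, where `Φ n`
is linear fractional and contracting. -/
theorem contDiffAt_of_linearFractional_recursion {a e c u : ℝ → ℕ →ᵇ ℝ} (ha : ContDiffAt ℝ ∞ a 0)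
    (he : ContDiffAt ℝ ∞ e 0) (hc : ContDiffAt ℝ ∞ c 0) (hu : Tendsto u (𝓝 0) (𝓝 (u 0)))
    (hrec : ∀ᶠ t in 𝓝 0, ∀ n,
      u t n = (a t n * u t (n + 1) + e t n) / (c t n * u t (n + 1) + 1))
    {d K : ℝ} (hd : 0 < d) (hden : ∀ n, d ≤ c 0 n * u 0 (n + 1) + 1) (hK : K < 1)
    (hcontr : ∀ n, |(a 0 n - e 0 n * c 0 n) / (c 0 n * u 0 (n + 1) + 1) ^ 2| ≤ K) :
    ContDiffAt ℝ ∞ u 0 := by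
  -- The recursion for all n at once is the equation H(t, u) = 0 in the Banach algebra of bounded
  -- sequences. Division is `Ring.inverse`, smooth at units; `W` is a unit at the base point because
  -- it is bounded below by `d`.
  let W : ℝ × (ℕ →ᵇ ℝ) → ℕ →ᵇ ℝ := fun q => c q.1 * shiftCLM q.2 + 1
  let H : ℝ × (ℕ →ᵇ ℝ) → ℕ →ᵇ ℝ := fun q =>
    q.2 - (a q.1 * shiftCLM q.2 + e q.1) * Ring.inverse (W q)
  have hfst : ∀ {g : ℝ → ℕ →ᵇ ℝ}, ContDiffAt ℝ ∞ g 0 →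
      ContDiffAt ℝ ∞ (fun q : ℝ × (ℕ →ᵇ ℝ) => g q.1) (0, u 0) := fun hg =>
    ContDiffAt.comp (g := _) (f := Prod.fst) ((0 : ℝ), u 0) hg contDiffAt_fst
  have hshift : ContDiffAt ℝ ∞ (fun q : ℝ × (ℕ →ᵇ ℝ) => shiftCLM q.2) (0, u 0) :=
    shiftCLM.contDiff.contDiffAt.comp _ contDiffAt_snd
  have hW : ContDiffAt ℝ ∞ W (0, u 0) := ((hfst hc).mul hshift).add contDiffAt_const
  have hunit : IsUnit (W (0, u 0)) := isUnit_of_le_seq hd hden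
  have hinv : ContDiffAt ℝ ∞ (fun q => Ring.inverse (W q)) (0, u 0) := by
    obtain ⟨w, hw⟩ := hunit
    refine ContDiffAt.comp (g := Ring.inverse) (f := W) _ ?_ hW
    rw [← hw]
    exact contDiffAt_ringInverse ℝ w
  have hH : ContDiffAt ℝ ∞ H (0, u 0) := contDiffAt_snd.sub ((((hfst ha).mul hshift).add (hfst he)).mul hinv)
  have hunits : ∀ᶠ q in 𝓝 ((0 : ℝ), u 0), IsUnit (W q) :=
    hW.continuousAt.eventually (Units.isOpen.mem_nhds hunit)
  have happly : ∀ q, IsUnit (W q) → ∀ n, H q n = q.2 n -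
      (a q.1 n * q.2 (n + 1) + e q.1 n) / (c q.1 n * q.2 (n + 1) + 1) := by
    intro q hq n
    have := ringInverse_seq_apply hq n
    simp only [H, BoundedContinuousFunction.coe_sub, BoundedContinuousFunction.coe_mul,
      BoundedContinuousFunction.coe_add, Pi.sub_apply, Pi.mul_apply, Pi.add_apply, shiftCLM_apply]
    rw [this, ← div_eq_mul_inv]
    rfl
  have hcurve : Tendsto (fun t => (t, u t)) (𝓝 0) (𝓝 ((0 : ℝ), u 0)) := tendsto_id.prodMk_nhds hu
  have hzero : ∀ᶠ t in 𝓝 0, H (t, u t) = 0 := by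
    filter_upwards [hrec, hcurve.eventually hunits] with t h1 h2
    ext n
    rw [happly _ h2, h1 n]
    exact sub_self _
  have hzero0 : H (0, u 0) = 0 := hzero.self_of_nhds
  have hpn : (∞ : WithTop ℕ∞) ≠ 0 := by simp
  let L : (ℕ →ᵇ ℝ) →L[ℝ] (ℕ →ᵇ ℝ) := fderiv ℝ H (0, u 0) ∘L .inr ℝ ℝ (ℕ →ᵇ ℝ)
  -- The partial derivative in `u` is found coordinatewise, by differentiating along the line u₀ + s
  -- v in two ways.
  have hL : ∀ v n, L v n = v n -
      (a 0 n - e 0 n * c 0 n) / (c 0 n * u 0 (n + 1) + 1) ^ 2 * v (n + 1) := by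
    intro v n
    have hline : HasDerivAt (fun s : ℝ => ((0 : ℝ), u 0 + s • v)) ((0 : ℝ), v) 0 := by
      refine (hasDerivAt_const _ _).prodMk ?_
      simpa using ((hasDerivAt_id (0 : ℝ)).smul_const v).const_add (u 0)
    have hHd : HasFDerivAt H (fderiv ℝ H (0, u 0)) (0, u 0 + (0 : ℝ) • v) := by
      simpa using (hH.differentiableAt hpn).hasFDerivAt
    have h1 := hHd.comp_hasDerivAt (0 : ℝ) hline
    have h2 := (BoundedContinuousFunction.evalCLM ℝ n).hasFDerivAt.comp_hasDerivAt (0 : ℝ) h1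
    have hd0 : c 0 n * (u 0 (n + 1) + 0 * v (n + 1)) + 1 ≠ 0 := by
      simpa using (hd.trans_le (hden n)).ne'
    have h3 : HasDerivAt (fun s : ℝ => (u 0 n + s * v n) -
        (a 0 n * (u 0 (n + 1) + s * v (n + 1)) + e 0 n) /
          (c 0 n * (u 0 (n + 1) + s * v (n + 1)) + 1)) _ 0 :=
      (((hasDerivAt_id (0 : ℝ)).mul_const (v n)).const_add (u 0 n)).sub
        ((((((hasDerivAt_id (0 : ℝ)).mul_const (v (n + 1))).const_add (u 0 (n + 1))).const_mul
          (a 0 n)).add_const (e 0 n)).div (((((hasDerivAt_id (0 : ℝ)).mul_const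
            (v (n + 1))).const_add (u 0 (n + 1))).const_mul (c 0 n)).add_const 1) hd0)
    have hev : ∀ᶠ s : ℝ in 𝓝 0, H (0, u 0 + s • v) n = (u 0 n + s * v n) -
        (a 0 n * (u 0 (n + 1) + s * v (n + 1)) + e 0 n) /
          (c 0 n * (u 0 (n + 1) + s * v (n + 1)) + 1) := by
      have : Tendsto (fun s : ℝ => ((0 : ℝ), u 0 + s • v)) (𝓝 0) (𝓝 (0, u 0)) := by
        simpa using hline.continuousAt.tendsto
      filter_upwards [this.eventually hunits] with s hs
      rw [happly _ hs]
      simp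
    have h4 := (h3.congr_of_eventuallyEq (f₁ := fun s : ℝ => H (0, u 0 + s • v) n) hev).unique h2
    have h5 : L v n = (BoundedContinuousFunction.evalCLM ℝ n) ((fderiv ℝ H (0, u 0)) (0, v)) := rfl
    rw [h5, ← h4]
    have hd1 := (hd.trans_le (hden n)).ne'
    simp only [id, zero_mul, add_zero, one_mul]
    field_simp
    ring
  -- `L` is the identity minus a weighted shift of norm at most K < 1, so a Neumann series inverts
  -- it.
  have hinvert : L.IsInvertible := by
    have hB : ‖(1 : (ℕ →ᵇ ℝ) →L[ℝ] (ℕ →ᵇ ℝ)) - L‖ < 1 := by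
      have hK0 : 0 ≤ K := (abs_nonneg _).trans (hcontr 0)
      refine lt_of_le_of_lt (ContinuousLinearMap.opNorm_le_bound _ hK0 fun v => ?_) hK
      refine (BoundedContinuousFunction.norm_le (by positivity)).2 fun n => ?_
      have : ((1 : (ℕ →ᵇ ℝ) →L[ℝ] (ℕ →ᵇ ℝ)) - L) v n =
          (a 0 n - e 0 n * c 0 n) / (c 0 n * u 0 (n + 1) + 1) ^ 2 * v (n + 1) := by
        change v n - L v n = _
        rw [hL]
        ring
      rw [this, norm_mul]
      exact mul_le_mul (hcontr n) (v.norm_coe_le_norm _) (norm_nonneg _) hK0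
    let w := Units.oneSub ((1 : (ℕ →ᵇ ℝ) →L[ℝ] (ℕ →ᵇ ℝ)) - L) hB
    refine ⟨ContinuousLinearEquiv.unitsEquiv ℝ _ w, ?_⟩
    ext v n
    change (v - (v - L v)) n = L v n
    rw [sub_sub_cancel]
  have hψ := hH.contDiffAt_implicitFunction hpn hinvert
  refine hψ.congr_of_eventuallyEq ?_
  -- Near the base point the zero set of `H` is the graph of the implicit function; continuity of
  -- `u` at 0 places the curve (t, u t) in that neighbourhood.
  filter_upwards [hzero, hcurve.eventually (hH.eventually_apply_eq_iff_implicitFunction hpn hinvert)]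
    with t h1 h2
  exact (h2.1 (by rw [h1, hzero0])).symm

/-- The doubling map of the interval. -/
noncomputable def doubling (x : ℝ) : ℝ := if x ≤ 1 / 2 then 2 * x else 2 * x - 1

lemma doubling_mem {x : ℝ} (hx : x ∈ Icc (0 : ℝ) 1) : doubling x ∈ Icc (0 : ℝ) 1 := by
  unfold doubling
  split_ifs with h
  · exact ⟨by linarith [hx.1], by linarith⟩
  · exact ⟨by linarith, by linarith [hx.2]⟩

lemma exists_deriv_bound {s c : ℝ} (hc : -1 < c) (hs : 0 < s) (h1 : s < 1) (h2 : s < (1 + c) ^ 2) :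
    ∃ K < 1, ∀ z ∈ Icc (0 : ℝ) 1, |s / (c * z + 1) ^ 2| ≤ K := by
  have hm : 0 < min 1 (1 + c) := lt_min one_pos (by linarith)
  have hlt : s < (min 1 (1 + c)) ^ 2 := by
    rcases min_choice 1 (1 + c) with h | h <;> rw [h] <;> linarith
  refine ⟨s / (min 1 (1 + c)) ^ 2, (div_lt_one (by positivity)).2 hlt, fun z hz => ?_⟩
  have := DRParam.den_ge (c := c) hz
  rw [abs_of_nonneg (by positivity)]
  gcongr

namespace DRParam

lemma Cond.exists_deriv_bound₀ {p : DRParam} (h : p.Cond) : ∃ K < 1, ∀ z ∈ Icc (0 : ℝ) 1,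
    |p.b * (p.c₀ + 1) / (p.c₀ * z + 1) ^ 2| ≤ K := by
  have h1 := h.slope_lt_one
  have h2 := h.c₀_add_one_pos
  exact exists_deriv_bound (by linarith) (mul_pos h.1.1 h2) h1 (by nlinarith [h.2.1.1])

lemma Cond.exists_deriv_bound₁ {p : DRParam} (h : p.Cond) : ∃ K < 1, ∀ z ∈ Icc (0 : ℝ) 1,
    |(1 - p.b + p.c₁ - p.b * p.c₁) / (p.c₁ * z + 1) ^ 2| ≤ K := by
  have h1 := h.c₁_mul_lt
  have h2 := h.c₁_add_one_pos
  have h3 := h.1.2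
  exact exists_deriv_bound (by linarith) (by nlinarith) (by nlinarith) (by nlinarith [h.2.2.1])

lemma IsDeRham.apply_doubling {p : DRParam} {f : StieltjesFunction ℝ} (hf : p.IsDeRham f) {x : ℝ}
    (hx : x ∈ Icc (0 : ℝ) 1) : f x = if x ≤ 1 / 2 then mobius p.A₀ (f (doubling x)) else
      mobius p.A₁ (f (doubling x)) := by
  unfold doubling
  split_ifs with h
  · exact hf.eq₀ x ⟨hx.1, h⟩
  · exact hf.eq₁ x ⟨by linarith, hx.2⟩

end DRParam

section
variable {γ : ℝ → DRParam}

lemma distF_eq {t : ℝ} (h : (γ t).Cond) {f : StieltjesFunction ℝ} (hf : (γ t).IsDeRham f) (x : ℝ) :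
    distF γ t x = f x := hf.measure_real_Icc h x

lemma distF_mem_Icc {t : ℝ} (h : (γ t).Cond) (x : ℝ) : distF γ t x ∈ Icc (0 : ℝ) 1 := by
  obtain ⟨f, hf, -⟩ := DRParam.existsUnique_isDeRham h
  rw [distF_eq h hf]
  exact hf.mem_Icc x

lemma norm_distF_le (γ : ℝ → DRParam) (t x : ℝ) : ‖distF γ t x‖ ≤ 1 := by
  by_cases h : (γ t).Cond
  · have := distF_mem_Icc h x
    rw [Real.norm_of_nonneg this.1]
    exact this.2
  · simp [distF, DRParam.measure, dif_neg h]

lemma distF_apply_doubling {t : ℝ} (h : (γ t).Cond) {x : ℝ} (hx : x ∈ Icc (0 : ℝ) 1) :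
    distF γ t x = if x ≤ 1 / 2 then mobius (γ t).A₀ (distF γ t (doubling x)) else
      mobius (γ t).A₁ (distF γ t (doubling x)) := by
  obtain ⟨f, hf, -⟩ := DRParam.existsUnique_isDeRham h
  rw [distF_eq h hf, distF_eq h hf]
  exact hf.apply_doubling hx

/-- Linear fractional maps depend continuously on their coefficients, uniformly on `[0, 1]`. -/
lemma eventually_linearFractional_close {a e c : ℝ → ℝ} (ha : ContinuousAt a 0)
    (he : ContinuousAt e 0) (hc : ContinuousAt c 0) (hc0 : -1 < c 0) {ε : ℝ} (hε : 0 < ε) :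
    ∀ᶠ t in 𝓝 0, ∀ z ∈ Icc (0 : ℝ) 1,
      |(a t * z + e t) / (c t * z + 1) - (a 0 * z + e 0) / (c 0 * z + 1)| < ε := by
  refine isCompact_Icc.eventually_forall_of_forall_eventually fun z hz => ?_
  have hden : c 0 * z + 1 ≠ 0 :=
    ((lt_min one_pos (by linarith)).trans_le (DRParam.den_ge hz)).ne'
  have hfst : ∀ {g : ℝ → ℝ}, ContinuousAt g 0 →
      ContinuousAt (fun q : ℝ × ℝ => g q.1) (0, z) := fun hg =>
    ContinuousAt.comp (g := _) (f := Prod.fst) (x := ((0 : ℝ), z)) hg continuousAt_fst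
  have hcont : ContinuousAt (fun q : ℝ × ℝ => |(a q.1 * q.2 + e q.1) / (c q.1 * q.2 + 1) -
      (a 0 * q.2 + e 0) / (c 0 * q.2 + 1)|) (0, z) := by
    refine ContinuousAt.abs (ContinuousAt.sub (ContinuousAt.div ?_ ?_ hden)
      (ContinuousAt.div ?_ ?_ hden))
    · exact ((hfst ha).mul continuousAt_snd).add (hfst he)
    · exact ((hfst hc).mul continuousAt_snd).add continuousAt_const
    · exact (continuousAt_const.mul continuousAt_snd).add continuousAt_const
    · exact (continuousAt_const.mul continuousAt_snd).add continuousAt_const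
  exact hcont.eventually_lt continuousAt_const (by simpa using hε)

/-- The values of the distribution function along the orbit of `x` under the doubling map. -/
noncomputable def orbitValues (γ : ℝ → DRParam) (x t : ℝ) : ℕ →ᵇ ℝ :=
  boundedSeq (fun n => distF γ t (doubling^[n] x)) 1 fun _ => norm_distF_le γ t _

lemma iterate_doubling_mem {x : ℝ} (hx : x ∈ Icc (0 : ℝ) 1) (n : ℕ) :
    doubling^[n] x ∈ Icc (0 : ℝ) 1 := by
  induction n with
  | zero => exact hx
  | succ n ih =>
    rw [Function.iterate_succ_apply']
    exact doubling_mem ih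

lemma orbitValues_apply {x t : ℝ} (h : (γ t).Cond) (hx : x ∈ Icc (0 : ℝ) 1) (n : ℕ) :
    orbitValues γ x t n = if doubling^[n] x ≤ 1 / 2 then
      mobius (γ t).A₀ (orbitValues γ x t (n + 1)) else
      mobius (γ t).A₁ (orbitValues γ x t (n + 1)) := by
  simp only [orbitValues, boundedSeq_apply, Function.iterate_succ_apply']
  exact distF_apply_doubling h (iterate_doubling_mem hx n)

lemma orbitValues_mem {x t : ℝ} (h : (γ t).Cond) (n : ℕ) :
    orbitValues γ x t n ∈ Icc (0 : ℝ) 1 := distF_mem_Icc h _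

/-- The implicit function is only locally unique, so convergence uniform along the orbit must be
known beforehand. It follows from the contraction property of both Möbius maps at t = 0. -/
lemma tendsto_orbitValues (hC : ∀ᶠ t in 𝓝 0, (γ t).Cond)
    (hb : ContinuousAt (fun t => (γ t).b) 0) (hc₀ : ContinuousAt (fun t => (γ t).c₀) 0)
    (hc₁ : ContinuousAt (fun t => (γ t).c₁) 0) {x : ℝ} (hx : x ∈ Icc (0 : ℝ) 1) :
    Tendsto (orbitValues γ x) (𝓝 0) (𝓝 (orbitValues γ x 0)) := by
  have h0 : (γ 0).Cond := hC.self_of_nhds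
  obtain ⟨K₀, k₀, r₀⟩ := h0.ratio₀
  obtain ⟨K₁, k₁, r₁⟩ := h0.ratio₁
  have l₀ := DRParam.continuousOn_of_ratio r₀
  have l₁ := DRParam.continuousOn_of_ratio r₁
  set K : ℝ := max K₀ K₁
  have hK : K < 1 := max_lt k₀ k₁
  have hK0 : 0 ≤ K := K₀.2.trans (le_max_left _ _)
  rw [Metric.tendsto_nhds]
  intro ε hε
  have hε' : 0 < (1 - K) * (ε / 2) := mul_pos (by linarith) (by linarith)
  have e₀ := eventually_linearFractional_close (a := fun t => (γ t).b * ((γ t).c₀ + 1))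
    (e := fun _ => 0) (hb.mul (hc₀.add continuousAt_const)) continuousAt_const hc₀
    (by linarith [h0.c₀_add_one_pos]) hε'
  have e₁ := eventually_linearFractional_close (a := fun t => 1 - (γ t).b + (γ t).c₁)
    ((continuousAt_const.sub hb).add hc₁) hb hc₁ (by linarith [h0.c₁_add_one_pos]) hε'
  filter_upwards [hC, e₀, e₁] with t ht h₀ h₁
  set D := dist (orbitValues γ x t) (orbitValues γ x 0)
  -- Changing the coefficients costs at most (1 - K)ε/2, and changing the argument at most K D; the
  -- finite D is then absorbed.
  have key : D ≤ (1 - K) * (ε / 2) + K * D := by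
    refine (BoundedContinuousFunction.dist_le (by positivity)).2 fun n => ?_
    have m1 := orbitValues_mem (x := x) ht (n + 1)
    have m2 := orbitValues_mem (x := x) h0 (n + 1)
    have hD := BoundedContinuousFunction.dist_coe_le_dist (f := orbitValues γ x t)
      (g := orbitValues γ x 0) (n + 1)
    rw [orbitValues_apply ht hx, orbitValues_apply h0 hx]
    split_ifs
    · have a1 := h₀ _ m1
      simp only [add_zero] at a1
      rw [← DRParam.mobius_A₀, ← DRParam.mobius_A₀, ← Real.dist_eq] at a1
      have a2 := l₀.dist_le_mul _ m1 _ m2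
      refine (dist_triangle _ (mobius (γ 0).A₀ (orbitValues γ x t (n + 1))) _).trans ?_
      refine add_le_add a1.le (a2.trans ?_)
      exact mul_le_mul (le_max_left _ _) hD dist_nonneg hK0
    · have a1 := h₁ _ m1
      rw [← DRParam.mobius_A₁, ← DRParam.mobius_A₁, ← Real.dist_eq] at a1
      have a2 := l₁.dist_le_mul _ m1 _ m2
      refine (dist_triangle _ (mobius (γ 0).A₁ (orbitValues γ x t (n + 1))) _).trans ?_
      refine add_le_add a1.le (a2.trans ?_)
      exact mul_le_mul (le_max_right _ _) hD dist_nonneg hK0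
  have : (1 - K) * D ≤ (1 - K) * (ε / 2) := by linarith
  have := le_of_mul_le_mul_left this (by linarith)
  linarith

/-- The distribution function depends smoothly on the parameter. -/
theorem contDiffAt_distF (hC : ∀ᶠ t in 𝓝 0, (γ t).Cond)
    (hb : ContDiffAt ℝ ∞ (fun t => (γ t).b) 0) (hc₀ : ContDiffAt ℝ ∞ (fun t => (γ t).c₀) 0)
    (hc₁ : ContDiffAt ℝ ∞ (fun t => (γ t).c₁) 0) {x : ℝ} (hx : x ∈ Icc (0 : ℝ) 1) :
    ContDiffAt ℝ ∞ (fun t => distF γ t x) 0 := by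
  classical
  have h0 : (γ 0).Cond := hC.self_of_nhds
  -- The orbit of `x` does not depend on t, so the coefficient sequences are smooth scalars times
  -- the fixed indicator sequences of the two halves.
  let χ₀ : ℕ →ᵇ ℝ := boundedSeq (fun n => if doubling^[n] x ≤ 1 / 2 then 1 else 0) 1
    fun n => by split_ifs <;> simp
  let χ₁ : ℕ →ᵇ ℝ := boundedSeq (fun n => if doubling^[n] x ≤ 1 / 2 then 0 else 1) 1
    fun n => by split_ifs <;> simp
  let a : ℝ → ℕ →ᵇ ℝ := fun t =>
    ((γ t).b * ((γ t).c₀ + 1)) • χ₀ + (1 - (γ t).b + (γ t).c₁) • χ₁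
  let e : ℝ → ℕ →ᵇ ℝ := fun t => (γ t).b • χ₁
  let c : ℝ → ℕ →ᵇ ℝ := fun t => (γ t).c₀ • χ₀ + (γ t).c₁ • χ₁
  have ha' : ∀ t n, a t n = if doubling^[n] x ≤ 1 / 2 then (γ t).b * ((γ t).c₀ + 1) else
      1 - (γ t).b + (γ t).c₁ := fun t n => by
    simp only [a, χ₀, χ₁, BoundedContinuousFunction.coe_add, BoundedContinuousFunction.coe_smul,
      Pi.add_apply, boundedSeq_apply]
    split_ifs <;> simp
  have he' : ∀ t n, e t n = if doubling^[n] x ≤ 1 / 2 then 0 else (γ t).b := fun t n => by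
    simp only [e, χ₁, BoundedContinuousFunction.coe_smul, boundedSeq_apply]
    split_ifs <;> simp
  have hc' : ∀ t n, c t n = if doubling^[n] x ≤ 1 / 2 then (γ t).c₀ else (γ t).c₁ := fun t n => by
    simp only [c, χ₀, χ₁, BoundedContinuousFunction.coe_add, BoundedContinuousFunction.coe_smul,
      Pi.add_apply, boundedSeq_apply]
    split_ifs <;> simp
  obtain ⟨K₀, k₀, r₀⟩ := h0.exists_deriv_bound₀
  obtain ⟨K₁, k₁, r₁⟩ := h0.exists_deriv_bound₁
  have hu : ContDiffAt ℝ ∞ (orbitValues γ x) 0 := by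
    refine contDiffAt_of_linearFractional_recursion (a := a) (e := e) (c := c)
      (d := min (min 1 (1 + (γ 0).c₀)) (min 1 (1 + (γ 0).c₁))) (K := max K₀ K₁)
      (((hb.mul (hc₀.add contDiffAt_const)).smul contDiffAt_const).add
        (((contDiffAt_const.sub hb).add hc₁).smul contDiffAt_const))
      (hb.smul contDiffAt_const)
      ((hc₀.smul contDiffAt_const).add (hc₁.smul contDiffAt_const))
      (tendsto_orbitValues hC hb.continuousAt hc₀.continuousAt hc₁.continuousAt hx) ?_ ?_ ?_
      (max_lt k₀ k₁) ?_
    · filter_upwards [hC] with t ht n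
      rw [orbitValues_apply ht hx, ha', he', hc']
      split_ifs
      · rw [add_zero, DRParam.mobius_A₀]
      · rw [DRParam.mobius_A₁]
    · have h1 := h0.c₀_add_one_pos
      have h2 := h0.c₁_add_one_pos
      exact lt_min (lt_min one_pos (by linarith)) (lt_min one_pos (by linarith))
    · intro n
      rw [hc']
      split_ifs
      · exact (min_le_left _ _).trans (DRParam.den_ge (orbitValues_mem h0 _))
      · exact (min_le_right _ _).trans (DRParam.den_ge (orbitValues_mem h0 _))
    · intro n
      rw [ha', he', hc']
      split_ifs
      · rw [zero_mul, sub_zero]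
        exact (r₀ _ (orbitValues_mem h0 _)).trans (le_max_left _ _)
      · exact (r₁ _ (orbitValues_mem h0 _)).trans (le_max_right _ _)
  exact (BoundedContinuousFunction.evalCLM ℝ 0).contDiff.contDiffAt.comp 0 hu

end

/-! ### Derivatives of the row ratios and the non-degeneracy condition. -/

/-- A curve of parameters which is smooth at `0` and satisfies `Cond` near `0`. -/
structure IsSmoothAtZero (γ : ℝ → DRParam) : Prop where
  cond : ∀ᶠ t in 𝓝 0, (γ t).Cond
  b : ContDiffAt ℝ ∞ (fun t => (γ t).b) 0
  c₀ : ContDiffAt ℝ ∞ (fun t => (γ t).c₀) 0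
  c₁ : ContDiffAt ℝ ∞ (fun t => (γ t).c₁) 0

lemma IsAdmissibleCurve.isSmoothAtZero {γ : ℝ → DRParam} {I : Set ℝ} (h : IsAdmissibleCurve γ I) :
    IsSmoothAtZero γ where
  cond := (h.isOpen.eventually_mem h.zero_mem).mono fun t ht => (h.inE t ht).1
  b := h.smooth_b.contDiffAt (h.isOpen.mem_nhds h.zero_mem)
  c₀ := h.smooth_c₀.contDiffAt (h.isOpen.mem_nhds h.zero_mem)
  c₁ := h.smooth_c₁.contDiffAt (h.isOpen.mem_nhds h.zero_mem)

namespace DRParam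

/-- This is G₁' < 1. Since G₁' decreases on [α, β], it suffices to treat α, where the derivative is
the limit of difference quotients bounded by the Lipschitz constant. -/
lemma Cond.G₁_contraction {p : DRParam} (h : p.Cond) (hc : p.Contracting) {y : ℝ}
    (hy : y ∈ Icc p.α p.β) : (1 - p.b) * (1 + p.c₁) < (p.b * y + 1) ^ 2 := by
  have hb := h.1.1
  have hb1 := h.1.2
  have hs : 0 < (1 - p.b) * (1 + p.c₁) :=
    mul_pos (by linarith) (by linarith [h.c₁_add_one_pos])
  have hα := h.neg_one_lt_α
  have hdα := h.den_pos hα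
  have h0 := p.zero_mem_Icc_α_β
  suffices (1 - p.b) * (1 + p.c₁) < (p.b * p.α + 1) ^ 2 by
    refine this.trans_le ?_
    have : p.b * p.α ≤ p.b * y := mul_le_mul_of_nonneg_left hy.1 hb.le
    gcongr
  -- If α = β the Lipschitz condition is vacuous; but then c₁ = 0 and α = 0, and the claim reads 1 -
  -- b₁ < 1.
  rcases (h0.1.trans h0.2).eq_or_lt with hαβ | hαβ
  · have hα0 : p.α = 0 := le_antisymm h0.1 (hαβ ▸ h0.2)
    have a1 : p.α ≤ p.c₁ / p.b := (min_le_right _ _).trans (min_le_right _ _)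
    have b1 : p.c₁ / p.b ≤ p.β := (le_max_right _ _).trans (le_max_right _ _)
    have : p.c₁ / p.b = 0 := le_antisymm (by linarith) (by linarith)
    have hc1 : p.c₁ = 0 := by
      rcases div_eq_zero_iff.1 this with h | h
      · exact h
      · exact absurd h hb.ne'
    rw [hα0, hc1]
    nlinarith
  · obtain ⟨K, hK, hLip⟩ := hc
    have key : ∀ v ∈ Ioc p.α p.β,
        (1 - p.b) * (1 + p.c₁) ≤ K * ((p.b * p.α + 1) * (p.b * v + 1)) := by
      intro v hv
      have hdv := h.den_pos (hα.trans hv.1)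
      have hd := hLip.dist_le_mul v ⟨hv.1.le, hv.2⟩ p.α ⟨le_rfl, hαβ.le⟩
      have e : p.G₁ v - p.G₁ p.α =
          (1 - p.b) * (1 + p.c₁) / ((p.b * p.α + 1) * (p.b * v + 1)) * (v - p.α) := by
        rw [G₁_apply, G₁_apply, div_sub_div _ _ hdv.ne' hdα.ne', div_mul_eq_mul_div,
          mul_comm (p.b * p.α + 1)]
        congr 1
        ring
      have hpos : 0 < v - p.α := by linarith [hv.1]
      rw [Real.dist_eq, Real.dist_eq, e, abs_mul] at hd
      have hd' := le_of_mul_le_mul_right hd (by rwa [abs_pos, ne_eq, sub_eq_zero, ← ne_eq, ← sub_ne_zero, ← abs_pos, abs_of_pos hpos])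
      rw [abs_of_pos (by positivity), div_le_iff₀ (by positivity)] at hd'
      exact hd'
    have hlim : Tendsto (fun v : ℝ => (K : ℝ) * ((p.b * p.α + 1) * (p.b * v + 1))) (𝓝[>] p.α)
        (𝓝 (K * ((p.b * p.α + 1) * (p.b * p.α + 1)))) := by
      refine Tendsto.mono_left ?_ nhdsWithin_le_nhds
      exact Continuous.tendsto (by fun_prop) _
    have hle := ge_of_tendsto hlim (by
      filter_upwards [Ioc_mem_nhdsGT hαβ] with v hv using key v hv)
    have hK' : (K : ℝ) < 1 := hK
    have hsq : 0 < (p.b * p.α + 1) * (p.b * p.α + 1) := mul_pos hdα hdα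
    nlinarith

end DRParam

/-- One step of the estimate for the derivative of the row ratios along a curve. -/
lemma ndRatio_step {g : DRParam → ℝ → ℝ} {γ : ℝ → DRParam} {y A B y' lo hi : ℝ}
    (hA : HasDerivAt (fun t => g (γ t) y) A 0) (hB : HasDerivAt (g (γ 0)) B y) (hB0 : 0 ≤ B)
    (hB1 : B < 1) (hcont : ContinuousOn (ndRatio g γ) (Icc (γ 0).α (γ 0).β))
    (hy : y ∈ Icc (γ 0).α (γ 0).β) (hlo : lo ≤ deltaMin g γ) (hhi : deltaMax g γ ≤ hi)
    (hy' : y' ∈ Icc lo hi) : A + B * y' ∈ Icc lo hi := by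
  have hcomp := isCompact_Icc.image_of_continuousOn hcont
  have e : ndRatio g γ y = A / (1 - B) := by rw [ndRatio, hA.deriv, hB.deriv]
  have h1 : deltaMin g γ ≤ A / (1 - B) := e ▸ csInf_le hcomp.bddBelow ⟨y, hy, rfl⟩
  have h2 : A / (1 - B) ≤ deltaMax g γ := e ▸ le_csSup hcomp.bddAbove ⟨y, hy, rfl⟩
  have h3 := hlo.trans h1
  have h4 := h2.trans hhi
  -- From lo ≤ A/(1 - B) ≤ hi one gets lo ≤ A + B lo and A + B hi ≤ hi, and B ≥ 0 carries this to
  -- all of [lo, hi].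
  rw [le_div_iff₀ (by linarith)] at h3
  rw [div_le_iff₀ (by linarith)] at h4
  constructor
  · nlinarith [hy'.1]
  · nlinarith [hy'.2]

section
variable {γ : ℝ → DRParam}

lemma hasDerivAt_G₀_curve {b' c' y' : ℝ} {y : ℝ → ℝ} (hb : HasDerivAt (fun t => (γ t).b) b' 0)
    (hc : HasDerivAt (fun t => (γ t).c₀) c' 0) (hy : HasDerivAt y y' 0) :
    HasDerivAt (fun t => (γ t).G₀ (y t))
      ((b' * ((γ 0).c₀ + 1) + (γ 0).b * c') * y 0 + c' + (γ 0).b * ((γ 0).c₀ + 1) * y') 0 := by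
  simp only [DRParam.G₀_apply]
  refine (((hb.fun_mul (hc.add_const 1)).fun_mul hy).fun_add hc).congr_deriv ?_
  ring

lemma hasDerivAt_G₀ (p : DRParam) (y : ℝ) : HasDerivAt p.G₀ (p.b * (p.c₀ + 1)) y := by
  have : p.G₀ = fun y => p.b * (p.c₀ + 1) * y + p.c₀ := funext p.G₀_apply
  rw [this]
  simpa using ((hasDerivAt_id y).const_mul (p.b * (p.c₀ + 1))).add_const p.c₀

lemma hasDerivAt_G₁_curve {b' c' y' : ℝ} {y : ℝ → ℝ} (hb : HasDerivAt (fun t => (γ t).b) b' 0)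
    (hc : HasDerivAt (fun t => (γ t).c₁) c' 0) (hy : HasDerivAt y y' 0)
    (hden : 0 < (γ 0).b * y 0 + 1) :
    HasDerivAt (fun t => (γ t).G₁ (y t))
      ((((-b' + c') * y 0 + c') * ((γ 0).b * y 0 + 1) -
          ((1 - (γ 0).b + (γ 0).c₁) * y 0 + (γ 0).c₁) * (b' * y 0)) / ((γ 0).b * y 0 + 1) ^ 2 +
        (1 - (γ 0).b) * (1 + (γ 0).c₁) / ((γ 0).b * y 0 + 1) ^ 2 * y') 0 := by
  simp only [DRParam.G₁_apply]
  have hn := (((hb.const_sub 1).fun_add hc).fun_mul hy).fun_add hc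
  have hd := (hb.fun_mul hy).add_const 1
  refine (hn.fun_div hd hden.ne').congr_deriv ?_
  field_simp
  ring

lemma hasDerivAt_G₁ (p : DRParam) {y : ℝ} (hden : 0 < p.b * y + 1) :
    HasDerivAt p.G₁ ((1 - p.b) * (1 + p.c₁) / (p.b * y + 1) ^ 2) y := by
  have : p.G₁ = fun y => ((1 - p.b + p.c₁) * y + p.c₁) / (p.b * y + 1) := funext p.G₁_apply
  rw [this]
  have h1 := (((hasDerivAt_id' y).const_mul (1 - p.b + p.c₁)).add_const p.c₁).fun_div
    (((hasDerivAt_id' y).const_mul p.b).add_const 1) hden.ne'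
  refine h1.congr_deriv ?_
  field_simp
  ring

lemma IsSmoothAtZero.hasDerivAt (hγ : IsSmoothAtZero γ) :
    HasDerivAt (fun t => (γ t).b) (deriv (fun t => (γ t).b) 0) 0 ∧
    HasDerivAt (fun t => (γ t).c₀) (deriv (fun t => (γ t).c₀) 0) 0 ∧
    HasDerivAt (fun t => (γ t).c₁) (deriv (fun t => (γ t).c₁) 0) 0 :=
  ⟨(hγ.b.differentiableAt (by simp)).hasDerivAt, (hγ.c₀.differentiableAt (by simp)).hasDerivAt,
    (hγ.c₁.differentiableAt (by simp)).hasDerivAt⟩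

lemma IsSmoothAtZero.continuousOn_ndRatio_G₀ (hγ : IsSmoothAtZero γ) (s : Set ℝ) :
    ContinuousOn (ndRatio DRParam.G₀ γ) s := by
  obtain ⟨hb, hc, -⟩ := hγ.hasDerivAt
  refine ContinuousOn.congr (f := fun y =>
    ((deriv (fun t => (γ t).b) 0 * ((γ 0).c₀ + 1) + (γ 0).b * deriv (fun t => (γ t).c₀) 0) * y +
      deriv (fun t => (γ t).c₀) 0 + (γ 0).b * ((γ 0).c₀ + 1) * 0) /
        (1 - (γ 0).b * ((γ 0).c₀ + 1))) ?_ fun y _ => ?_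
  · exact Continuous.continuousOn (Continuous.div_const (by fun_prop) _)
  · rw [ndRatio, (hasDerivAt_G₀_curve hb hc (hasDerivAt_const (0 : ℝ) y)).deriv,
      (hasDerivAt_G₀ _ y).deriv]

lemma IsSmoothAtZero.continuousOn_ndRatio_G₁ (hγ : IsSmoothAtZero γ) (hK : (γ 0).Contracting) :
    ContinuousOn (ndRatio DRParam.G₁ γ) (Icc (γ 0).α (γ 0).β) := by
  obtain ⟨hb, -, hc⟩ := hγ.hasDerivAt
  have h0 : (γ 0).Cond := hγ.cond.self_of_nhds
  have hden : ∀ y ∈ Icc (γ 0).α (γ 0).β, 0 < (γ 0).b * y + 1 := fun y hy =>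
    h0.den_pos (h0.neg_one_lt_α.trans_le hy.1)
  have hpow : ∀ y ∈ Icc (γ 0).α (γ 0).β, ((γ 0).b * y + 1) ^ 2 ≠ 0 := fun y hy =>
    (pow_pos (hden y hy) 2).ne'
  refine ContinuousOn.congr (f := fun y =>
    (((-deriv (fun t => (γ t).b) 0 + deriv (fun t => (γ t).c₁) 0) * y +
      deriv (fun t => (γ t).c₁) 0) * ((γ 0).b * y + 1) -
          ((1 - (γ 0).b + (γ 0).c₁) * y + (γ 0).c₁) * (deriv (fun t => (γ t).b) 0 * y)) /
          ((γ 0).b * y + 1) ^ 2 /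
        (1 - (1 - (γ 0).b) * (1 + (γ 0).c₁) / ((γ 0).b * y + 1) ^ 2)) ?_ fun y hy => ?_
  swap
  · rw [ndRatio, (hasDerivAt_G₁_curve hb hc (hasDerivAt_const (0 : ℝ) y) (hden y hy)).deriv,
      (hasDerivAt_G₁ _ (hden y hy)).deriv, mul_zero, add_zero]
  refine ContinuousOn.div ?_ ?_ fun y hy => ?_
  · exact ContinuousOn.div (by fun_prop) (by fun_prop) hpow
  · exact continuousOn_const.sub (ContinuousOn.div (by fun_prop) (by fun_prop) hpow)
  · have := h0.G₁_contraction hK hy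
    have : (1 - (γ 0).b) * (1 + (γ 0).c₁) / ((γ 0).b * y + 1) ^ 2 < 1 :=
      (div_lt_one (pow_pos (hden y hy) 2)).2 this
    linarith

/-- The row ratios are differentiable along a curve, with uniformly bounded derivatives. -/
lemma IsSmoothAtZero.rowRatio_deriv (hγ : IsSmoothAtZero γ) (hK : (γ 0).Contracting) (n j : ℕ) :
    ∃ y' ∈ Icc (min 0 (min (deltaMin DRParam.G₀ γ) (deltaMin DRParam.G₁ γ)))
        (max 0 (max (deltaMax DRParam.G₀ γ) (deltaMax DRParam.G₁ γ))),
      HasDerivAt (fun t => (γ t).rowRatio n j) y' 0 := by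
  obtain ⟨hb, hc₀, hc₁⟩ := hγ.hasDerivAt
  have h0 : (γ 0).Cond := hγ.cond.self_of_nhds
  induction n generalizing j with
  -- The initial ratio is constantly 0 in t, which is why 0 enters the minimum and the maximum.
  | zero => exact ⟨0, ⟨min_le_left _ _, le_max_left _ _⟩, hasDerivAt_const _ _⟩
  | succ n ih =>
    obtain ⟨y', hy', hd⟩ := ih (j / 2)
    have hmem := h0.rowRatio_mem_Icc n (j / 2)
    simp only [DRParam.rowRatio]
    split_ifs
    · refine ⟨_, ?_, hasDerivAt_G₀_curve hb hc₀ hd⟩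
      refine ndRatio_step (y := (γ 0).rowRatio n (j / 2)) ?_ (hasDerivAt_G₀ _ _) ?_ h0.slope_lt_one
        (hγ.continuousOn_ndRatio_G₀ _) hmem ((min_le_right _ _).trans (min_le_left _ _))
        ((le_max_left _ _).trans (le_max_right _ _)) hy'
      · simpa using hasDerivAt_G₀_curve hb hc₀ (hasDerivAt_const (0 : ℝ) ((γ 0).rowRatio n (j / 2)))
      · exact (mul_pos h0.1.1 h0.c₀_add_one_pos).le
    · have hden := h0.den_pos (h0.rowRatio_gt n (j / 2))
      refine ⟨_, ?_, hasDerivAt_G₁_curve hb hc₁ hd hden⟩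
      refine ndRatio_step (y := (γ 0).rowRatio n (j / 2)) ?_ (hasDerivAt_G₁ _ hden) ?_ ?_
        (hγ.continuousOn_ndRatio_G₁ hK) hmem ((min_le_right _ _).trans (min_le_right _ _))
        ((le_max_right _ _).trans (le_max_right _ _)) hy'
      · simpa using hasDerivAt_G₁_curve hb hc₁
          (hasDerivAt_const (0 : ℝ) ((γ 0).rowRatio n (j / 2))) hden
      · exact div_nonneg (mul_nonneg (by linarith [h0.1.2]) (by linarith [h0.c₁_add_one_pos]))
          (sq_nonneg _)
      · exact (div_lt_one (pow_pos hden 2)).2 (h0.G₁_contraction hK hmem)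

lemma hasDerivAt_leftShare {b' y' : ℝ} {y : ℝ → ℝ} (hb : HasDerivAt (fun t => (γ t).b) b' 0)
    (hy : HasDerivAt y y' 0) (hden : 0 < (γ 0).b * y 0 + 1) :
    HasDerivAt (fun t => (γ t).leftShare (y t))
      ((b' * (1 + y 0) + (γ 0).b * (1 - (γ 0).b) * y') / (1 + (γ 0).b * y 0) ^ 2) 0 := by
  have hden' : 1 + (γ 0).b * y 0 ≠ 0 := by linarith
  have h1 := (hb.fun_mul (hy.const_add 1)).fun_div ((hb.fun_mul hy).const_add 1) hden'
  unfold DRParam.leftShare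
  refine h1.congr_deriv ?_
  congr 1
  ring

lemma dyadicInc_distF_even {t : ℝ} (h : (γ t).Cond) {n j : ℕ} (hj : j < 2 ^ n) :
    dyadicInc (distF γ t) (n + 1) (2 * j) =
      (γ t).leftShare ((γ t).rowRatio n j) * dyadicInc (distF γ t) n j := by
  obtain ⟨f, hf, -⟩ := DRParam.existsUnique_isDeRham h
  rw [show distF γ t = f from funext fun x => distF_eq h hf x]
  exact hf.dyadicInc_even h hj

lemma div_two_pow_mem {n i : ℕ} (hi : i ≤ 2 ^ n) : (i : ℝ) / 2 ^ n ∈ Icc (0 : ℝ) 1 := by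
  refine ⟨by positivity, ?_⟩
  rw [div_le_one (by positivity)]
  exact_mod_cast hi

lemma IsSmoothAtZero.contDiffAt_distF (hγ : IsSmoothAtZero γ) {x : ℝ} (hx : x ∈ Icc (0 : ℝ) 1) :
    ContDiffAt ℝ ∞ (fun t => distF γ t x) 0 :=
  _root_.contDiffAt_distF hγ.cond hγ.b hγ.c₀ hγ.c₁ hx

lemma IsSmoothAtZero.contDiffAt_dyadicInc (hγ : IsSmoothAtZero γ) {n j : ℕ} (hj : j < 2 ^ n) :
    ContDiffAt ℝ ∞ (fun t => dyadicInc (distF γ t) n j) 0 := by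
  refine (hγ.contDiffAt_distF ?_).sub (hγ.contDiffAt_distF (div_two_pow_mem hj.le))
  exact_mod_cast div_two_pow_mem (Nat.succ_le_of_lt hj)

lemma IsSmoothAtZero.dyadicInc_fk (hγ : IsSmoothAtZero γ) (k : ℕ) {n j : ℕ} (hj : j < 2 ^ n) :
    dyadicInc (fk γ k) n j = iteratedDeriv k (fun t => dyadicInc (distF γ t) n j) 0 := by
  have hk : ((k : ℕ∞) : WithTop ℕ∞) ≤ ∞ := by exact_mod_cast le_top
  have h1 : ContDiffAt ℝ k (fun t => distF γ t (((j : ℝ) + 1) / 2 ^ n)) 0 := by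
    refine (hγ.contDiffAt_distF ?_).of_le hk
    exact_mod_cast div_two_pow_mem (Nat.succ_le_of_lt hj)
  have h2 : ContDiffAt ℝ k (fun t => distF γ t ((j : ℝ) / 2 ^ n)) 0 :=
    (hγ.contDiffAt_distF (div_two_pow_mem hj.le)).of_le hk
  exact (iteratedDeriv_sub h1 h2).symm

lemma IsSmoothAtZero.hasDerivAt_dyadicInc (hγ : IsSmoothAtZero γ) {n j : ℕ} (hj : j < 2 ^ n) :
    HasDerivAt (fun t => dyadicInc (distF γ t) n j) (dyadicInc (fk γ 1) n j) 0 := by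
  rw [hγ.dyadicInc_fk 1 hj, iteratedDeriv_one]
  exact ((hγ.contDiffAt_dyadicInc hj).differentiableAt (by simp)).hasDerivAt

/-- The proportion in which the mass of dyadic intervals is split, and its derivative. -/
lemma IsSmoothAtZero.exists_split (hγ : IsSmoothAtZero γ) (hK : (γ 0).Contracting) {n j : ℕ}
    (hj : j < 2 ^ n) : ∃ y ∈ Icc (γ 0).α (γ 0).β,
    ∃ y' ∈ Icc (min 0 (min (deltaMin DRParam.G₀ γ) (deltaMin DRParam.G₁ γ)))
        (max 0 (max (deltaMax DRParam.G₀ γ) (deltaMax DRParam.G₁ γ))),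
      dyadicInc (distF γ 0) (n + 1) (2 * j) = (γ 0).leftShare y * dyadicInc (distF γ 0) n j ∧
      dyadicInc (fk γ 1) (n + 1) (2 * j) = (γ 0).leftShare y * dyadicInc (fk γ 1) n j +
        (deriv (fun t => (γ t).b) 0 * (1 + y) + (γ 0).b * (1 - (γ 0).b) * y') /
          (1 + (γ 0).b * y) ^ 2 * dyadicInc (distF γ 0) n j := by
  have h0 : (γ 0).Cond := hγ.cond.self_of_nhds
  obtain ⟨y', hy', hd⟩ := hγ.rowRatio_deriv hK n j
  refine ⟨(γ 0).rowRatio n j, h0.rowRatio_mem_Icc n j, y', hy', dyadicInc_distF_even h0 hj, ?_⟩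
  have hP := hasDerivAt_leftShare hγ.hasDerivAt.1 hd (h0.den_pos (h0.rowRatio_gt n j))
  -- The product rule for share times mass gives the splitting rule of `fk γ 1`.
  have h1 := hP.mul (hγ.hasDerivAt_dyadicInc hj)
  have h2 := hγ.hasDerivAt_dyadicInc (n := n + 1) (j := 2 * j) (by rw [pow_succ]; omega)
  have h3 : (fun t => dyadicInc (distF γ t) (n + 1) (2 * j)) =ᶠ[𝓝 0] fun t =>
      (γ t).leftShare ((γ t).rowRatio n j) * dyadicInc (distF γ t) n j :=
    hγ.cond.mono fun t ht => dyadicInc_distF_even ht hj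
  rw [h2.unique (h1.congr_of_eventuallyEq h3)]
  ring

end

/-- [α, β] is a compact subset of (-1, ∞), where the share lies strictly between 0 and 1. -/
lemma DRParam.Cond.exists_leftShare_bounds {p : DRParam} (h : p.Cond) :
    ∃ η > 0, ∀ y ∈ Icc p.α p.β, p.leftShare y ∈ Icc η (1 - η) := by
  have hb := h.1.1
  have hb1 := h.1.2
  have hα := h.neg_one_lt_α
  have hβ : 0 ≤ p.β := p.zero_mem_Icc_α_β.2
  have hdβ : 0 < 1 + p.b * p.β := by positivity
  refine ⟨min (p.b * (1 + p.α) / (1 + p.b * p.β)) ((1 - p.b) / (1 + p.b * p.β)),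
    lt_min (div_pos (mul_pos hb (by linarith)) hdβ) (div_pos (by linarith) hdβ), fun y hy => ?_⟩
  have hy1 := hα.trans_le hy.1
  have hd : 0 < 1 + p.b * y := by linarith [h.den_pos hy1]
  have hdle : 1 + p.b * y ≤ 1 + p.b * p.β := by
    have := mul_le_mul_of_nonneg_left hy.2 hb.le
    linarith
  constructor
  · refine (min_le_left _ _).trans ?_
    have h1 : p.b * (1 + p.α) ≤ p.b * (1 + y) := mul_le_mul_of_nonneg_left (by linarith [hy.1]) hb.le
    exact div_le_div₀ (mul_nonneg hb.le (by linarith)) h1 hd hdle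
  · have h1 := h.one_sub_leftShare hy1
    have h2 : (1 - p.b) / (1 + p.b * p.β) ≤ (1 - p.b) / (1 + p.b * y) :=
      div_le_div_of_nonneg_left (by linarith) hd hdle
    have h3 := min_le_right (p.b * (1 + p.α) / (1 + p.b * p.β)) ((1 - p.b) / (1 + p.b * p.β))
    linarith

/-- Dyadic masses `m` are split with proportions bounded away from `0` and `1`, and `D` is split like
the derivative of `m` with respect to a parameter, where the derivative of the proportion of the left
half is bounded and positive, bounded away from `0`. -/
def HasSplitting (m D : ℕ → ℕ → ℝ) : Prop :=
  ∃ η > 0, ∃ ε > 0, ∃ C, ∀ n, ∀ j < 2 ^ n, ∃ P ∈ Icc η (1 - η), ∃ Q ∈ Icc ε C,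
    m (n + 1) (2 * j) = P * m n j ∧ D (n + 1) (2 * j) = P * D n j + Q * m n j

/-- The derivative of the share is (b'(1+y) + b(1-b)y')/(1+by)². Inserting the extreme values of y
and y' bounds the numerator below by the quantity in (ND), whose positivity also forces b' > 0. -/
lemma IsSmoothAtZero.hasSplitting_of_ND₁ {γ : ℝ → DRParam} (hγ : IsSmoothAtZero γ) (h : ND₁ γ) :
    HasSplitting (dyadicInc (distF γ 0)) (dyadicInc (fk γ 1)) := by
  obtain ⟨hK, hpos⟩ := h
  have h0 : (γ 0).Cond := hγ.cond.self_of_nhds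
  obtain ⟨η, hη, hP⟩ := h0.exists_leftShare_bounds
  set b := (γ 0).b
  set b' := deriv (fun t => (γ t).b) 0
  set lo := min 0 (min (deltaMin DRParam.G₀ γ) (deltaMin DRParam.G₁ γ))
  set hi := max 0 (max (deltaMax DRParam.G₀ γ) (deltaMax DRParam.G₁ γ))
  have hb : 0 < b := h0.1.1
  have hb1 : b < 1 := h0.1.2
  have hα := h0.neg_one_lt_α
  have hβ : 0 ≤ (γ 0).β := (γ 0).zero_mem_Icc_α_β.2
  have hlo : lo ≤ 0 := min_le_left _ _
  have hhi : 0 ≤ hi := le_max_left _ _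
  have hbb : 0 < b * (1 - b) := mul_pos hb (by linarith)
  have hb' : 0 < b' := by
    have : 0 < b' * ((γ 0).α + 1) := by nlinarith [mul_nonneg hbb.le (neg_nonneg.2 hlo)]
    exact pos_of_mul_pos_left this (by linarith)
  have hdα : 0 < 1 + b * (γ 0).α := by linarith [h0.den_pos hα]
  have hdβ : 0 < 1 + b * (γ 0).β := by positivity
  refine ⟨η, hη, _, div_pos hpos (pow_pos hdβ 2),
    (b' * (1 + (γ 0).β) + b * (1 - b) * hi) / (1 + b * (γ 0).α) ^ 2, fun n j hj => ?_⟩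
  obtain ⟨y, hy, y', hy', e1, e2⟩ := hγ.exists_split hK hj
  have hl : 1 + b * (γ 0).α ≤ 1 + b * y := by linarith [mul_le_mul_of_nonneg_left hy.1 hb.le]
  have hu : 1 + b * y ≤ 1 + b * (γ 0).β := by linarith [mul_le_mul_of_nonneg_left hy.2 hb.le]
  have m1 := mul_le_mul_of_nonneg_left hy.1 hb'.le
  have m2 := mul_le_mul_of_nonneg_left hy.2 hb'.le
  have m3 := mul_le_mul_of_nonneg_left hy'.1 hbb.le
  have m4 := mul_le_mul_of_nonneg_left hy'.2 hbb.le
  refine ⟨_, hP y hy, _, ⟨?_, ?_⟩, e1, e2⟩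
  · refine div_le_div₀ (by linarith) (by linarith) (pow_pos (hdα.trans_le hl) 2) ?_
    exact pow_le_pow_left₀ (hdα.trans_le hl).le hu 2
  · refine div_le_div₀ ?_ (by linarith) (pow_pos hdα 2) (pow_le_pow_left₀ hdα.le hl 2)
    exact add_nonneg (mul_nonneg hb'.le (by linarith)) (mul_nonneg hbb.le hhi)

/-- The same estimate with the opposite sign: here the derivative of the share is negative, so the
splitting holds for -f₁. Passing to the dual restores the sign. -/
lemma IsSmoothAtZero.hasSplitting_of_ND₂ {γ : ℝ → DRParam} (hγ : IsSmoothAtZero γ) (h : ND₂ γ) :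
    HasSplitting (dyadicInc (distF γ 0)) (-dyadicInc (fk γ 1)) := by
  obtain ⟨hK, hneg⟩ := h
  have h0 : (γ 0).Cond := hγ.cond.self_of_nhds
  obtain ⟨η, hη, hP⟩ := h0.exists_leftShare_bounds
  set b := (γ 0).b
  set b' := deriv (fun t => (γ t).b) 0
  set lo := min 0 (min (deltaMin DRParam.G₀ γ) (deltaMin DRParam.G₁ γ))
  set hi := max 0 (max (deltaMax DRParam.G₀ γ) (deltaMax DRParam.G₁ γ))
  have hb : 0 < b := h0.1.1
  have hb1 : b < 1 := h0.1.2
  have hα := h0.neg_one_lt_α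
  have hβ : 0 ≤ (γ 0).β := (γ 0).zero_mem_Icc_α_β.2
  have hlo : lo ≤ 0 := min_le_left _ _
  have hhi : 0 ≤ hi := le_max_left _ _
  have hbb : 0 < b * (1 - b) := mul_pos hb (by linarith)
  have hb' : 0 < -b' := by
    have : 0 < -b' * ((γ 0).α + 1) := by nlinarith [mul_nonneg hbb.le hhi]
    exact pos_of_mul_pos_left this (by linarith)
  have hdα : 0 < 1 + b * (γ 0).α := by linarith [h0.den_pos hα]
  have hdβ : 0 < 1 + b * (γ 0).β := by positivity
  refine ⟨η, hη, _, div_pos (neg_pos.2 hneg) (pow_pos hdβ 2),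
    (-b' * (1 + (γ 0).β) + b * (1 - b) * -lo) / (1 + b * (γ 0).α) ^ 2, fun n j hj => ?_⟩
  obtain ⟨y, hy, y', hy', e1, e2⟩ := hγ.exists_split hK hj
  have hl : 1 + b * (γ 0).α ≤ 1 + b * y := by linarith [mul_le_mul_of_nonneg_left hy.1 hb.le]
  have hu : 1 + b * y ≤ 1 + b * (γ 0).β := by linarith [mul_le_mul_of_nonneg_left hy.2 hb.le]
  have m1 := mul_le_mul_of_nonneg_left hy.1 hb'.le
  have m2 := mul_le_mul_of_nonneg_left hy.2 hb'.le
  have m3 := mul_le_mul_of_nonneg_left hy'.1 hbb.le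
  have m4 := mul_le_mul_of_nonneg_left hy'.2 hbb.le
  refine ⟨_, hP y hy, -(b' * (1 + y) + b * (1 - b) * y') / (1 + b * y) ^ 2, ⟨?_, ?_⟩, e1, ?_⟩
  · refine div_le_div₀ (by linarith) (by linarith) (pow_pos (hdα.trans_le hl) 2) ?_
    exact pow_le_pow_left₀ (hdα.trans_le hl).le hu 2
  · refine div_le_div₀ ?_ (by linarith) (pow_pos hdα 2) (pow_le_pow_left₀ hdα.le hl 2)
    exact add_nonneg (mul_nonneg hb'.le (by linarith)) (mul_nonneg hbb.le (by linarith))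
  · simp only [Pi.neg_apply]
    rw [e2]
    ring

/-! ### Duality under the reflection of the interval. -/

namespace DRParam

variable {p : DRParam} {f : StieltjesFunction ℝ}

lemma Cond.dual (h : p.Cond) : p.dual.Cond := by
  have hb := h.1.1
  have hb1 := h.1.2
  have h0 := h.c₀_add_one_pos
  have h1 := h.c₁_add_one_pos
  have h2 := h.c₁_mul_lt
  have h3 := h.slope_lt_one
  have h4 := h.2.1.1
  have h5 := h.2.2.1
  -- In this form the bounds for the dual parameter are bounds for reciprocals of 1 + c₁ and 1 + c₀.
  have e0 : p.c₁ / (1 + p.c₁) = 1 - 1 / (1 + p.c₁) := by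
    have : 1 + p.c₁ ≠ 0 := by linarith
    field_simp
    ring
  have e1 : p.c₀ / (1 + p.c₀) = 1 - 1 / (1 + p.c₀) := by
    have : 1 + p.c₀ ≠ 0 := by linarith
    field_simp
    ring
  have i1 : 1 - p.b < 1 / (1 + p.c₁) := by
    rw [lt_div_iff₀ (by linarith)]
    nlinarith
  have i2 : 1 / (1 + p.c₁) < 1 / (1 - p.b) := by
    apply one_div_lt_one_div_of_lt <;> linarith
  have i3 : p.b < 1 / (1 + p.c₀) := by
    rw [lt_div_iff₀ (by linarith)]
    nlinarith
  have i4 : 1 / (1 + p.c₀) < 1 / p.b := by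
    apply one_div_lt_one_div_of_lt <;> linarith
  have e2 : (1 - p.b) / (1 - (1 - p.b)) = 1 / p.b - 1 := by
    rw [sub_sub_cancel, sub_div, div_self hb.ne']
  refine ⟨⟨?_, ?_⟩, ⟨?_, ?_⟩, ?_, ?_⟩ <;> simp only [DRParam.dual]
  · linarith
  · linarith
  · linarith
  · linarith
  · linarith
  · rw [e2]
    linarith

lemma Cond.mobius_dual_A₀ (h : p.Cond) {z : ℝ} (hz : z ∈ Icc (0 : ℝ) 1) :
    mobius p.dual.A₀ z = 1 - mobius p.A₁ (1 - z) := by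
  have h1 := h.c₁_add_one_pos
  have hd : 0 < p.c₁ * (1 - z) + 1 :=
    (lt_min one_pos (by linarith)).trans_le (den_ge (c := p.c₁) ⟨by linarith [hz.2], by linarith [hz.1]⟩)
  have e1 : -(p.c₁ / (1 + p.c₁)) + 1 = 1 / (1 + p.c₁) := by
    have : 1 + p.c₁ ≠ 0 := by linarith
    field_simp
    ring
  have e2 : -(p.c₁ / (1 + p.c₁)) * z + 1 = (p.c₁ * (1 - z) + 1) / (1 + p.c₁) := by
    have : 1 + p.c₁ ≠ 0 := by linarith
    field_simp
    ring
  rw [mobius_A₀, mobius_A₁]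
  simp only [DRParam.dual]
  rw [e1, e2, mul_one_div, div_mul_eq_mul_div, div_div_div_cancel_right₀ (by linarith),
    one_sub_div hd.ne']
  congr 1
  ring

lemma Cond.mobius_dual_A₁ (h : p.Cond) {z : ℝ} (hz : z ∈ Icc (0 : ℝ) 1) :
    mobius p.dual.A₁ z = 1 - mobius p.A₀ (1 - z) := by
  have h1 := h.c₀_add_one_pos
  have hd : 0 < p.c₀ * (1 - z) + 1 :=
    (lt_min one_pos (by linarith)).trans_le (den_ge (c := p.c₀) ⟨by linarith [hz.2], by linarith [hz.1]⟩)
  have h1' : 1 + p.c₀ ≠ 0 := by linarith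
  have e1 : (1 - (1 - p.b) + -(p.c₀ / (1 + p.c₀))) * z + (1 - p.b) =
      ((p.b * (1 + p.c₀) - p.c₀) * z + (1 - p.b) * (1 + p.c₀)) / (1 + p.c₀) := by
    field_simp
    ring
  have e2 : -(p.c₀ / (1 + p.c₀)) * z + 1 = (p.c₀ * (1 - z) + 1) / (1 + p.c₀) := by
    field_simp
    ring
  rw [mobius_A₀, mobius_A₁]
  simp only [DRParam.dual]
  rw [e1, e2, div_div_div_cancel_right₀ h1', one_sub_div hd.ne']
  congr 1
  ring

/-- The reflection `x ↦ 1 - f (1 - x)` of a continuous distribution function. -/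
noncomputable def reflection (f : StieltjesFunction ℝ) (hf : Continuous f) : StieltjesFunction ℝ where
  toFun x := 1 - f (1 - x)
  mono' _ _ hxy := sub_le_sub_left (f.mono (sub_le_sub_left hxy 1)) 1
  right_continuous' _ := Continuous.continuousWithinAt (by fun_prop)

lemma IsDeRham.reflection (hf : p.IsDeRham f) (h : p.Cond) :
    p.dual.IsDeRham (reflection f hf.cont) := by
  have happ : ∀ x, DRParam.reflection f hf.cont x = 1 - f (1 - x) := fun _ => rfl
  have hmem : ∀ x, 1 - f (1 - x) ∈ Icc (0 : ℝ) 1 := fun x =>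
    ⟨by linarith [(hf.mem_Icc (1 - x)).2], by linarith [(hf.mem_Icc (1 - x)).1]⟩
  refine ⟨?_, fun x hx => ?_, fun x hx => ?_, fun x hx => ?_, fun x hx => ?_⟩
  · exact continuous_const.sub (hf.cont.comp (continuous_const.sub continuous_id))
  · rw [happ, hf.right _ (by linarith), sub_self]
  · rw [happ, hf.left _ (by linarith), sub_zero]
  · rw [happ, happ, h.mobius_dual_A₀ (hmem _), sub_sub_cancel,
      hf.eq₁ (1 - x) ⟨by linarith [hx.2], by linarith [hx.1]⟩]
    rw [show 2 * (1 - x) - 1 = 1 - 2 * x by ring]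
  · rw [happ, happ, h.mobius_dual_A₁ (hmem _), sub_sub_cancel,
      hf.eq₀ (1 - x) ⟨by linarith [hx.2], by linarith [hx.1]⟩]
    rw [show 2 * (1 - x) = 1 - (2 * x - 1) by ring]

end DRParam

lemma IsSmoothAtZero.dual {γ : ℝ → DRParam} (hγ : IsSmoothAtZero γ) :
    IsSmoothAtZero fun t => (γ t).dual where
  cond := hγ.cond.mono fun _ ht => ht.dual
  b := contDiffAt_const.sub hγ.b
  c₀ := (hγ.c₁.div (contDiffAt_const.add hγ.c₁)
    (by linarith [hγ.cond.self_of_nhds.c₁_add_one_pos])).neg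
  c₁ := (hγ.c₀.div (contDiffAt_const.add hγ.c₀)
    (by linarith [hγ.cond.self_of_nhds.c₀_add_one_pos])).neg

lemma distF_dual {γ : ℝ → DRParam} {t : ℝ} (h : (γ t).Cond) (x : ℝ) :
    distF (fun t => (γ t).dual) t x = 1 - distF γ t (1 - x) := by
  obtain ⟨f, hf, -⟩ := DRParam.existsUnique_isDeRham h
  rw [distF_eq h hf, distF_eq (γ := fun t => (γ t).dual) h.dual (hf.reflection h)]
  rfl

lemma IsSmoothAtZero.fk_one_dual {γ : ℝ → DRParam} (hγ : IsSmoothAtZero γ) (x : ℝ) :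
    fk (fun t => (γ t).dual) 1 x = 0 - fk γ 1 (1 - x) := by
  have : (fun t => distF (fun t => (γ t).dual) t x) =ᶠ[𝓝 0] fun t => 1 - distF γ t (1 - x) :=
    hγ.cond.mono fun t ht => distF_dual ht x
  rw [fk, fk, iteratedDeriv_one, iteratedDeriv_one, this.deriv_eq, deriv_const_sub, zero_sub]

/-- The constant is 1 for the distribution functions and 0 for their t-derivatives. Reversing the
interval and the sign together preserves increments. -/
lemma dyadicInc_reflection {f g : ℝ → ℝ} {C : ℝ} (h : ∀ x, g x = C - f (1 - x)) {n j : ℕ}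
    (hj : j < 2 ^ n) : dyadicInc g n (2 ^ n - 1 - j) = dyadicInc f n j := by
  have e : ((2 ^ n - 1 - j : ℕ) : ℝ) = 2 ^ n - 1 - j := by
    rw [Nat.cast_sub (by omega), Nat.cast_sub Nat.one_le_two_pow]
    push_cast
    ring
  have hp : (2 : ℝ) ^ n ≠ 0 := by positivity
  have e1 : 1 - ((2 ^ n - 1 - j : ℝ) + 1) / 2 ^ n = j / 2 ^ n := by
    field_simp
    ring
  have e2 : 1 - (2 ^ n - 1 - j : ℝ) / 2 ^ n = (j + 1) / 2 ^ n := by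
    field_simp
    ring
  rw [dyadicInc, h, h, e, e1, e2, dyadicInc]
  ring

/-- For the second alternative the left half of the mirrored interval is the right half of the
original one. There D(right) = P D - Q m, hence D(left) = (1 - P) D + Q m by additivity. -/
lemma IsSmoothAtZero.hasSplitting {γ : ℝ → DRParam} (hγ : IsSmoothAtZero γ) (h : ND γ) :
    HasSplitting (dyadicInc (distF γ 0)) (dyadicInc (fk γ 1)) := by
  rcases h with h | h
  · exact hγ.hasSplitting_of_ND₁ h
  · obtain ⟨η, hη, ε, hε, C, hs⟩ := hγ.dual.hasSplitting_of_ND₂ h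
    refine ⟨η, hη, ε, hε, C, fun n j hj => ?_⟩
    obtain ⟨P, hP, Q, hQ, e1, e2⟩ := hs n (2 ^ n - 1 - j) (by omega)
    have hi : 2 * (2 ^ n - 1 - j) = 2 ^ (n + 1) - 1 - (2 * j + 1) := by rw [pow_succ]; omega
    have hj' : 2 * j + 1 < 2 ^ (n + 1) := by rw [pow_succ]; omega
    have r1 := distF_dual (γ := γ) hγ.cond.self_of_nhds
    have r2 := hγ.fk_one_dual
    simp only [Pi.neg_apply] at e2
    rw [hi, dyadicInc_reflection r1 hj', dyadicInc_reflection r1 hj] at e1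
    rw [hi, dyadicInc_reflection r2 hj', dyadicInc_reflection r2 hj,
      dyadicInc_reflection r1 hj] at e2
    have a1 := dyadicInc_children (distF γ 0) n j
    have a2 := dyadicInc_children (fk γ 1) n j
    exact ⟨1 - P, ⟨by linarith [hP.2], by linarith [hP.1]⟩, Q, hQ, by linarith, by linarith⟩

/-! ### Hellinger affinity and the exponent c. -/

/-- A quantitative Cauchy–Schwarz inequality: with d = P - 1/2, √(P(1-P)) = √(1/4 - d²) ≤ 1/2 - d²,
and squaring both sides of the claim reduces it to this. -/
lemma sqrt_add_sqrt_one_sub_le {P : ℝ} (h0 : 0 ≤ P) (h1 : P ≤ 1) :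
    √P + √(1 - P) ≤ √2 * (1 - (P - 1 / 2) ^ 2 / 2) := by
  have hd : (P - 1 / 2) ^ 2 ≤ 1 / 4 := by nlinarith
  have a := Real.sq_sqrt h0
  have b := Real.sq_sqrt (sub_nonneg.2 h1)
  have c : √2 ^ 2 = (2 : ℝ) := Real.sq_sqrt zero_le_two
  refine abs_le_of_sq_le_sq' ?_ (mul_nonneg (Real.sqrt_nonneg _) (by linarith)) |>.2
  have hprod : √P * √(1 - P) ≤ 1 / 2 - (P - 1 / 2) ^ 2 := by
    refine abs_le_of_sq_le_sq' ?_ (by linarith) |>.2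
    rw [mul_pow, a, b]
    nlinarith [sq_nonneg ((P - 1 / 2) ^ 2)]
  rw [mul_pow, c]
  nlinarith [sq_nonneg ((P - 1 / 2) ^ 2)]

/-- The Hellinger-type affinity of two successive splittings. -/
lemma two_step_affinity_le {η P P₀ P₁ : ℝ} (hη : 0 < η) (hP : P ∈ Icc η (1 - η))
    (h0 : P₀ ∈ Icc (0 : ℝ) 1) (h1 : P₁ ∈ Icc (0 : ℝ) 1) :
    √P * (√P₀ + √(1 - P₀)) + √(1 - P) * (√P₁ + √(1 - P₁)) ≤
      2 * (1 - ((P - 1 / 2) ^ 2 / 2 + √η / 4 * ((P₀ - 1 / 2) ^ 2 + (P₁ - 1 / 2) ^ 2))) := by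
  have c : √2 * √2 = (2 : ℝ) := Real.mul_self_sqrt zero_le_two
  have hs1 : 1 ≤ √2 := Real.one_le_sqrt.2 one_le_two
  have a0 := sqrt_add_sqrt_one_sub_le h0.1 h0.2
  have a1 := sqrt_add_sqrt_one_sub_le h1.1 h1.2
  have a := sqrt_add_sqrt_one_sub_le (P := P) (by linarith [hP.1]) (by linarith [hP.2])
  have q0 : √η ≤ √P := Real.sqrt_le_sqrt hP.1
  have q1 : √η ≤ √(1 - P) := Real.sqrt_le_sqrt (by linarith [hP.2])
  have e0 := sq_nonneg (P₀ - 1 / 2)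
  have e1 := sq_nonneg (P₁ - 1 / 2)
  have hη0 := Real.sqrt_nonneg η
  calc √P * (√P₀ + √(1 - P₀)) + √(1 - P) * (√P₁ + √(1 - P₁))
      ≤ √P * (√2 * (1 - (P₀ - 1 / 2) ^ 2 / 2)) + √(1 - P) * (√2 * (1 - (P₁ - 1 / 2) ^ 2 / 2)) := by
        gcongr
    _ = √2 * (√P + √(1 - P)) -
        √2 / 2 * (√P * (P₀ - 1 / 2) ^ 2 + √(1 - P) * (P₁ - 1 / 2) ^ 2) := by ring
    _ ≤ √2 * (√2 * (1 - (P - 1 / 2) ^ 2 / 2)) -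
        1 / 2 * (√η * (P₀ - 1 / 2) ^ 2 + √η * (P₁ - 1 / 2) ^ 2) := by
        gcongr
    _ = _ := by rw [← mul_assoc, c]; ring

section
variable {μ : Measure ℝ} {m : ℕ → ℕ → ℝ}

/-- If the sums of the square roots of the masses decay at a rate strictly better than the trivial
one, the mass lower bound holds with an exponent less than `1`. -/
lemma HasDyadicMass.exists_hasMassLowerBound (h : HasDyadicMass μ m) {η δ : ℝ} (hη : 0 < η)
    (hη1 : η ≤ 1) (hδ : 0 < δ) (hδ1 : δ ≤ 1)
    (hchild : ∀ n, ∀ j < 2 ^ (n + 1), η * m n (j / 2) ≤ m (n + 1) j)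
    (hdecay : ∀ n, ∑ j ∈ Finset.range (2 ^ (2 * n)), √(m (2 * n) j) ≤ (2 * (1 - δ)) ^ n) :
    ∃ c ∈ Ico (0 : ℝ) 1, HasMassLowerBound μ m c := by
  have := h.prob
  -- The exponent is c = 1 - θ. The gain 1 - δ leaves room for a small θ > 0, as (1 - δ) 2^θ tends
  -- to 1 - δ < 1 when θ tends to 0.
  obtain ⟨θ, ⟨hθ0, hθ1⟩, hθ⟩ : ∃ θ ∈ Ioc (0 : ℝ) 1, (1 - δ) * 2 ^ θ < 1 := by
    have hc : Continuous fun θ : ℝ => (1 - δ) * (2 : ℝ) ^ θ :=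
      continuous_const.mul (Real.continuous_const_rpow two_ne_zero)
    have hev : ∀ᶠ θ : ℝ in 𝓝[>] 0, (1 - δ) * (2 : ℝ) ^ θ < 1 :=
      (hc.continuousAt.eventually_lt continuousAt_const
        (by simpa using hδ)).filter_mono nhdsWithin_le_nhds
    obtain ⟨θ, h1, h2⟩ := (hev.and (Ioc_mem_nhdsGT one_pos)).exists
    exact ⟨θ, h2, h1⟩
  set c : ℝ := 1 - θ
  have hc0 : 0 ≤ c := by simp only [c]; linarith
  refine ⟨c, ⟨hc0, by simp only [c]; linarith⟩, ?_⟩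
  set r := (1 - δ) * (2 : ℝ) ^ θ
  have hr0 : 0 ≤ r := mul_nonneg (by linarith) (by positivity)
  let s : ℕ → Set ℝ := fun n =>
    {x | m (2 * n) (dyadicIndex (2 * n) x) * ((2 : ℝ) ^ (2 * n)) ^ c < 1}
  have hs : ∀ n, μ (s n) ≤ ENNReal.ofReal (r ^ n) := by
    intro n
    classical
    let g : ℕ → ℝ := fun j => if m (2 * n) j * ((2 : ℝ) ^ (2 * n)) ^ c < 1 then 1 else 0
    have hmeas : MeasurableSet (s n) :=
      measurable_dyadicIndex (2 * n) (t := {j | m (2 * n) j * ((2 : ℝ) ^ (2 * n)) ^ c < 1}) trivial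
    have e : (s n).indicator 1 = fun x => g (dyadicIndex (2 * n) x) := by
      ext x
      simp [s, g, indicator_apply]
    have hint := h.integral (2 * n) g
    rw [← e, integral_indicator_one hmeas] at hint
    rw [← ofReal_measureReal, hint]
    refine ENNReal.ofReal_le_ofReal ?_
    have hpow : (((2 : ℝ) ^ (2 * n)) ^ c) = (((2 : ℝ) ^ n) ^ c) ^ 2 := by
      rw [← Real.rpow_natCast, ← Real.rpow_natCast, ← Real.rpow_mul zero_le_two,
        ← Real.rpow_natCast, ← Real.rpow_mul zero_le_two, ← Real.rpow_mul zero_le_two]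
      congr 1
      push_cast
      ring
    have hq : 0 < ((2 : ℝ) ^ n) ^ c := by positivity
    -- On the exceptional set √m < 2^(-nc), so m ≤ √m · 2^(-nc) there; the decay hypothesis then
    -- gives the geometric bound r^n.
    calc ∑ j ∈ Finset.range (2 ^ (2 * n)), m (2 * n) j * g j
        ≤ ∑ j ∈ Finset.range (2 ^ (2 * n)), √(m (2 * n) j) * (((2 : ℝ) ^ n) ^ c)⁻¹ := by
          refine Finset.sum_le_sum fun j hj => ?_
          have hp := h.pos (2 * n) j (Finset.mem_range.1 hj)
          simp only [g]
          split_ifs with hlt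
          · rw [mul_one]
            nth_rewrite 1 [← Real.mul_self_sqrt hp.le]
            refine mul_le_mul_of_nonneg_left ?_ (Real.sqrt_nonneg _)
            rw [le_inv_comm₀ (Real.sqrt_pos.2 hp) hq]
            rw [hpow, mul_comm, ← lt_div_iff₀ hp, one_div] at hlt
            refine abs_le_of_sq_le_sq' ?_ (by positivity) |>.2
            rw [inv_pow, Real.sq_sqrt hp.le]
            exact hlt.le
          · rw [mul_zero]
            positivity
      _ = (∑ j ∈ Finset.range (2 ^ (2 * n)), √(m (2 * n) j)) * (((2 : ℝ) ^ n) ^ c)⁻¹ := by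
          rw [Finset.sum_mul]
      _ ≤ (2 * (1 - δ)) ^ n * (((2 : ℝ) ^ n) ^ c)⁻¹ := by
          gcongr
          exact hdecay n
      _ = r ^ n := by
          have e1 : ((2 : ℝ) ^ n) ^ c = ((2 : ℝ) ^ c) ^ n := by
            rw [← Real.rpow_natCast, ← Real.rpow_natCast, ← Real.rpow_mul zero_le_two,
              ← Real.rpow_mul zero_le_two, mul_comm]
          have e2 : (2 : ℝ) * ((2 : ℝ) ^ c)⁻¹ = 2 ^ θ := by
            rw [← Real.rpow_neg zero_le_two]
            nth_rewrite 1 [← Real.rpow_one 2]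
            rw [← Real.rpow_add two_pos]
            congr 1
            simp only [c]
            ring
          rw [e1, ← inv_pow, ← mul_pow, mul_right_comm, e2, mul_comm]
  have hsum : ∑' n, μ (s n) ≠ ⊤ := by
    refine ne_top_of_le_ne_top ?_ (ENNReal.tsum_le_tsum hs)
    exact (summable_geometric_of_lt_one hr0 hθ).tsum_ofReal_ne_top
  -- By Borel–Cantelli almost every point leaves the exceptional sets eventually. Odd levels cost a
  -- factor η, and finitely many initial levels only change the constant.
  filter_upwards [ae_eventually_notMem hsum, h.unit] with x hx hx1
  have hp : ∀ n, 0 < m n (dyadicIndex n x) * ((2 : ℝ) ^ n) ^ c := fun n =>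
    mul_pos (h.pos n _ (dyadicIndex_lt hx1 n)) (by positivity)
  have hev : ∀ᶠ n in atTop, (m n (dyadicIndex n x) * ((2 : ℝ) ^ n) ^ c)⁻¹ ≤ η⁻¹ := by
    obtain ⟨N, hN⟩ := eventually_atTop.1 hx
    filter_upwards [eventually_ge_atTop (2 * N)] with n hn
    refine inv_anti₀ hη ?_
    have h1 : 1 ≤ m (2 * (n / 2)) (dyadicIndex (2 * (n / 2)) x) * ((2 : ℝ) ^ (2 * (n / 2))) ^ c :=
      not_lt.1 (hN (n / 2) (by omega))
    rcases Nat.even_or_odd' n with ⟨i, rfl | rfl⟩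
    · rw [show 2 * i / 2 = i by omega] at h1
      linarith
    · rw [show (2 * i + 1) / 2 = i by omega] at h1
      have h2 := hchild (2 * i) _ (dyadicIndex_lt hx1 (2 * i + 1))
      rw [dyadicIndex_succ_div] at h2
      have hpow : ((2 : ℝ) ^ (2 * i)) ^ c ≤ ((2 : ℝ) ^ (2 * i + 1)) ^ c :=
        Real.rpow_le_rpow (by positivity) (pow_le_pow_right₀ one_le_two (Nat.le_succ _)) hc0
      calc η = η * 1 := (mul_one η).symm
        _ ≤ η * (m (2 * i) (dyadicIndex (2 * i) x) * ((2 : ℝ) ^ (2 * i)) ^ c) := by gcongr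
        _ = η * m (2 * i) (dyadicIndex (2 * i) x) * ((2 : ℝ) ^ (2 * i)) ^ c := by ring
        _ ≤ _ := mul_le_mul h2 hpow (by positivity) (h.pos _ _ (dyadicIndex_lt hx1 _)).le
  obtain ⟨B, hB⟩ := IsBoundedUnder.bddAbove_range (isBoundedUnder_of_eventually_le hev)
  have hB0 : 0 < B := (inv_pos.2 (hp 0)).trans_le (hB ⟨0, rfl⟩)
  exact ⟨B⁻¹, inv_pos.2 hB0, fun n => inv_le_of_inv_le₀ (hp n) (hB ⟨n, rfl⟩)⟩

end

namespace DRParam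

variable {p : DRParam} {f : StieltjesFunction ℝ}

/-- A measure with Lipschitz continuous distribution function is absolutely continuous. -/
lemma absolutelyContinuous_of_lipschitz (f : StieltjesFunction ℝ) (hf : Continuous f) {L : ℝ}
    (hL : 0 ≤ L) (h : ∀ u v, u ≤ v → f v - f u ≤ L * (v - u)) : f.measure ≪ volume := by
  -- Since L x - f x is also nondecreasing, the measure of `f` is dominated by L times Lebesgue
  -- measure.
  let g : StieltjesFunction ℝ :=
    ⟨fun x => L * x - f x, fun u v huv => by
      have := h u v huv
      dsimp only
      linarith, fun x => Continuous.continuousWithinAt (by fun_prop)⟩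
  have e : f + g = L.toNNReal • StieltjesFunction.id := by
    ext x
    change f x + (L * x - f x) = (L.toNNReal : ℝ) * x
    rw [Real.coe_toNNReal _ hL]
    ring
  have e2 : f.measure + g.measure = L.toNNReal • volume := by
    rw [← StieltjesFunction.measure_add, e, StieltjesFunction.measure_smul,
      Real.volume_eq_stieltjes_id]
  have hle : f.measure ≤ L.toNNReal • volume := by
    rw [← e2]
    exact Measure.le_add_right le_rfl
  exact (Measure.absolutelyContinuous_of_le hle).trans
    (Measure.smul_absolutelyContinuous (c := (L.toNNReal : ENNReal)))

/-- The linear fractional solution of de Rham's functional equation. -/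
lemma absolutelyContinuous_of_linearFractional (h : p.Cond) (h0 : 2 * p.b * p.c₀ = 1 - 2 * p.b)
    (h1 : p.c₁ = 1 - 2 * p.b) : p.measure ≪ volume := by
  have hb := h.1.1
  have hb1 := h.1.2
  set b := p.b
  -- The solution is b x/((2b-1)x + 1 - b) on [0, 1]. It is Lipschitz because the denominator is a
  -- convex combination of b and 1 - b.
  let D : ℝ → ℝ := fun x => (2 * b - 1) * x + (1 - b)
  let φ : ℝ → ℝ := fun x => b * x / D x
  let cl : ℝ → ℝ := fun x => max 0 (min x 1)
  have hcl : ∀ x, cl x ∈ Icc (0 : ℝ) 1 := fun x =>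
    ⟨le_max_left _ _, max_le zero_le_one (min_le_right _ _)⟩
  have hcl' : ∀ x ∈ Icc (0 : ℝ) 1, cl x = x := fun x hx => by
    simp only [cl]
    rw [min_eq_left hx.2, max_eq_right hx.1]
  set d := min b (1 - b)
  have hd : 0 < d := lt_min hb (by linarith)
  have hD : ∀ x ∈ Icc (0 : ℝ) 1, d ≤ D x := fun x hx => by
    have e : D x = b * x + (1 - b) * (1 - x) := by simp only [D]; ring
    rw [e]
    have i1 : d * x ≤ b * x := mul_le_mul_of_nonneg_right (min_le_left _ _) hx.1
    have i2 : d * (1 - x) ≤ (1 - b) * (1 - x) :=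
      mul_le_mul_of_nonneg_right (min_le_right _ _) (by linarith [hx.2])
    linarith
  have hDpos : ∀ x ∈ Icc (0 : ℝ) 1, 0 < D x := fun x hx => hd.trans_le (hD x hx)
  have hsub : ∀ u ∈ Icc (0 : ℝ) 1, ∀ v ∈ Icc (0 : ℝ) 1,
      φ v - φ u = b * (1 - b) / (D u * D v) * (v - u) := fun u hu v hv => by
    simp only [φ]
    rw [div_sub_div _ _ (hDpos v hv).ne' (hDpos u hu).ne', div_mul_eq_mul_div, mul_comm (D u) (D v)]
    congr 1
    simp only [D]
    ring
  have hbb : 0 < b * (1 - b) := mul_pos hb (by linarith)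
  have hclm : Monotone cl := fun u v huv => max_le_max le_rfl (min_le_min huv le_rfl)
  have hcll : ∀ u v, u ≤ v → cl v - cl u ≤ v - u := fun u v huv => by
    simp only [cl]
    rcases le_total u 1 with h1 | h1 <;> rcases le_total v 1 with h2 | h2 <;>
    rcases le_total u 0 with h3 | h3 <;> rcases le_total v 0 with h4 | h4 <;>
    simp only [min_eq_left, min_eq_right, max_eq_left, max_eq_right, h1, h2, h3, h4, zero_le_one] <;>
    linarith
  have hcc : Continuous fun x => φ (cl x) := by
    have hclc : Continuous cl := continuous_const.max (continuous_id.min continuous_const)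
    refine Continuous.div ?_ ?_ fun x => (hDpos _ (hcl x)).ne'
    · exact continuous_const.mul hclc
    · exact (continuous_const.mul hclc).add continuous_const
  have hdiff : ∀ u v, u ≤ v → 0 ≤ φ (cl v) - φ (cl u) ∧
      φ (cl v) - φ (cl u) ≤ b * (1 - b) / (d * d) * (v - u) := fun u v huv => by
    have p1 := hDpos _ (hcl u)
    have p2 := hDpos _ (hcl v)
    rw [hsub _ (hcl u) _ (hcl v)]
    have i1 := hclm huv
    constructor
    · exact mul_nonneg (by positivity) (by linarith)
    · refine mul_le_mul ?_ (hcll u v huv) (by linarith) (by positivity)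
      exact div_le_div_of_nonneg_left hbb.le (by positivity)
        (mul_le_mul (hD _ (hcl u)) (hD _ (hcl v)) hd.le p1.le)
  let F : StieltjesFunction ℝ :=
    ⟨fun x => φ (cl x), fun u v huv => by linarith [(hdiff u v huv).1],
      fun x => hcc.continuousWithinAt⟩
  have hF : p.IsDeRham F := by
    have happ : ∀ x ∈ Icc (0 : ℝ) 1, F x = b * x / D x := fun x hx => by
      change φ (cl x) = _
      rw [hcl' x hx]
    have hc0 : p.c₀ = (1 - 2 * b) / (2 * b) := by field_simp; linarith
    refine ⟨hcc, fun x hx => ?_, fun x hx => ?_, fun x hx => ?_, fun x hx => ?_⟩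
    · change φ (cl x) = 0
      have : cl x = 0 := max_eq_left ((min_le_left _ _).trans hx)
      simp [this, φ]
    · change φ (cl x) = 1
      have : cl x = 1 := by simp only [cl]; rw [min_eq_right hx, max_eq_right zero_le_one]
      simp only [this, φ, D]
      rw [div_eq_one_iff_eq (by linarith)]
      ring
    · have m1 : x ∈ Icc (0 : ℝ) 1 := ⟨hx.1, by linarith [hx.2]⟩
      have m2 : 2 * x ∈ Icc (0 : ℝ) 1 := ⟨by linarith [hx.1], by linarith [hx.2]⟩
      have d1 := hDpos _ m1
      have d2 := hDpos _ m2
      rw [happ _ m1, happ _ m2, mobius_A₀, hc0]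
      change _ = b * ((1 - 2 * b) / (2 * b) + 1) * (b * (2 * x) / D (2 * x)) /
        ((1 - 2 * b) / (2 * b) * (b * (2 * x) / D (2 * x)) + 1)
      have e1 : b * ((1 - 2 * b) / (2 * b) + 1) * (b * (2 * x) / D (2 * x)) =
          b * x / D (2 * x) := by
        field_simp
        ring
      have e2 : (1 - 2 * b) / (2 * b) * (b * (2 * x) / D (2 * x)) + 1 = D x / D (2 * x) := by
        rw [eq_div_iff d2.ne', add_mul, mul_assoc, div_mul_cancel₀ _ d2.ne']
        simp only [D]
        field_simp
        ring
      rw [e1, e2, div_div_div_cancel_right₀ d2.ne']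
    · have m1 : x ∈ Icc (0 : ℝ) 1 := ⟨by linarith [hx.1], hx.2⟩
      have m2 : 2 * x - 1 ∈ Icc (0 : ℝ) 1 := ⟨by linarith [hx.1], by linarith [hx.2]⟩
      have d1 := hDpos _ m1
      have d2 := hDpos _ m2
      rw [happ _ m1, happ _ m2, mobius_A₁, h1]
      change _ = ((1 - b + (1 - 2 * b)) * (b * (2 * x - 1) / D (2 * x - 1)) + b) /
        ((1 - 2 * b) * (b * (2 * x - 1) / D (2 * x - 1)) + 1)
      have e1 : (1 - b + (1 - 2 * b)) * (b * (2 * x - 1) / D (2 * x - 1)) + b =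
          2 * (1 - b) * (b * x) / D (2 * x - 1) := by
        rw [eq_div_iff d2.ne', add_mul, mul_assoc, div_mul_cancel₀ _ d2.ne']
        simp only [D]
        ring
      have e2 : (1 - 2 * b) * (b * (2 * x - 1) / D (2 * x - 1)) + 1 =
          2 * (1 - b) * D x / D (2 * x - 1) := by
        rw [eq_div_iff d2.ne', add_mul, mul_assoc, div_mul_cancel₀ _ d2.ne']
        simp only [D]
        ring
      rw [e1, e2, div_div_div_cancel_right₀ d2.ne', mul_div_mul_left _ _ (by linarith)]
  rw [hF.measure_eq h]
  exact absolutelyContinuous_of_lipschitz F hcc (by positivity) fun u v huv => (hdiff u v huv).2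

lemma IsDeRham.child_le (hf : p.IsDeRham f) (h : p.Cond) {η : ℝ}
    (hη : ∀ y ∈ Icc p.α p.β, p.leftShare y ∈ Icc η (1 - η)) (n : ℕ) {j : ℕ} (hj : j < 2 ^ (n + 1)) :
    η * dyadicInc f n (j / 2) ≤ dyadicInc f (n + 1) j := by
  have hj2 : j / 2 < 2 ^ n := by rw [pow_succ] at hj; omega
  have hp := hf.dyadicInc_pos h n _ hj2
  have hP := hη _ (h.rowRatio_mem_Icc n (j / 2))
  rcases Nat.even_or_odd' j with ⟨i, rfl | rfl⟩
  · rw [show 2 * i / 2 = i by omega] at *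
    rw [hf.dyadicInc_even h hj2]
    exact mul_le_mul_of_nonneg_right hP.1 hp.le
  · rw [show (2 * i + 1) / 2 = i by omega] at *
    rw [hf.dyadicInc_odd h hj2]
    exact mul_le_mul_of_nonneg_right (by linarith [hP.2]) hp.le

/-- The gain over the trivial bound in two successive splittings that start at row ratio `y`. -/
noncomputable def affinityGap (p : DRParam) (η y : ℝ) : ℝ :=
  (p.leftShare y - 1 / 2) ^ 2 / 2 +
    √η / 4 * ((p.leftShare (p.G₀ y) - 1 / 2) ^ 2 + (p.leftShare (p.G₁ y) - 1 / 2) ^ 2)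

lemma Cond.continuousOn_affinityGap (h : p.Cond) (η : ℝ) :
    ContinuousOn (p.affinityGap η) (Icc p.α p.β) := by
  have hden : ∀ y ∈ Icc p.α p.β, p.b * y + 1 ≠ 0 := fun y hy =>
    (h.den_pos (h.neg_one_lt_α.trans_le hy.1)).ne'
  have hP : ContinuousOn p.leftShare (Icc p.α p.β) := by
    refine ContinuousOn.div (by fun_prop) (by fun_prop) fun y hy => ?_
    rw [add_comm]
    exact hden y hy
  have hG₀ : ContinuousOn p.G₀ (Icc p.α p.β) := by
    rw [show p.G₀ = _ from funext p.G₀_apply]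
    fun_prop
  have hG₁ : ContinuousOn p.G₁ (Icc p.α p.β) := by
    rw [show p.G₁ = _ from funext p.G₁_apply]
    exact ContinuousOn.div (by fun_prop) (by fun_prop) hden
  have h0 := hP.comp hG₀ h.mapsTo_G₀_Icc
  have h1 := hP.comp hG₁ h.mapsTo_G₁_Icc
  exact (((hP.sub continuousOn_const).pow 2).div_const 2).add (continuousOn_const.mul
    (((h0.sub continuousOn_const).pow 2).add ((h1.sub continuousOn_const).pow 2)))

lemma Cond.mul_eq_of_leftShare (h : p.Cond) {y : ℝ} (hy : -1 < y)
    (hP : (p.leftShare y - 1 / 2) ^ 2 = 0) : p.b * y = 1 - 2 * p.b := by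
  have hd := h.den_pos hy
  have : p.leftShare y = 1 / 2 := by linarith [pow_eq_zero_iff (two_ne_zero) |>.1 hP]
  rw [leftShare, div_eq_div_iff (by linarith) two_ne_zero] at this
  linarith

/-- One splitting may be even, but the gap vanishes only if the splittings at y, `G₀ y` and `G₁ y`
all are. Then all three ratios equal (1 - 2b)/b, a common fixed point; this determines c₀ and c₁ and
makes the solution linear fractional. -/
lemma Cond.affinityGap_pos (h : p.Cond) (hs : ¬ p.measure ≪ volume) {η : ℝ} (hη : 0 < η) {y : ℝ}
    (hy : y ∈ Icc p.α p.β) : 0 < p.affinityGap η y := by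
  by_contra hcon
  have hη' := Real.sqrt_pos.2 hη
  have hb := h.1.1
  have hb1 := h.1.2
  have hy1 : -1 < y := h.neg_one_lt_α.trans_le hy.1
  set A := (p.leftShare y - 1 / 2) ^ 2 with hA
  set B := (p.leftShare (p.G₀ y) - 1 / 2) ^ 2 with hB
  set C := (p.leftShare (p.G₁ y) - 1 / 2) ^ 2 with hC
  have hA0 : 0 ≤ A := sq_nonneg _
  have hB0 : 0 ≤ B := sq_nonneg _
  have hC0 : 0 ≤ C := sq_nonneg _
  have hgap : p.affinityGap η y = A / 2 + √η / 4 * (B + C) := rfl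
  rw [hgap, not_lt] at hcon
  have hBC : 0 ≤ √η / 4 * (B + C) := by positivity
  have hBC' : B + C ≤ 0 := by
    by_contra hlt
    have : 0 < √η / 4 * (B + C) := mul_pos (by linarith) (not_le.1 hlt)
    linarith
  have e0 := h.mul_eq_of_leftShare hy1 (show A = 0 by linarith)
  have e1 := h.mul_eq_of_leftShare (h.mapsTo_G₀_Ioi hy1) (show B = 0 by linarith)
  have e2 := h.mul_eq_of_leftShare (h.mapsTo_G₁_Ioi hy1) (show C = 0 by linarith)
  have hd := h.den_pos hy1
  rw [G₀_apply] at e1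
  rw [G₁_apply, mul_div_assoc', div_eq_iff hd.ne'] at e2
  refine hs (absolutelyContinuous_of_linearFractional h ?_ ?_)
  · refine mul_right_cancel₀ (b := 1 - p.b) (by linarith) ?_
    linear_combination e1 - p.b * (p.c₀ + 1) * e0
  · refine mul_right_cancel₀ (b := 1 - p.b) (by linarith) ?_
    linear_combination e2 + (1 - 2 * p.b - (1 - p.b + p.c₁)) * e0

/-- Each interval of level 2n has four grandchildren, and the sum of the square roots of their
masses is at most 2(1 - δ) times the square root of its own. -/
lemma IsDeRham.sum_sqrt_le (hf : p.IsDeRham f) (h : p.Cond) {η δ : ℝ} (hη : 0 < η) (hδ1 : δ ≤ 1)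
    (hP : ∀ y ∈ Icc p.α p.β, p.leftShare y ∈ Icc η (1 - η))
    (hδ : ∀ y ∈ Icc p.α p.β, δ ≤ p.affinityGap η y) (n : ℕ) :
    ∑ j ∈ Finset.range (2 ^ (2 * n)), √(dyadicInc f (2 * n) j) ≤ (2 * (1 - δ)) ^ n := by
  induction n with
  | zero => simp [dyadicInc, hf.left 0 le_rfl, hf.right 1 le_rfl]
  | succ n ih =>
    rw [show 2 * (n + 1) = 2 * n + 1 + 1 by ring, sum_range_two_pow_succ, sum_range_two_pow_succ,
      pow_succ]
    refine le_trans ?_ (mul_le_mul_of_nonneg_right ih (by linarith))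
    rw [Finset.sum_mul]
    refine Finset.sum_le_sum fun j hj => ?_
    rw [Finset.mem_range] at hj
    have hj0 : 2 * j < 2 ^ (2 * n + 1) := by rw [pow_succ]; omega
    have hj1 : 2 * j + 1 < 2 ^ (2 * n + 1) := by rw [pow_succ]; omega
    have hp := (hf.dyadicInc_pos h (2 * n) j hj).le
    have hy := h.rowRatio_mem_Icc (2 * n) j
    rw [hf.dyadicInc_even h hj0, hf.dyadicInc_odd h hj0, hf.dyadicInc_even h hj1,
      hf.dyadicInc_odd h hj1, hf.dyadicInc_even h hj, hf.dyadicInc_odd h hj, rowRatio_even,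
      rowRatio_odd]
    set y := p.rowRatio (2 * n) j
    have b := hP y hy
    have b0 := hP _ (h.mapsTo_G₀_Icc hy)
    have b1 := hP _ (h.mapsTo_G₁_Icc hy)
    have haff := two_step_affinity_le hη b ⟨hη.le.trans b0.1, by linarith [b0.2]⟩
      ⟨hη.le.trans b1.1, by linarith [b1.2]⟩
    have hgap := hδ y hy
    unfold affinityGap at hgap
    have hs : ∀ q : ℝ, q ∈ Icc η (1 - η) → ∀ r : ℝ,
        √(q * r) = √q * √r ∧ √((1 - q) * r) = √(1 - q) * √r := fun q hq r =>
      ⟨Real.sqrt_mul (hη.le.trans hq.1) r, Real.sqrt_mul (by linarith [hq.2]) r⟩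
    rw [(hs _ b0 _).1, (hs _ b0 _).2, (hs _ b1 _).1, (hs _ b1 _).2, (hs _ b _).1, (hs _ b _).2]
    calc _ = √(dyadicInc f (2 * n) j) * (√(p.leftShare y) * (√(p.leftShare (p.G₀ y)) +
            √(1 - p.leftShare (p.G₀ y))) + √(1 - p.leftShare y) * (√(p.leftShare (p.G₁ y)) +
            √(1 - p.leftShare (p.G₁ y)))) := by ring
      _ ≤ √(dyadicInc f (2 * n) j) * (2 * (1 - δ)) := by
        refine mul_le_mul_of_nonneg_left ?_ (Real.sqrt_nonneg _)
        linarith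

/-- The dichotomy is absolute continuity or not. In the second case the gap is continuous and
positive on the compact [α, β], so it has a positive minimum; a singular probability measure cannot
fall under the first. -/
lemma IsDeRham.exists_exponent (hf : p.IsDeRham f) (h : p.Cond) :
    ∃ c ∈ Icc (0 : ℝ) 1, (p.measure ⟂ₘ volume → c < 1) ∧ (p.measure ≪ volume → c = 1) ∧
      HasMassLowerBound p.measure (dyadicInc f) c := by
  have hmass := hf.hasDyadicMass h
  rw [← hf.measure_eq h] at hmass
  by_cases hac : p.measure ≪ volume
  · refine ⟨1, ⟨zero_le_one, le_rfl⟩, fun hs => ?_, fun _ => rfl, hmass.hasMassLowerBound_one⟩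
    have h0 := Measure.eq_zero_of_absolutelyContinuous_of_mutuallySingular hac hs
    have := hmass.prob
    exact absurd h0 (IsProbabilityMeasure.ne_zero _)
  · obtain ⟨η, hη, hP⟩ := h.exists_leftShare_bounds
    obtain ⟨y₀, hy₀, hmin⟩ := isCompact_Icc.exists_isMinOn ⟨0, p.zero_mem_Icc_α_β⟩
      (h.continuousOn_affinityGap η)
    have hpos := h.affinityGap_pos hac hη hy₀
    have hη1 : η ≤ 1 := by
      have := hP _ p.zero_mem_Icc_α_β
      linarith [this.1, this.2]
    obtain ⟨c, hc, hlow⟩ := hmass.exists_hasMassLowerBound (δ := min (p.affinityGap η y₀) 1) hη hη1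
      (lt_min hpos one_pos) (min_le_right _ _) (fun n j hj => hf.child_le h hP n hj)
      (hf.sum_sqrt_le h hη (min_le_right _ _) hP fun y hy =>
        (min_le_left _ _).trans (hmin hy))
    exact ⟨c, ⟨hc.1, hc.2.le⟩, fun _ => hc.2, fun h' => absurd h' hac, hlow⟩

end DRParam

/-! ### Higher derivatives in the linear case, and the main theorem. -/

lemma iteratedDeriv_affine_mul {a : ℝ} {g : ℝ → ℝ} (hg : ContDiffAt ℝ ∞ g 0) (k : ℕ) :
    iteratedDeriv (k + 1) (fun t => (t + a) * g t) 0 =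
      a * iteratedDeriv (k + 1) g 0 + (k + 1) * iteratedDeriv k g 0 := by
  have hg' : ContDiffAt ℝ ((k + 1 : ℕ)) g 0 :=
    hg.of_le (by exact_mod_cast le_top)
  have hl : ContDiffAt ℝ ((k + 1 : ℕ)) (fun t : ℝ => t + a) 0 := by fun_prop
  have h1 : deriv (fun t : ℝ => t + a) = fun _ => 1 := by
    ext t
    simp
  have h2 : ∀ i, iteratedDeriv (i + 1 + 1) (fun t : ℝ => t + a) 0 = 0 := fun i => by
    rw [iteratedDeriv_succ', h1, iteratedDeriv_succ']
    simp
  change iteratedDeriv (k + 1) ((fun t : ℝ => t + a) * g) 0 = _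
  -- In Leibniz' formula only the terms with at most one derivative on the affine factor survive.
  rw [iteratedDeriv_mul hl hg', Finset.sum_range_succ', Finset.sum_range_succ',
    Finset.sum_eq_zero fun i _ => by rw [h2]; ring]
  simp only [iteratedDeriv_zero, iteratedDeriv_one, zero_add, h1]
  simp
  ring

lemma LinearCase.dyadicInc_distF_even {γ : ℝ → DRParam} {t a : ℝ} (hC : (γ t).Cond)
    (ha : γ t = ⟨t + a, 0, 0⟩) {n j : ℕ} (hj : j < 2 ^ n) :
    dyadicInc (distF γ t) (n + 1) (2 * j) = (t + a) * dyadicInc (distF γ t) n j := by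
  rw [_root_.dyadicInc_distF_even hC hj]
  -- For c₀ = c₁ = 0 both `G₀` and `G₁` fix 0, so the share is t + a in every interval.
  have hr : (γ t).rowRatio n j = 0 := by
    refine DRParam.rowRatio_mem (s := {0}) rfl ?_ ?_ n j
    · rintro _ rfl
      simp [DRParam.G₀_apply, ha]
    · rintro _ rfl
      simp [DRParam.G₁_apply, ha]
  rw [hr, DRParam.leftShare, ha]
  simp

lemma LinearCase.dyadicInc_fk_succ {γ : ℝ → DRParam} {I : Set ℝ} (hγ : IsAdmissibleCurve γ I) {a : ℝ}
    (ha : ∀ t ∈ I, γ t = ⟨t + a, 0, 0⟩) (k : ℕ) {n j : ℕ} (hj : j < 2 ^ n) :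
    dyadicInc (fk γ (k + 1)) (n + 1) (2 * j) =
      a * dyadicInc (fk γ (k + 1)) n j + (k + 1) * dyadicInc (fk γ k) n j := by
  have hs := hγ.isSmoothAtZero
  have hj' : 2 * j < 2 ^ (n + 1) := by rw [pow_succ]; omega
  rw [hs.dyadicInc_fk _ hj, hs.dyadicInc_fk _ hj, hs.dyadicInc_fk _ hj',
    ← iteratedDeriv_affine_mul (hs.contDiffAt_dyadicInc hj)]
  refine Filter.EventuallyEq.iteratedDeriv_eq _ ?_
  filter_upwards [hγ.isOpen.mem_nhds hγ.zero_mem, hs.cond] with t ht hC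
  exact LinearCase.dyadicInc_distF_even hC (ha t ht) hj

theorem mainTheorem7 (γ : ℝ → DRParam) (I : Set ℝ) (hγ : IsAdmissibleCurve γ I) (hND : ND γ) :
    ∃ c ∈ Icc (0 : ℝ) 1,
      ((γ 0).measure ⟂ₘ volume → c < 1) ∧
      ((γ 0).measure ≪ volume → c = 1) ∧
      ∀ k : ℕ, 1 ≤ k → (k = 1 ∨ LinearCase γ I) →
        (∀ x ∈ Icc (0 : ℝ) 1, ContDiffAt ℝ k (fun t => distF γ t x) 0) ∧
        (∀ᵐ x ∂(γ 0).measure,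
          limsup (fun h : ℝ => ((|fk γ k (x + h) - fk γ k x| / |h| ^ c : ℝ) : EReal)) (𝓝[≠] 0)
            = ⊤) ∧
        (∀ u v : ℝ, 0 ≤ u → u < v → v ≤ 1 →
          supQuot (fk γ k) c (Ioo u v) = ⊤ ∧ infQuot (fk γ k) c (Ioo u v) = ⊥) ∧
        IsMTNI (fk γ k) := by
  have hs := hγ.isSmoothAtZero
  have h0 : (γ 0).Cond := hs.cond.self_of_nhds
  obtain ⟨f, hf, -⟩ := DRParam.existsUnique_isDeRham h0
  have hF : distF γ 0 = f := funext fun x => distF_eq h0 hf x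
  obtain ⟨c, hc, hc1, hc2, hlow⟩ := hf.exists_exponent h0
  have hmass := hf.hasDyadicMass h0
  rw [← hf.measure_eq h0] at hmass
  have hm := dyadicAdditive_dyadicInc f
  obtain ⟨η, hη, hP⟩ := h0.exists_leftShare_bounds
  have hchild : ∀ n, ∀ j < 2 ^ (n + 1), η * dyadicInc f n (j / 2) ≤ dyadicInc f (n + 1) j :=
    fun n j hj => hf.child_le h0 hP n hj
  have hdens : ∀ k : ℕ, 1 ≤ k → (k = 1 ∨ LinearCase γ I) →
      HasUnboundedDensity (γ 0).measure (dyadicInc f) (dyadicInc (fk γ k)) := by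
    intro k hk hL
    -- Only the start k = 1 uses (ND); each further derivative inherits unboundedness through the
    -- linear recursion.
    induction k, hk using Nat.le_induction with
    | base =>
      obtain ⟨η', hη', ε, hε, C, hsplit⟩ := hs.hasSplitting hND
      rw [hF] at hsplit
      exact hmass.hasUnboundedDensity hm (dyadicAdditive_dyadicInc _) hη' hε hsplit
    | succ k hk ih =>
      have hL' : LinearCase γ I := hL.resolve_left (by omega)
      obtain ⟨a, ha, hγa⟩ := hL'
      refine hmass.hasUnboundedDensity_succ hm (dyadicAdditive_dyadicInc _) ha (k := k + 1)
        (by linarith [(Nat.cast_nonneg k : (0 : ℝ) ≤ k)]) (fun n j hj => ?_)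
        (fun n j hj => LinearCase.dyadicInc_fk_succ hγ hγa k hj) (ih (Or.inr ⟨a, ha, hγa⟩))
      rw [← hF, LinearCase.dyadicInc_distF_even h0 (hγa 0 hγ.zero_mem) hj, zero_add]
  refine ⟨c, hc, hc1, hc2, fun k hk hL => ?_⟩
  have hD := hdens k hk hL
  have hup : UnboundedQuot (fk γ k) c := unboundedQuot_of_exists_large fun n₀ j₀ hj₀ M =>
    hmass.exists_large hm (dyadicAdditive_dyadicInc _) hη hchild hc.1 hlow hD n₀ hj₀ M
  -- Unboundedness of |D/m| does not see the sign, so the one-sided argument applies to -f_k as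
  -- well.
  have hdown : UnboundedQuot (-fk γ k) c := unboundedQuot_of_exists_large fun n₀ j₀ hj₀ M =>
    hmass.exists_large hm (dyadicAdditive_dyadicInc _) hη hchild hc.1 hlow hD.neg n₀ hj₀ M
  refine ⟨fun x hx => (hs.contDiffAt_distF hx).of_le (by exact_mod_cast le_top), ?_,
    fun u v hu huv hv => ⟨supQuot_eq_top hup hu huv hv, infQuot_eq_bot hdown hu huv hv⟩,
    isMTNI_of_unboundedQuot (hup.one hc.2) (hdown.one hc.2)⟩
  filter_upwards [hmass.not_bddAbove_inc hlow hD, hmass.unit] with x hx hx1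
  exact limsup_eq_top_of_not_bddAbove hc.1 hx1.1 hx
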